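/- **Setting.** Let $(\mathfrak H,[\cdot,\cdot])$ be a Pontryagin space with negative index $\kappa$ and fundamental symmetry $J$, regarded as a Hilbert space with inner product $(f,g)=[Jf,g]$. Let $A\subset\mathfrak H\times\mathfrak H$ be a closed symmetric linear relation, $A\subset A^{[*]}$. *Rigging.* $\mathfrak H_+=\operatorname{dom}A^{[*]}$ with the norm $\|f\|_+^2=\|f\|^2+\|P_{\mathfrak H_0}Jf'\|^2$ for $(f,f')\in A^{[*]}$, where $\mathfrak H_0=\overline{\operatorname{dom}A}$. $\mathfrak H_-$ is the space of bounded conjugate linear functionals on $\mathfrak H_+$, with the duality $\langle\mathfrak f,h\rangle_{-,+}=\mathfrak f(h)$. A vector $f\in\mathfrak H$ is regarded as the element $h\mapsto[f,h]$ of $\mathfrak H_-$. The adjoints $T^{\langle*\rangle}$ are taken with respect to this duality, $[\cdot,\cdot]$, and the Euclidean inner product of $\mathbb C^p$. For a relation $T\subset A^{[*]}$ consider the set of all $(f,\mathfrak f')\in\mathfrak H\times\mathfrak H_-$ such that $\langle\mathfrak f',h\rangle_{-,+}=[f,h']$ for all $(h,h')\in T$. It is denoted by $A^{\langle*\rangle}$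 for $T=A$, and by $\mathbf A$ for $T=A^{[*]}$. *Boundary triple.* Let $(\mathbb C^p,\Gamma_0,\Gamma_1)$ be a boundary triple for $A^{[*]}$. That is, $\Gamma_j:A^{[*]}\to\mathbb C^p$ are linear, $(\Gamma_0,\Gamma_1):A^{[*]}\to\mathbb C^{2p}$ is surjective, and $[f',g]-[f,g']=(\Gamma_1\hat f,\Gamma_0\hat g)-(\Gamma_0\hat f,\Gamma_1\hat g)$ for $\hat f=(f,f'),\hat g=(g,g')\in A^{[*]}$. Let $(\mathbb C^p,\hat\Gamma_0,\hat\Gamma_1)$ be the corresponding extended boundary triple: $\hat\Gamma_j:A^{\langle*\rangle}\to\mathbb C^p$ are bounded linear continuations of $\Gamma_j$. Write $\hat\Gamma=\begin{bmatrix}\hat\Gamma_0\\ \hat\Gamma_1\end{bmatrix}$. Let $A_0=\ker\Gamma_0$, $R^0_\lambda=(A_0-\lambda)^{-1}$ for $\lambda\in\rho(A_0)$, and assume $\pm i\in\rho(A_0)$. Put $\widetilde R^0_\lambda=(R^0_{\bar\lambda})^{\langle*\rangle}:\mathfrak H_-\to\mathfrak H$, $\mathbf R=\tfrac12(R^0_i+R^0_{-i})$,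 $\widetilde{\mathbf R}=\mathbf R^{\langle*\rangle}$, $\hat R^0_\lambda=\widetilde R^0_\lambda-\widetilde{\mathbf R}$. For $\lambda\in\rho(A_0)$ let $\gamma(\lambda)$ and $M(\lambda)$ be the $\gamma$-field and the Weyl function: $\gamma(\lambda)\Gamma_0\hat f=f$ and $M(\lambda)\Gamma_0\hat f=\Gamma_1\hat f$ for $\hat f=(f,\lambda f)\in A^{[*]}$. *Gauge.* Let $\mathfrak L\subset\mathfrak H_-$ be a subspace with a linear homeomorphism $L:\mathbb C^p\to\mathfrak L$. Let $\rho(A,\mathfrak L)$ be the set of those $\lambda\in\mathbb C$ for which $\ker(A-\lambda)=\{0\}$, $\operatorname{ran}(A-\lambda)$ is closed, and $\mathfrak H_-=\operatorname{ran}(\mathbf A-\lambda)\dotplus\mathfrak L$. Assume $\rho(A,\mathfrak L)\neq\emptyset$. For $\lambda\in\rho(A,\mathfrak L)$ let $\Pi^\lambda$ be the projection onto $\mathfrak L$ parallel to $\operatorname{ran}(\mathbf A-\lambda)$, and put $$\mathcal P(\lambda)=L^{-1}\Pi^\lambda:\mathfrak H_-\to\mathbb C^p,\qquad \mathcal Q(\lambda)=L^{\langle*\rangle}\big((\mathbf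 A-\lambda)^{-1}(I-\Pi^\lambda)+\widetilde{\mathbf R}\,\Pi^\lambda\big):\mathfrak H\to\mathbb C^p,$$ $$\mathcal G(\lambda)=\begin{bmatrix}-\mathcal Q(\lambda)\\ \mathcal P(\lambda)\end{bmatrix}:\mathfrak H\to\mathbb C^{2p},\qquad \hat{\mathcal P}(\lambda)^{\langle*\rangle}=\begin{bmatrix}\mathcal P(\lambda)^{\langle*\rangle}\\ \bar\lambda\mathcal P(\lambda)^{\langle*\rangle}\end{bmatrix},\quad \hat{\mathcal Q}(\lambda)^{\langle*\rangle}=\begin{bmatrix}\mathcal Q(\lambda)^{\langle*\rangle}\\ \bar\lambda\mathcal Q(\lambda)^{\langle*\rangle}+L\end{bmatrix},$$ $\hat{\mathcal G}(\lambda)^{\langle*\rangle}=\big[-\hat{\mathcal Q}(\lambda)^{\langle*\rangle}\ \ \hat{\mathcal P}(\lambda)^{\langle*\rangle}\big]:\mathbb C^{2p}\to A^{\langle*\rangle}$, and $$\hat W(\lambda)=\big(\hat\Gamma(\hat{\mathcal G}(\lambda)^{\langle*\rangle})\big)^*=\begin{bmatrix}-\hat\Gamma_0\hat{\mathcal Q}(\lambda)^{\langle*\rangle}&\hat\Gamma_0\hat{\mathcal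 P}(\lambda)^{\langle*\rangle}\\-\hat\Gamma_1\hat{\mathcal Q}(\lambda)^{\langle*\rangle}&\hat\Gamma_1\hat{\mathcal P}(\lambda)^{\langle*\rangle}\end{bmatrix}^*,\qquad J_p=\begin{bmatrix}0&-iI_p\\ iI_p&0\end{bmatrix}.$$ *Kernel.* For $\lambda,\omega\in\rho(A,\mathfrak L)$ let $$\mathsf K_\omega(\lambda)=\frac{J_p-\hat W(\lambda)J_p\hat W(\omega)^*}{-i(\lambda-\bar\omega)}\quad(\lambda\ne\bar\omega),\qquad \mathsf K_\omega(\lambda)=-i\,\hat W'(\lambda)J_p\hat W(\omega)^*\quad(\lambda=\bar\omega).$$ For a non-empty open set $\Omega\subset\rho(A,\mathfrak L)$ write $\hat W\in\mathcal W_\kappa(J_p;\Omega)$ if $\hat W$ is holomorphic on $\Omega$ and $\mathsf K$ is a Hermitian kernel with exactly $\kappa$ negative squares on $\Omega$. **Theorem.** The operator $\mathcal Q(\lambda)$ can be computed from generalized resolvents. Let $\widetilde A$ be a selfadjoint extension of $A$ in a Pontryagin space $\widetilde{\mathfrak H}\supset\mathfrak H$, let $\mathbf R_\mu=P_{\mathfrak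 H}(\widetilde A-\mu)^{-1}|_{\mathfrak H}$ for $\mu\in\rho(\widetilde A)$, and let $\lambda\in\rho(A,\mathfrak L)\cap\rho(\widetilde A)$. Then $\mathcal Q(\lambda)=L^{\langle*\rangle}(\mathbf R_\lambda-\hat{\mathbf R}_\lambda\Pi^\lambda)$ with $\hat{\mathbf R}_\lambda=(\mathbf R_{\bar\lambda})^{\langle*\rangle}-\widetilde{\mathbf R}$. Moreover: (i) $\mathsf K_\omega(\lambda)=\mathcal G(\lambda)\mathcal G(\omega)^{\langle*\rangle}$ for all $\lambda,\omega\in\rho(A,\mathfrak L)$. (ii) Let $\mathfrak H_{\mathfrak A}$ be the closed linear span of the vectors $\gamma(\lambda)u+\widetilde R^0_\lambda Lv$ with $\lambda\in\rho(A_0)$, $u,v\in\mathbb C^p$. If the maximal dimension of negative definite subspaces of $\mathfrak H_{\mathfrak A}$ equals $\kappa$, then $\rho(A,\mathfrak L)$ is open and $\hat W\in\mathcal W_\kappa(J_p;\Omega)$ both for $\Omega=\rho(A,\mathfrak L)$ and for every non-empty open $\Omega\subset\rho(A,\mathfrak L)$. (iii) If $\lambda$ and $\bar\lambda$ belong to $\rho(A,\mathfrak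 L)$, then $\hat W(\lambda)$ is invertible. If, in addition, $\lambda\in\rho(A_0)$, then $\hat W(\lambda)$ coincides with the $\Pi\mathfrak L$-resolvent matrix $$W_{\Pi\mathfrak L}(\lambda)=\begin{bmatrix}\mathfrak a_{22}\mathfrak a_{12}^{-1}&\mathfrak a_{22}\mathfrak a_{12}^{-1}\mathfrak a_{11}-\mathfrak a_{21}\\ \mathfrak a_{12}^{-1}&\mathfrak a_{12}^{-1}\mathfrak a_{11}\end{bmatrix}(\lambda),\qquad \begin{bmatrix}\mathfrak a_{11}&\mathfrak a_{12}\\ \mathfrak a_{21}&\mathfrak a_{22}\end{bmatrix}(\lambda)=\begin{bmatrix}M(\lambda)&\gamma(\bar\lambda)^{\langle*\rangle}L\\ L^{\langle*\rangle}\gamma(\lambda)&L^{\langle*\rangle}\hat R^0_\lambda L\end{bmatrix}.$$ -/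

import Mathlib

open scoped ComplexConjugate InnerProductSpace

namespace LResolvent

noncomputable section

/-! ### Generic helpers -/

/-- The space `ℂ^p` with its Euclidean inner product. -/
abbrev Cp (p : ℕ) : Type := EuclideanSpace ℂ (Fin p)

section Helpers

variable {E : Type*} {F : Type*}

open Classical in
/-- A linear left inverse of an injective linear map (the inverse, if the map is bijective);
on the range of the map its values do not depend on any choice. -/
def leftInv [AddCommMonoid E] [Module ℂ E] [AddCommMonoid F] [Module ℂ F]
    (f : E →ₗ[ℂ] F) : F →ₗ[ℂ] E :=
  if h : ∃ g : F →ₗ[ℂ] E, g ∘ₗ f = LinearMap.id then h.choose else 0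

open Classical in
/-- A bounded (= continuous) linear map, viewed as a continuous linear map. -/
def toCLM [TopologicalSpace E] [AddCommMonoid E] [Module ℂ E]
    [TopologicalSpace F] [AddCommMonoid F] [Module ℂ F]
    (f : E →ₗ[ℂ] F) : E →L[ℂ] F :=
  if h : Continuous f then ⟨f, h⟩ else 0

open Classical in
/-- A linear map with values in the subspace `M`, viewed as a map into `M`. -/
def intoSub [AddCommMonoid E] [Module ℂ E] [AddCommMonoid F] [Module ℂ F]
    (M : Submodule ℂ F) (f : E →ₗ[ℂ] F) : E →ₗ[ℂ] M :=
  if h : ∀ x, f x ∈ M then f.codRestrict M h else 0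

/-- The matrix of a linear operator in `ℂ^p`. -/
def mat {p : ℕ} (T : Cp p →ₗ[ℂ] Cp p) : Matrix (Fin p) (Fin p) ℂ :=
  Matrix.of fun i j => T (EuclideanSpace.single j 1) i

/-- The `2p × 2p` block matrix of a linear operator in `ℂ^p × ℂ^p`. -/
def blockMat {p : ℕ} (T : (Cp p × Cp p) →ₗ[ℂ] (Cp p × Cp p)) :
    Matrix (Fin p ⊕ Fin p) (Fin p ⊕ Fin p) ℂ :=
  Matrix.fromBlocks
    (mat (LinearMap.fst ℂ _ _ ∘ₗ T ∘ₗ LinearMap.inl ℂ _ _))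
    (mat (LinearMap.fst ℂ _ _ ∘ₗ T ∘ₗ LinearMap.inr ℂ _ _))
    (mat (LinearMap.snd ℂ _ _ ∘ₗ T ∘ₗ LinearMap.inl ℂ _ _))
    (mat (LinearMap.snd ℂ _ _ ∘ₗ T ∘ₗ LinearMap.inr ℂ _ _))

end Helpers

/-! ### Linear relations in Pontryagin spaces -/

/-- A fundamental symmetry `J = P₊ - P₋` of the Hilbert space `H` whose negative eigenspace is
finite dimensional.  `H` with the indefinite inner product `[f, g] = (J f, g)` is a Pontryagin
space, and every Pontryagin space is of this form. -/
structure FundamentalSymmetry (H : Type*) [NormedAddCommGroup H] [InnerProductSpace ℂ H]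
    [CompleteSpace H] where
  J : H →L[ℂ] H
  symm : ∀ x y : H, ⟪J x, y⟫_ℂ = ⟪x, J y⟫_ℂ
  invol : ∀ x : H, J (J x) = x
  finite_neg : FiniteDimensional ℂ (LinearMap.ker (J + 1 : H →L[ℂ] H).toLinearMap)

section Relations

variable {H : Type*} [NormedAddCommGroup H] [InnerProductSpace ℂ H] [CompleteSpace H]

/-- The negative index `κ₋(H)` of the Pontryagin space. -/
def FundamentalSymmetry.negIndex (S : FundamentalSymmetry H) : ℕ :=
  Module.finrank ℂ (LinearMap.ker (S.J + 1 : H →L[ℂ] H).toLinearMap)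

/-- The indefinite inner product `[f, g]`, linear in `f` and conjugate linear in `g`
(Mathlib's `⟪·, ·⟫` is conjugate linear in its first argument). -/
def FundamentalSymmetry.ip (S : FundamentalSymmetry H) (f g : H) : ℂ := ⟪S.J g, f⟫_ℂ

/-- `κ₋(M) = k`: `k` is the largest dimension of a negative definite subspace of `M`. -/
def FundamentalSymmetry.HasNegIndex (S : FundamentalSymmetry H) (M : Submodule ℂ H) (k : ℕ) :
    Prop :=
  IsGreatest {n : ℕ | ∃ N : Submodule ℂ H, N ≤ M ∧ FiniteDimensional ℂ N ∧
    Module.finrank ℂ N = n ∧ ∀ x ∈ N, x ≠ 0 → (S.ip x x).re < 0} k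

/-- The adjoint relation `T^{[*]}` with respect to the indefinite inner product. -/
def adj (S : FundamentalSymmetry H) (T : Submodule ℂ (H × H)) : Submodule ℂ (H × H) where
  carrier := {x | ∀ y ∈ T, S.ip x.2 y.1 = S.ip x.1 y.2}
  add_mem' := by
    intro a b ha hb y hy
    simp only [FundamentalSymmetry.ip, Prod.fst_add, Prod.snd_add, inner_add_right] at *
    rw [ha y hy, hb y hy]
  zero_mem' := by
    intro y _
    simp [FundamentalSymmetry.ip]
  smul_mem' := by
    intro c a ha y hy
    simp only [FundamentalSymmetry.ip, Prod.smul_fst, Prod.smul_snd, inner_smul_right] at *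
    rw [ha y hy]

/-- The linear map `(f, f') ↦ f' - λ f` on a linear relation. -/
def minus (T : Submodule ℂ (H × H)) (lam : ℂ) : T →ₗ[ℂ] H :=
  (LinearMap.snd ℂ H H - lam • LinearMap.fst ℂ H H) ∘ₗ T.subtype

/-- The set `ρ(T)` of regular points of a (closed) linear relation:
`ker (T - λ) = {0}` and `ran (T - λ) = H`. -/
def regularPoints (T : Submodule ℂ (H × H)) : Set ℂ :=
  {lam | (∀ f : H, (f, lam • f) ∈ T → f = 0) ∧ LinearMap.range (minus T lam) = ⊤}

/-- The set `ρ̂(T)` of points of regular type: `ker (T - λ) = {0}` and `ran (T - λ)` is closed. -/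
def regularType (T : Submodule ℂ (H × H)) : Set ℂ :=
  {lam | (∀ f : H, (f, lam • f) ∈ T → f = 0) ∧
    IsClosed (LinearMap.range (minus T lam) : Set H)}

/-- The resolvent `(T - λ)⁻¹`, for `λ ∈ ρ(T)`. -/
def relResolvent (T : Submodule ℂ (H × H)) (lam : ℂ) : H →ₗ[ℂ] H :=
  LinearMap.fst ℂ H H ∘ₗ T.subtype ∘ₗ leftInv (minus T lam)

end Relations

/-! ### The rigging `H₊ ⊂ H ⊂ H₋` -/

section Rigging

variable {H : Type*} [NormedAddCommGroup H] [InnerProductSpace ℂ H] [CompleteSpace H]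
variable (S : FundamentalSymmetry H) (A : Submodule ℂ (H × H))

/-- `H₀`, the closure of `dom A`. -/
def domClosure : Submodule ℂ H := (A.map (LinearMap.fst ℂ H H)).topologicalClosure

instance : CompleteSpace (domClosure A) :=
  (Submodule.isClosed_topologicalClosure _).completeSpace_coe

/-- The map `(f, f') ↦ (f, P_{H₀} J f')`, into the Hilbert space `H ⊕ H`. -/
def graphMap : (H × H) →ₗ[ℂ] WithLp 2 (H × H) :=
  (WithLp.linearEquiv 2 ℂ (H × H)).symm.toLinearMap ∘ₗ
    (LinearMap.fst ℂ H H).prod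
      (((domClosure A).starProjection ∘L S.J).toLinearMap ∘ₗ LinearMap.snd ℂ H H)

/-- The Hilbert space `H₊ = dom A^{[*]}` with `‖f‖₊² = ‖f‖² + ‖P_{H₀} J f'‖²` for
`(f, f') ∈ A^{[*]}`.  As `P_{H₀} J f'` is determined by `f`, the vector `f` is stored as the pair
`(f, P_{H₀} J f')`, and the norm is that of the Hilbert space `H ⊕ H`. -/
abbrev HPlus : Type _ := ((adj S A).map (graphMap S A) : Submodule ℂ (WithLp 2 (H × H)))

/-- A pair `(f, g)` represents an element of `H₊` iff `g ∈ H₀` and `(g, v) = [f, w]` for all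
`(v, w) ∈ A`. -/
theorem mem_HPlus_iff (x : WithLp 2 (H × H)) :
    x ∈ (adj S A).map (graphMap S A) ↔
      x.snd ∈ domClosure A ∧ ∀ y ∈ A, ⟪y.1, x.snd⟫_ℂ = S.ip x.fst y.2 := by
  have key : ∀ y ∈ A, ∀ z : H,
      ⟪y.1, (domClosure A).starProjection z⟫_ℂ = ⟪y.1, z⟫_ℂ := by
    intro y hy z
    have hy1 : y.1 ∈ domClosure A :=
      Submodule.le_topologicalClosure _ ⟨y, hy, rfl⟩
    have h0 := (domClosure A).starProjection_inner_eq_zero z y.1 hy1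
    have h1 : ⟪y.1, z - (domClosure A).starProjection z⟫_ℂ = 0 := by
      rw [← inner_conj_symm, h0, map_zero]
    rw [inner_sub_right, sub_eq_zero] at h1
    exact h1.symm
  constructor
  · rintro ⟨f, hf, rfl⟩
    refine ⟨Submodule.starProjection_apply_mem _ _, fun y hy => ?_⟩
    have := hf y hy
    simp only [FundamentalSymmetry.ip] at this
    change ⟪y.1, (domClosure A).starProjection (S.J f.2)⟫_ℂ = ⟪S.J y.2, f.1⟫_ℂ
    rw [key y hy, ← S.symm, this]
  · rintro ⟨h1, h2⟩
    refine ⟨(x.fst, S.J x.snd), fun y hy => ?_, ?_⟩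
    · have := h2 y hy
      simp only [FundamentalSymmetry.ip] at this ⊢
      rw [S.symm, S.invol, this]
    · apply WithLp.ofLp_injective
      refine Prod.ext rfl ?_
      change (domClosure A).starProjection (S.J (S.J x.snd)) = x.snd
      rw [S.invol]
      exact Submodule.starProjection_eq_self_iff.2 h1

instance HPlus.completeSpace : CompleteSpace (HPlus S A) := by
  have : IsClosed (((adj S A).map (graphMap S A) : Submodule ℂ (WithLp 2 (H × H))) :
      Set (WithLp 2 (H × H))) := by
    have hset : (((adj S A).map (graphMap S A) : Submodule ℂ (WithLp 2 (H × H))) :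
        Set (WithLp 2 (H × H))) = {x | x.snd ∈ (domClosure A : Set H)} ∩
          ⋂ y ∈ A, {x : WithLp 2 (H × H) | ⟪y.1, x.snd⟫_ℂ = ⟪S.J y.2, x.fst⟫_ℂ} := by
      ext x
      simp only [SetLike.mem_coe, mem_HPlus_iff, Set.mem_inter_iff, Set.mem_ofPred_eq,
        Set.mem_iInter, FundamentalSymmetry.ip]
    have c1 : Continuous fun x : WithLp 2 (H × H) => x.fst := by fun_prop
    have c2 : Continuous fun x : WithLp 2 (H × H) => x.snd := by fun_prop
    rw [hset]
    refine IsClosed.inter ((Submodule.isClosed_topologicalClosure _).preimage c2) ?_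
    refine isClosed_biInter fun y _ => isClosed_eq ?_ ?_
    · exact continuous_const.inner c2
    · exact continuous_const.inner c1
  exact this.completeSpace_coe

/-- The inclusion `H₊ ⊂ H`. -/
def incl : HPlus S A →ₗ[ℂ] H where
  toFun x := (x : WithLp 2 (H × H)).fst
  map_add' _ _ := rfl
  map_smul' _ _ := rfl

open Classical in
/-- A linear map into `H` with values in `H₊`, viewed as a map into `H₊`. -/
def liftPlus {E : Type*} [AddCommMonoid E] [Module ℂ E] (T : E →ₗ[ℂ] H) : E →ₗ[ℂ] HPlus S A :=
  if h : ∃ R : E →ₗ[ℂ] HPlus S A, incl S A ∘ₗ R = T then h.choose else 0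

/-- The space `H₋` of bounded conjugate linear functionals on `H₊`; the duality is
`⟨𝔣, h⟩_{-,+} = 𝔣 h`. -/
abbrev HMinus : Type _ := HPlus S A →L⋆[ℂ] ℂ

/-- The canonical map `H → H₋`, which identifies `f` with the functional `h ↦ [f, h]`. -/
def iota : H →ₗ[ℂ] HMinus S A where
  toFun f := (innerSLFlip ℂ f).comp
    (S.J ∘L WithLp.fstL 2 ℂ H H ∘L ((adj S A).map (graphMap S A)).subtypeL)
  map_add' f g := by ext h; simp
  map_smul' c f := by ext h; simp

theorem iota_apply (f : H) (h : HPlus S A) : iota S A f h = S.ip f (incl S A h) := rfl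

/-- For bounded `G : K → H₊`, the dual adjoint `G^{⟨*⟩} : H₋ → K`, defined by
`(G^{⟨*⟩} 𝔣, ξ) = ⟨𝔣, G ξ⟩_{-,+}`. -/
def dualAdjOfPlus {K : Type*} [NormedAddCommGroup K] [InnerProductSpace ℂ K] [CompleteSpace K]
    (G : K →L[ℂ] HPlus S A) : HMinus S A →ₗ[ℂ] K where
  toFun f := (InnerProductSpace.toDual ℂ K).symm
    ((starL ℂ : ℂ ≃L⋆[ℂ] ℂ).toContinuousLinearMap.comp (f.comp G))
  map_add' f g := by
    rw [← map_add]; congr 1; ext x; simp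
  map_smul' c f := by
    apply ext_inner_right ℂ
    intro x
    simp [inner_smul_left]

theorem dualAdjOfPlus_spec {K : Type*} [NormedAddCommGroup K] [InnerProductSpace ℂ K]
    [CompleteSpace K] (G : K →L[ℂ] HPlus S A) (f : HMinus S A) (ξ : K) :
    ⟪ξ, dualAdjOfPlus S A G f⟫_ℂ = f (G ξ) := by
  rw [← inner_conj_symm]
  simp [dualAdjOfPlus]

/-- For bounded `G : K → H₋`, the dual adjoint `G^{⟨*⟩} : H₊ → K`, defined by
`(ξ, G^{⟨*⟩} h) = ⟨G ξ, h⟩_{-,+}`. -/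
def dualAdjOfMinus {K : Type*} [NormedAddCommGroup K] [InnerProductSpace ℂ K] [CompleteSpace K]
    (G : K →L[ℂ] HMinus S A) : HPlus S A →L[ℂ] K :=
  ((InnerProductSpace.toDual ℂ K).symm.toContinuousLinearEquiv.toContinuousLinearMap).comp G.flip

theorem dualAdjOfMinus_spec {K : Type*} [NormedAddCommGroup K] [InnerProductSpace ℂ K]
    [CompleteSpace K] (G : K →L[ℂ] HMinus S A) (h : HPlus S A) (ξ : K) :
    ⟪dualAdjOfMinus S A G h, ξ⟫_ℂ = G ξ h := by
  simp [dualAdjOfMinus]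

/-- For bounded `T : H₋ → K`, the dual adjoint `T^{⟨*⟩} : K → H₊`, defined by
`⟨𝔣, T^{⟨*⟩} ξ⟩_{-,+} = (T 𝔣, ξ)`. -/
def dualAdjFromMinus {K : Type*} [NormedAddCommGroup K] [InnerProductSpace ℂ K] [CompleteSpace K]
    (T : HMinus S A →L[ℂ] K) : K →L[ℂ] HPlus S A :=
  ContinuousLinearMap.adjoint (T ∘L (innerSLFlip ℂ : HPlus S A →L[ℂ] HMinus S A))

theorem dualAdjFromMinus_spec {K : Type*} [NormedAddCommGroup K] [InnerProductSpace ℂ K]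
    [CompleteSpace K] (T : HMinus S A →L[ℂ] K) (f : HMinus S A) (ξ : K) :
    f (dualAdjFromMinus S A T ξ) = ⟪ξ, T f⟫_ℂ := by
  obtain ⟨x, hx⟩ : ∃ x : HPlus S A, innerSLFlip ℂ x = f := by
    refine ⟨(InnerProductSpace.toDual ℂ _).symm
      ((starL ℂ : ℂ ≃L⋆[ℂ] ℂ).toContinuousLinearMap.comp f), ?_⟩
    ext y
    rw [innerSLFlip_apply_apply, ← inner_conj_symm, InnerProductSpace.toDual_symm_apply]
    simp
  subst hx
  rw [innerSLFlip_apply_apply, dualAdjFromMinus, ContinuousLinearMap.adjoint_inner_left]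
  rfl

/-- For bounded `T : H → K`, the adjoint `T^{[*]} : K → H`, defined by
`[f, T^{[*]} ξ] = (T f, ξ)`. -/
def hAdj {K : Type*} [NormedAddCommGroup K] [InnerProductSpace ℂ K] [CompleteSpace K]
    (T : H →L[ℂ] K) : K →L[ℂ] H :=
  S.J ∘L ContinuousLinearMap.adjoint T

/-- The relation in `H × H₋` adjoint to the relation `T ⊂ A^{[*]}`: all `(f, 𝔣')` with
`⟨𝔣', h⟩_{-,+} = [f, h']` whenever `(h, h') ∈ T`. -/
def dualRel (T : Submodule ℂ (H × H)) : Submodule ℂ (H × HMinus S A) where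
  carrier := {x | ∀ (h : HPlus S A) (h' : H), (incl S A h, h') ∈ T → x.2 h = S.ip x.1 h'}
  add_mem' := by
    intro a b ha hb h h' hh
    simp only [FundamentalSymmetry.ip, Prod.fst_add, Prod.snd_add, inner_add_right,
      add_apply] at *
    rw [ha h h' hh, hb h h' hh]
  zero_mem' := by
    intro h h' _
    simp [FundamentalSymmetry.ip]
  smul_mem' := by
    intro c a ha h h' hh
    simp only [FundamentalSymmetry.ip, Prod.smul_fst, Prod.smul_snd, inner_smul_right,
      smul_apply, smul_eq_mul] at *
    rw [ha h h' hh]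

/-- The relation `A^{⟨*⟩}` in `H × H₋`. -/
abbrev adjHat : Submodule ℂ (H × HMinus S A) := dualRel S A A

/-- The relation `𝐀` in `H × H₋`, the extension of `A`. -/
abbrev boldA : Submodule ℂ (H × HMinus S A) := dualRel S A (adj S A)

/-- The linear map `(f, 𝔣') ↦ 𝔣' - λ f` on `𝐀`. -/
def boldMinus (lam : ℂ) : boldA S A →ₗ[ℂ] HMinus S A :=
  (LinearMap.snd ℂ H (HMinus S A) - lam • (iota S A ∘ₗ LinearMap.fst ℂ H (HMinus S A))) ∘ₗ
    (boldA S A).subtype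

/-- The subspace `ran (𝐀 - λ)` of `H₋`. -/
def boldRange (lam : ℂ) : Submodule ℂ (HMinus S A) := LinearMap.range (boldMinus S A lam)

/-- The inverse `(𝐀 - λ)⁻¹ : ran (𝐀 - λ) → H`; only its values on `ran (𝐀 - λ)` matter. -/
def boldInv (lam : ℂ) : HMinus S A →ₗ[ℂ] H :=
  LinearMap.fst ℂ H (HMinus S A) ∘ₗ (boldA S A).subtype ∘ₗ leftInv (boldMinus S A lam)

/-- The set `ρ(A, 𝔏)` of `𝔏`-regular points: `H₋ = ran (𝐀 - λ) ∔ 𝔏`, `λ ∈ ρ̂(A)`. -/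
def gaugeRegular (L : Submodule ℂ (HMinus S A)) : Set ℂ :=
  {lam | lam ∈ regularType A ∧ IsCompl (boldRange S A lam) L}

/-- For an operator `R` in `H` with `ran R ⊂ H₊`, bounded from `H` to `H₊`, the operator
`R^{⟨*⟩} : H₋ → H`, defined by `[R^{⟨*⟩} 𝔣, h] = ⟨𝔣, R h⟩_{-,+}`. -/
def opDual (R : H →ₗ[ℂ] H) : HMinus S A →ₗ[ℂ] H :=
  S.J.toLinearMap ∘ₗ dualAdjOfPlus S A (toCLM (liftPlus S A R))

open Classical in
/-- The projection `Π_𝔏^λ` onto `𝔏` parallel to `ran (𝐀 - λ)`, for `λ ∈ ρ(A, 𝔏)`. -/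
def gaugeProj (L : Submodule ℂ (HMinus S A)) (lam : ℂ) : HMinus S A →ₗ[ℂ] L :=
  if h : IsCompl (boldRange S A lam) L then L.projectionOnto (boldRange S A lam) h.symm else 0

end Rigging

/-! ### Boundary triples -/

section Triples

variable {H : Type*} [NormedAddCommGroup H] [InnerProductSpace ℂ H] [CompleteSpace H]

/-- A boundary triple `(ℂ^p, Γ₀, Γ₁)` for `A^{[*]}`. -/
structure BoundaryTriple (S : FundamentalSymmetry H) (A : Submodule ℂ (H × H)) (p : ℕ) where
  Γ0 : adj S A →ₗ[ℂ] Cp p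
  Γ1 : adj S A →ₗ[ℂ] Cp p
  green : ∀ f g : adj S A,
    S.ip f.1.2 g.1.1 - S.ip f.1.1 g.1.2 = ⟪Γ0 g, Γ1 f⟫_ℂ - ⟪Γ1 g, Γ0 f⟫_ℂ
  surj : Function.Surjective (Γ0.prod Γ1)

/-- An extended boundary triple `(ℂ^p, Γ̂₀, Γ̂₁)` for `A^{⟨*⟩}`: the bounded continuation of a
boundary triple from `A^{[*]}` to `A^{⟨*⟩} ⊂ H × H₋`. -/
structure ExtendedBoundaryTriple (S : FundamentalSymmetry H) (A : Submodule ℂ (H × H)) (p : ℕ)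
    extends BoundaryTriple S A p where
  Γ0hat : adjHat S A →L[ℂ] Cp p
  Γ1hat : adjHat S A →L[ℂ] Cp p
  ext0 : ∀ (f : adj S A) (h : ((f : H × H).1, iota S A (f : H × H).2) ∈ adjHat S A),
    Γ0hat ⟨_, h⟩ = Γ0 f
  ext1 : ∀ (f : adj S A) (h : ((f : H × H).1, iota S A (f : H × H).2) ∈ adjHat S A),
    Γ1hat ⟨_, h⟩ = Γ1 f

/-- The embedding of `A^{[*]}` into `A^{⟨*⟩}`, so that the two extension conditions above are
about all of `A^{[*]}`. -/
theorem mem_adjHat (S : FundamentalSymmetry H) (A : Submodule ℂ (H × H)) (f : adj S A) :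
    ((f : H × H).1, iota S A (f : H × H).2) ∈ adjHat S A :=
  fun h h' hh => f.2 (incl S A h, h') hh

variable {S : FundamentalSymmetry H} {A : Submodule ℂ (H × H)} {p : ℕ}

namespace BoundaryTriple

variable (B : BoundaryTriple S A p)

/-- The selfadjoint extension `A₀ = ker Γ₀`. -/
def A0 : Submodule ℂ (H × H) := (LinearMap.ker B.Γ0).map (adj S A).subtype

/-- `N̂_λ`, the set of all `(f, λ f) ∈ A^{[*]}`. -/
def defect (_B : BoundaryTriple S A p) (lam : ℂ) : Submodule ℂ (adj S A) :=
  LinearMap.ker (minus (adj S A) lam)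

/-- `γ̂(λ) = (Γ₀ ↾ N̂_λ)⁻¹`, for `λ ∈ ρ(A₀)`. -/
def gammaHat (lam : ℂ) : Cp p →ₗ[ℂ] B.defect lam :=
  leftInv (B.Γ0 ∘ₗ (B.defect lam).subtype)

/-- The `γ`-field, `γ(λ) = π₁ γ̂(λ)`. -/
def gamma (lam : ℂ) : Cp p →ₗ[ℂ] H :=
  LinearMap.fst ℂ H H ∘ₗ (adj S A).subtype ∘ₗ (B.defect lam).subtype ∘ₗ B.gammaHat lam

/-- The `γ`-field as a bounded operator `ℂ^p → H₊`. -/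
def gammaPlus (lam : ℂ) : Cp p →L[ℂ] HPlus S A := toCLM (liftPlus S A (B.gamma lam))

/-- The Weyl function: `M(λ) Γ₀ f̂ = Γ₁ f̂` for `f̂ ∈ N̂_λ`, `λ ∈ ρ(A₀)`. -/
def weyl (lam : ℂ) : Cp p →ₗ[ℂ] Cp p :=
  B.Γ1 ∘ₗ (B.defect lam).subtype ∘ₗ B.gammaHat lam

/-- The resolvent `R_λ⁰ = (A₀ - λ)⁻¹`. -/
def res0 (lam : ℂ) : H →ₗ[ℂ] H := relResolvent B.A0 lam

/-- The extended resolvent `R̃_λ⁰ = (R_{λ̄}⁰)^{⟨*⟩} : H₋ → H`. -/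
def extRes0 (lam : ℂ) : HMinus S A →ₗ[ℂ] H := opDual S A (B.res0 (conj lam))

/-- The regularizing operator `𝐑 = (R_i⁰ + R_{-i}⁰) / 2`. -/
def regularizer : H →ₗ[ℂ] H := (1 / 2 : ℂ) • (B.res0 Complex.I + B.res0 (-Complex.I))

/-- The extended regularizing operator `𝐑̃ = 𝐑^{⟨*⟩} : H₋ → H`. -/
def extRegularizer : HMinus S A →ₗ[ℂ] H := opDual S A B.regularizer

/-- The regularized extended resolvent `R̂_λ⁰ = R̃_λ⁰ - 𝐑̃`. -/
def hatRes0 (lam : ℂ) : HMinus S A →ₗ[ℂ] H := B.extRes0 lam - B.extRegularizer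

end BoundaryTriple

/-! ### Generalized resolvents -/

/-- A selfadjoint extension of `A` in a possibly larger Pontryagin space `K ⊃ H`; the inclusion is
an isometry `V` for the indefinite inner products. -/
structure SelfAdjointExtension (S : FundamentalSymmetry H) (A : Submodule ℂ (H × H))
    (K : Type*) [NormedAddCommGroup K] [InnerProductSpace ℂ K] [CompleteSpace K] where
  SK : FundamentalSymmetry K
  V : H →L[ℂ] K
  isometry : ∀ x y : H, SK.ip (V x) (V y) = S.ip x y
  rel : Submodule ℂ (K × K)
  selfAdjoint : adj SK rel = rel
  extends_A : ∀ x ∈ A, (V x.1, V x.2) ∈ rel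

/-- The generalized resolvent `𝐑_λ = P_H (Ã - λ)⁻¹ ↾ H`; the orthogonal projection onto `H` is
the adjoint `V^{[*]} = J_H V* J_K` of the inclusion. -/
def SelfAdjointExtension.genRes {K : Type*} [NormedAddCommGroup K] [InnerProductSpace ℂ K]
    [CompleteSpace K] (X : SelfAdjointExtension S A K) (lam : ℂ) : H →ₗ[ℂ] H :=
  (S.J ∘L ContinuousLinearMap.adjoint X.V ∘L X.SK.J).toLinearMap ∘ₗ
    relResolvent X.rel lam ∘ₗ X.V.toLinearMap

/-! ### Gauges, the functions `𝒫`, `𝒬`, `𝒢` and `Ŵ` -/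

section Gauge

variable {𝔏 : Submodule ℂ (HMinus S A)} (L : Cp p ≃L[ℂ] 𝔏)

/-- `L` as an operator from `ℂ^p` to `H₋`. -/
def gaugeMap : Cp p →L[ℂ] HMinus S A :=
  𝔏.subtypeL ∘L L.toContinuousLinearMap

/-- `L^{⟨*⟩} : H₊ → ℂ^p`. -/
def Lstar : HPlus S A →L[ℂ] Cp p := dualAdjOfMinus S A (gaugeMap L)

/-- `𝒫(λ) = L⁻¹ Π_𝔏^λ : H₋ → ℂ^p`. -/
def calP (lam : ℂ) : HMinus S A →L[ℂ] Cp p :=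
  toCLM (L.symm.toContinuousLinearMap.toLinearMap ∘ₗ gaugeProj S A 𝔏 lam)

/-- `𝒫(λ)^{⟨*⟩} : ℂ^p → H₊`. -/
def calPstar (lam : ℂ) : Cp p →L[ℂ] HPlus S A := dualAdjFromMinus S A (calP L lam)

/-- `𝒫̂(λ)^{⟨*⟩} = col(𝒫(λ)^{⟨*⟩}, λ̄ 𝒫(λ)^{⟨*⟩})`. -/
def hatPstar (lam : ℂ) : Cp p →ₗ[ℂ] H × HMinus S A :=
  (incl S A ∘ₗ (calPstar L lam).toLinearMap).prod
    (conj lam • (iota S A ∘ₗ incl S A ∘ₗ (calPstar L lam).toLinearMap))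

end Gauge

namespace BoundaryTriple

variable (B : BoundaryTriple S A p) {𝔏 : Submodule ℂ (HMinus S A)} (L : Cp p ≃L[ℂ] 𝔏)

/-- `𝒬(λ) : H → ℂ^p`.  For a generalized resolvent `𝐑` that is holomorphic at `λ` one has
`𝒬(λ) = L^{⟨*⟩} (𝐑_λ - 𝐑̂_λ Π)` with `Π = Π_𝔏^λ`.  As the extended generalized resolvent `𝐑̃_λ`
coincides with `(𝐀 - λ)⁻¹` on `ran (𝐀 - λ)`, this is `L^{⟨*⟩} ((𝐀 - λ)⁻¹ (1 - Π) + 𝐑̃ Π)`, where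
`𝐑̃` is now the extended regularizing operator.  The last expression does not involve the
generalized resolvent, and it makes sense at every `λ ∈ ρ(A, 𝔏)`. -/
def calQ (lam : ℂ) : H →L[ℂ] Cp p :=
  toCLM ((Lstar L).toLinearMap ∘ₗ liftPlus S A
    ((boldInv S A lam ∘ₗ (LinearMap.id - 𝔏.subtype ∘ₗ gaugeProj S A 𝔏 lam) +
      B.extRegularizer ∘ₗ 𝔏.subtype ∘ₗ gaugeProj S A 𝔏 lam) ∘ₗ iota S A))

/-- `𝒬(λ)^{⟨*⟩} = 𝒬(λ)^{[*]} : ℂ^p → H`. -/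
def calQstar (lam : ℂ) : Cp p →L[ℂ] H := hAdj S (B.calQ L lam)

/-- The expression `L^{⟨*⟩} (𝐑_λ - 𝐑̂_λ Π_𝔏^λ)` for the generalized resolvent of a selfadjoint
extension of `A`, where `𝐑̂_λ = (𝐑_{λ̄})^{⟨*⟩} - 𝐑̃` is the regularized extended generalized
resolvent. -/
def Qgen {K : Type*} [NormedAddCommGroup K] [InnerProductSpace ℂ K] [CompleteSpace K]
    (X : SelfAdjointExtension S A K) (lam : ℂ) : H →ₗ[ℂ] Cp p :=
  (Lstar L).toLinearMap ∘ₗ liftPlus S A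
    (X.genRes lam - (opDual S A (X.genRes (conj lam)) - B.extRegularizer) ∘ₗ
      𝔏.subtype ∘ₗ gaugeProj S A 𝔏 lam ∘ₗ iota S A)

/-- `𝒢(λ) = col(-𝒬(λ), 𝒫(λ)) : H → ℂ^p × ℂ^p`. -/
def G (lam : ℂ) : H →ₗ[ℂ] Cp p × Cp p :=
  (-(B.calQ L lam).toLinearMap).prod ((calP L lam).toLinearMap ∘ₗ iota S A)

/-- `𝒢(λ)^{⟨*⟩} = (-𝒬(λ)^{⟨*⟩}, 𝒫(λ)^{⟨*⟩}) : ℂ^p × ℂ^p → H`. -/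
def Gstar (lam : ℂ) : Cp p × Cp p →ₗ[ℂ] H :=
  (-(B.calQstar L lam).toLinearMap).coprod (incl S A ∘ₗ (calPstar L lam).toLinearMap)

/-- `𝒬̂(λ)^{⟨*⟩} = col(𝒬(λ)^{⟨*⟩}, λ̄ 𝒬(λ)^{⟨*⟩} + L)`. -/
def hatQstar (lam : ℂ) : Cp p →ₗ[ℂ] H × HMinus S A :=
  (B.calQstar L lam).toLinearMap.prod
    (conj lam • (iota S A ∘ₗ (B.calQstar L lam).toLinearMap) + (gaugeMap L).toLinearMap)

/-- `𝒢̂(λ)^{⟨*⟩} = (-𝒬̂(λ)^{⟨*⟩}, 𝒫̂(λ)^{⟨*⟩})`, whose values lie in `A^{⟨*⟩}`. -/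
def GhatStar (lam : ℂ) : Cp p × Cp p →ₗ[ℂ] adjHat S A :=
  intoSub (adjHat S A) ((-(B.hatQstar L lam)).coprod (hatPstar L lam))

/-- The subspace `H_𝔄`, the closed linear span of the ranges of
`T(λ) = [γ(λ)  R̃_λ⁰ L]`, `λ ∈ ρ(A₀)`. -/
def HA : Submodule ℂ H :=
  (Submodule.span ℂ {x : H | ∃ lam ∈ regularPoints B.A0, ∃ u v : Cp p,
    x = B.gamma lam u + B.extRes0 lam (gaugeMap L v)}).topologicalClosure

/-- The block `𝔞₁₁(λ) = M(λ)` of the `Π𝔏`-preresolvent matrix. -/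
def a11 (lam : ℂ) : Matrix (Fin p) (Fin p) ℂ := mat (B.weyl lam)

/-- The block `𝔞₁₂(λ) = γ(λ̄)^{⟨*⟩} L`. -/
def a12 (lam : ℂ) : Matrix (Fin p) (Fin p) ℂ :=
  mat (dualAdjOfPlus S A (B.gammaPlus (conj lam)) ∘ₗ (gaugeMap L).toLinearMap)

/-- The block `𝔞₂₁(λ) = L^{⟨*⟩} γ(λ)`. -/
def a21 (lam : ℂ) : Matrix (Fin p) (Fin p) ℂ :=
  mat ((Lstar L).toLinearMap ∘ₗ (B.gammaPlus lam).toLinearMap)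

/-- The block `𝔞₂₂(λ) = L^{⟨*⟩} R̂_λ⁰ L`; the operator `R̂_λ⁰` maps `H₋` into `H₊`. -/
def a22 (lam : ℂ) : Matrix (Fin p) (Fin p) ℂ :=
  mat ((Lstar L).toLinearMap ∘ₗ liftPlus S A (B.hatRes0 lam) ∘ₗ (gaugeMap L).toLinearMap)

/-- The `Π𝔏`-resolvent matrix `W_{Π𝔏}(λ)`, for `λ ∈ ρ(A, 𝔏) ∩ ρ(A₀)`. -/
def resolventMatrix (lam : ℂ) : Matrix (Fin p ⊕ Fin p) (Fin p ⊕ Fin p) ℂ :=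
  Matrix.fromBlocks
    (B.a22 L lam * (B.a12 L lam)⁻¹)
    (B.a22 L lam * (B.a12 L lam)⁻¹ * B.a11 lam - B.a21 L lam)
    ((B.a12 L lam)⁻¹)
    ((B.a12 L lam)⁻¹ * B.a11 lam)

end BoundaryTriple

/-- `Ŵ(λ) = (Γ̂ (𝒢̂(λ)^{⟨*⟩}))^*`, for `λ ∈ ρ(A, 𝔏)`. -/
def ExtendedBoundaryTriple.What (B : ExtendedBoundaryTriple S A p)
    {𝔏 : Submodule ℂ (HMinus S A)} (L : Cp p ≃L[ℂ] 𝔏) (lam : ℂ) :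
    Matrix (Fin p ⊕ Fin p) (Fin p ⊕ Fin p) ℂ :=
  (blockMat ((B.Γ0hat.toLinearMap.prod B.Γ1hat.toLinearMap) ∘ₗ
    B.toBoundaryTriple.GhatStar L lam)).conjTranspose

end Triples

/-! ### Kernels with negative squares and the class `𝒲_κ(J_p)` -/

/-- The matrix `[u_k^* K_{ω_j}(ω_k) u_j]_{j,k}`. -/
def gramMatrix {m : Type*} [Fintype m] (K : ℂ → ℂ → Matrix m m ℂ) {n : ℕ}
    (ω : Fin n → ℂ) (x : Fin n → m → ℂ) : Matrix (Fin n) (Fin n) ℂ :=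
  Matrix.of fun j k => star (x k) ⬝ᵥ Matrix.mulVec (K (ω j) (ω k)) (x j)

/-- The number of negative eigenvalues of a Hermitian matrix, with multiplicities. -/
def negEigenvalues {n : ℕ} {M : Matrix (Fin n) (Fin n) ℂ} (hM : M.IsHermitian) : ℕ :=
  (Finset.univ.filter fun i => hM.eigenvalues i < 0).card

/-- The Hermitian kernel `K_ω(λ)`, written `K ω λ`, has `κ` negative squares on `Ω`. -/
def HasNegSquares {m : Type*} [Fintype m] (K : ℂ → ℂ → Matrix m m ℂ) (Ω : Set ℂ) (κ : ℕ) : Prop :=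
  (∀ ω ∈ Ω, ∀ lam ∈ Ω, (K ω lam).conjTranspose = K lam ω) ∧
  (∀ (n : ℕ) (ω : Fin n → ℂ) (x : Fin n → m → ℂ), (∀ j, ω j ∈ Ω) →
    ∃ h : (gramMatrix K ω x).IsHermitian, negEigenvalues h ≤ κ) ∧
  (∃ (n : ℕ) (ω : Fin n → ℂ) (x : Fin n → m → ℂ), 0 < n ∧ (∀ j, ω j ∈ Ω) ∧
    ∃ h : (gramMatrix K ω x).IsHermitian, negEigenvalues h = κ)

/-- The matrix `J_p`. -/
def Jp (p : ℕ) : Matrix (Fin p ⊕ Fin p) (Fin p ⊕ Fin p) ℂ :=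
  Matrix.fromBlocks 0 (-Complex.I • 1) (Complex.I • 1) 0

/-- The kernel `K_ω(λ) = (J_p - W(λ) J_p W(ω)^*) / (-i (λ - ω̄))`, written `kernelW W ω λ`, with its
limit value `-i W'(λ) J_p W(ω)^*` at `λ = ω̄`. -/
def kernelW {p : ℕ} (W : ℂ → Matrix (Fin p ⊕ Fin p) (Fin p ⊕ Fin p) ℂ) (ω lam : ℂ) :
    Matrix (Fin p ⊕ Fin p) (Fin p ⊕ Fin p) ℂ :=
  if lam = conj ω then
    -Complex.I • ((Matrix.of fun i j => deriv (fun z => W z i j) lam) * Jp p *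
      (W ω).conjTranspose)
  else
    (-Complex.I * (lam - conj ω))⁻¹ • (Jp p - W lam * Jp p * (W ω).conjTranspose)

/-- The class `𝒲_κ(J_p)` on the open set `Ω`: `W` is holomorphic on `Ω` and the kernel
`K_ω(λ)` has `κ` negative squares on `Ω`. -/
def InClassW {p : ℕ} (κ : ℕ) (W : ℂ → Matrix (Fin p ⊕ Fin p) (Fin p ⊕ Fin p) ℂ) (Ω : Set ℂ) :
    Prop :=
  IsOpen Ω ∧ Ω.Nonempty ∧ (∀ i j, DifferentiableOn ℂ (fun z => W z i j) Ω) ∧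
    HasNegSquares (kernelW W) Ω κ

end

end LResolvent

open LResolvent

set_option linter.unusedSectionVars false
set_option maxSynthPendingDepth 4

namespace LResolvent

noncomputable section

section

/-! ### Generic helpers -/

section Helpers

variable {E : Type*} {F : Type*}

/-! The relation 𝐀 is the graph of a bounded operator from H₀ to H₋ (`mem_boldA_iff`). Hence λ ∈
ρ(A, 𝔏) exactly when (f, v) ↦ (𝐀 - λ)f + Lv is invertible from H₀ × ℂ^p onto H₋. So ρ(A, 𝔏) is open,
and the two components (𝐀 - λ)⁻¹(I - Π) and L⁻¹Π of the inverse are holomorphic. Pairing the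
decomposition x = (𝐀 - λ)f + Lv with elements of A^{[*]} (`boldRes_spec`) gives the formula for 𝒬 by
generalized resolvents.

Factorization. With 𝐑' = (i/2)(R̃_i - R̃_{-i}), every 𝔣 ∈ H₋ yields an element (𝐑̃𝔣, 𝐑'𝔣 + 𝔣) of
A^{⟨*⟩} on which Γ̂₀ vanishes, and subtracting it turns an element with singular part 𝔣 into one of
A^{[*]}. Since [𝐑̃𝔣, 𝐑'𝔤] = [𝐑'𝔣, 𝐑̃𝔤], no products of singular parts survive in the resulting
identity `green_regularized`. Apply it to 𝒢̂(ω)^{⟨*⟩}v and 𝒢̂(λ)^{⟨*⟩}w: the singular parts are -Lv₁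
and -Lw₁, and L^{⟨*⟩} of the regular parts is v₂ and w₂ (`Lstar_Gstar`), which produces J_p. This is
`Jp_sub`; at λ = ω̄ it is differentiated. It also gives invertibility: J_p = Ŵ(λ) J_p Ŵ(λ̄)^*. For
the resolvent matrix, the columns of 𝒢̂(λ)^{⟨*⟩} are written through the γ-field and the extended
resolvent at λ̄.

Negative squares. The kernel is a Gram kernel of the vectors 𝒢(ω)^{⟨*⟩}b, so it never has more than
κ negative squares. It has κ if the orthogonal complement of these vectors, the common kernel N of
all 𝒢(ω), is positive (`exists_negative_subspace`). Now N is invariant under the resolvents of A.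
For a nonreal ω in Ω the Cayley transform I + (ω - ω̄)(A - ω)⁻¹ is isometric on N. If N had a
nonzero nonpositive vector, this isometry would have a nonpositive eigenvector
(`exists_nonpos_eigenvector`). Such an eigenvector is an eigenvector, or a multivalued direction, of
A annihilated by L^{⟨*⟩}, hence orthogonal to H_𝔄 (`ip_HA_eq_zero`). But H_𝔄 has negative index κ,
so nonzero vectors orthogonal to it are positive, a contradiction. -/

theorem leftInv_apply_of_injective [AddCommGroup E] [Module ℂ E] [AddCommGroup F] [Module ℂ F]
    (f : E →ₗ[ℂ] F) (hf : Function.Injective f) (x : E) : leftInv f (f x) = x := by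
  have h : ∃ g : F →ₗ[ℂ] E, g ∘ₗ f = LinearMap.id :=
    f.exists_leftInverse_of_injective (LinearMap.ker_eq_bot.2 hf)
  rw [leftInv, dif_pos h]
  exact LinearMap.congr_fun h.choose_spec x

theorem toCLM_coe [TopologicalSpace E] [AddCommMonoid E] [Module ℂ E]
    [TopologicalSpace F] [AddCommMonoid F] [Module ℂ F] (f : E →L[ℂ] F) :
    toCLM f.toLinearMap = f := by
  have h : Continuous f.toLinearMap := f.continuous
  rw [toCLM, dif_pos h]

theorem toCLM_eq [TopologicalSpace E] [AddCommMonoid E] [Module ℂ E]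
    [TopologicalSpace F] [AddCommMonoid F] [Module ℂ F] {f : E →ₗ[ℂ] F} (g : E →L[ℂ] F)
    (h : ∀ x, f x = g x) : toCLM f = g := by
  have : f = g.toLinearMap := LinearMap.ext h
  rw [this, toCLM_coe]

theorem intoSub_coe [AddCommMonoid E] [Module ℂ E] [AddCommMonoid F] [Module ℂ F]
    (M : Submodule ℂ F) (f : E →ₗ[ℂ] F) (h : ∀ x, f x ∈ M) (x : E) :
    (intoSub M f x : F) = f x := by
  rw [intoSub, dif_pos h]
  rfl

/-- A bounded functional that separates a point from a closed subspace. -/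
theorem exists_functional_of_notMem [NormedAddCommGroup E] [NormedSpace ℂ E] {M : Submodule ℂ E}
    (hM : IsClosed (M : Set E)) {x : E} (hx : x ∉ M) :
    ∃ f : E →L[ℂ] ℂ, f x ≠ 0 ∧ ∀ a ∈ M, f a = 0 := by
  have : IsClosed (M : Set E) := hM
  have hne : M.mkQ x ≠ 0 := by simpa using hx
  obtain ⟨g, hg⟩ := SeparatingDual.exists_ne_zero (R := ℂ) hne
  refine ⟨g ∘L M.mkQL, hg, fun a ha => ?_⟩
  have : M.mkQ a = 0 := by simpa using ha
  change g (M.mkQ a) = 0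
  rw [this, map_zero]

end Helpers

/-! ### The indefinite inner product -/

section Relations

variable {H : Type*} [NormedAddCommGroup H] [InnerProductSpace ℂ H] [CompleteSpace H]

namespace FundamentalSymmetry

variable (S : FundamentalSymmetry H)

theorem conj_ip (f g : H) : conj (S.ip f g) = S.ip g f := by
  rw [ip, ip, inner_conj_symm, S.symm]

theorem ip_add_left (f g h : H) : S.ip (f + g) h = S.ip f h + S.ip g h := by
  simp [ip]

theorem ip_sub_left (f g h : H) : S.ip (f - g) h = S.ip f h - S.ip g h := by
  simp [ip]

theorem ip_neg_left (f h : H) : S.ip (-f) h = - S.ip f h := by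
  simp [ip]

theorem ip_smul_left (c : ℂ) (f h : H) : S.ip (c • f) h = c * S.ip f h := by
  simp [ip]

theorem ip_zero_left (h : H) : S.ip 0 h = 0 := by simp [ip]

theorem ip_add_right (f g h : H) : S.ip f (g + h) = S.ip f g + S.ip f h := by
  simp [ip]

theorem ip_sub_right (f g h : H) : S.ip f (g - h) = S.ip f g - S.ip f h := by
  simp [ip]

theorem ip_neg_right (f g : H) : S.ip f (-g) = - S.ip f g := by
  simp [ip]

theorem ip_smul_right (c : ℂ) (f h : H) : S.ip f (c • h) = conj c * S.ip f h := by
  simp [ip, mul_comm]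

theorem ip_J_left (f g : H) : S.ip (S.J f) g = ⟪g, f⟫_ℂ := by
  rw [ip, S.symm, S.invol]

theorem ip_J_right (f g : H) : S.ip f (S.J g) = ⟪g, f⟫_ℂ := by
  rw [ip, S.invol]

theorem eq_of_ip {f g : H} (h : ∀ x, S.ip f x = S.ip g x) : f = g := by
  refine ext_inner_left ℂ fun x => ?_
  rw [← S.ip_J_right, ← S.ip_J_right, h]

theorem continuous_ip {X : Type*} [TopologicalSpace X] {f g : X → H} (hf : Continuous f)
    (hg : Continuous g) : Continuous fun x => S.ip (f x) (g x) :=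
  (S.J.continuous.comp hg).inner hf

theorem ip_hAdj {K : Type*} [NormedAddCommGroup K] [InnerProductSpace ℂ K] [CompleteSpace K]
    (T : H →L[ℂ] K) (f : H) (ξ : K) : S.ip f (hAdj S T ξ) = ⟪ξ, T f⟫_ℂ := by
  simp only [hAdj, ContinuousLinearMap.comp_apply, ip_J_right]
  rw [ContinuousLinearMap.adjoint_inner_left]

end FundamentalSymmetry

/-! ### Selfadjoint relations -/

variable (S : FundamentalSymmetry H)

theorem isClosed_adj (T : Submodule ℂ (H × H)) : IsClosed (adj S T : Set (H × H)) := by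
  have : (adj S T : Set (H × H)) =
      ⋂ y ∈ T, {x : H × H | S.ip x.2 y.1 = S.ip x.1 y.2} := by
    ext x
    simp only [Set.mem_iInter]
    rfl
  rw [this]
  refine isClosed_biInter fun y _ => isClosed_eq ?_ ?_
  · exact S.continuous_ip continuous_snd continuous_const
  · exact S.continuous_ip continuous_fst continuous_const

/-- A closed relation is its own second adjoint. -/
theorem mem_of_mem_adj_adj {A : Submodule ℂ (H × H)} (hA : IsClosed (A : Set (H × H)))
    {x : H × H} (hx : x ∈ adj S (adj S A)) : x ∈ A := by
  by_contra hxA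
  obtain ⟨f, hfx, hfA⟩ := exists_functional_of_notMem hA hxA
  let a := (InnerProductSpace.toDual ℂ H).symm (f ∘L ContinuousLinearMap.inl ℂ H H)
  let b := (InnerProductSpace.toDual ℂ H).symm (f ∘L ContinuousLinearMap.inr ℂ H H)
  have hf : ∀ y : H × H, f y = ⟪a, y.1⟫_ℂ + ⟪b, y.2⟫_ℂ := by
    intro y
    simp only [a, b, InnerProductSpace.toDual_symm_apply, ContinuousLinearMap.comp_apply,
      ContinuousLinearMap.inl_apply, ContinuousLinearMap.inr_apply]
    rw [← map_add]
    simp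
  -- A functional (a, b) that annihilates A, rotated and multiplied by J, is an element of A^{[*]}.
  -- Pairing x with it shows that the functional vanishes at x.
  have hab : (S.J b, -S.J a) ∈ adj S A := by
    intro y hy
    have h1 := hfA y hy
    rw [hf] at h1
    have h2 := congrArg conj h1
    simp only [map_add, inner_conj_symm, map_zero] at h2
    simp only [S.ip_neg_left, S.ip_J_left]
    linear_combination -h2
  have h3 := hx _ hab
  simp only [S.ip_neg_right, S.ip_J_right] at h3
  apply hfx
  rw [hf]
  linear_combination h3

/-- `f' - λ f`, for `(f, f')` in the relation. -/
theorem minus_apply (T : Submodule ℂ (H × H)) (lam : ℂ) (x : T) :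
    minus T lam x = x.1.2 - lam • x.1.1 := rfl

theorem minus_injective {T : Submodule ℂ (H × H)} {lam : ℂ}
    (h : ∀ f : H, (f, lam • f) ∈ T → f = 0) : Function.Injective (minus T lam) := by
  rw [← LinearMap.ker_eq_bot, LinearMap.ker_eq_bot']
  rintro ⟨⟨f, f'⟩, hf⟩ h0
  rw [minus_apply, sub_eq_zero] at h0
  simp only at h0
  subst h0
  have := h f hf
  subst this
  ext <;> simp

section Resolvent

variable {S} {T : Submodule ℂ (H × H)} {lam : ℂ}

theorem relResolvent_minus (h : lam ∈ regularPoints T) {x : H × H} (hx : x ∈ T) :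
    relResolvent T lam (x.2 - lam • x.1) = x.1 := by
  have : x.2 - lam • x.1 = minus T lam ⟨x, hx⟩ := rfl
  rw [relResolvent, this]
  simp only [LinearMap.comp_apply]
  rw [leftInv_apply_of_injective _ (minus_injective h.1)]
  rfl

theorem relResolvent_mem (h : lam ∈ regularPoints T) (k : H) :
    (relResolvent T lam k, k + lam • relResolvent T lam k) ∈ T := by
  obtain ⟨⟨x, hx⟩, rfl⟩ := LinearMap.range_eq_top.1 h.2 k
  have h1 := relResolvent_minus h hx
  rw [minus_apply, h1]
  simpa using hx

/-- The resolvent of a closed relation is bounded. -/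
theorem continuous_relResolvent (hT : IsClosed (T : Set (H × H))) (h : lam ∈ regularPoints T) :
    Continuous (relResolvent T lam) := by
  have : CompleteSpace T := hT.completeSpace_coe
  let m : T →L[ℂ] H :=
    (ContinuousLinearMap.snd ℂ H H - lam • ContinuousLinearMap.fst ℂ H H) ∘L T.subtypeL
  have hm : ∀ x, m x = minus T lam x := fun _ => rfl
  have hinj : LinearMap.ker m.toLinearMap = ⊥ := by
    rw [LinearMap.ker_eq_bot]; exact minus_injective h.1
  have hsurj : LinearMap.range m.toLinearMap = ⊤ := h.2
  let e := ContinuousLinearEquiv.ofBijective m hinj hsurj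
  have : ⇑(relResolvent T lam) = fun k => ((e.symm k : T) : H × H).1 := by
    funext k
    obtain ⟨x, rfl⟩ := e.surjective k
    rw [e.symm_apply_apply]
    exact relResolvent_minus h x.2
  rw [this]
  fun_prop

/-- The resolvent of a closed relation as a bounded operator. -/
theorem exists_resolventL (hT : IsClosed (T : Set (H × H))) (h : lam ∈ regularPoints T) :
    ∃ R : H →L[ℂ] H, ∀ k, R k = relResolvent T lam k :=
  ⟨⟨relResolvent T lam, continuous_relResolvent hT h⟩, fun _ => rfl⟩

/-- The set of regular points of a selfadjoint relation is symmetric. -/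
theorem conj_mem_regularPoints (hT : adj S T = T) (h : lam ∈ regularPoints T) :
    conj lam ∈ regularPoints T := by
  have hcl : IsClosed (T : Set (H × H)) := hT ▸ isClosed_adj S T
  refine ⟨fun f hf => ?_, ?_⟩
  -- An eigenvector at λ̄ is orthogonal to ran (T - λ), which is the whole space.
  · have key : ∀ k, S.ip f k = 0 := by
      intro k
      have hk := relResolvent_mem h k
      rw [← hT] at hf
      have := hf _ hk
      simp only [S.ip_smul_left, S.ip_add_right, S.ip_smul_right] at this
      linear_combination -this
    exact S.eq_of_ip fun x => by rw [key, S.ip_zero_left]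
  · rw [LinearMap.range_eq_top]
    intro k
    obtain ⟨R, hR⟩ := exists_resolventL hcl h
    -- The indefinite adjoint of R_λ, applied to k; it must be the resolvent at λ̄.
    let f : H := S.J (ContinuousLinearMap.adjoint R (S.J k))
    have hf : ∀ x, S.ip f x = S.ip k (R x) := by
      intro x
      rw [S.ip_J_left, ContinuousLinearMap.adjoint_inner_right, FundamentalSymmetry.ip, S.symm]
    have hmem : (f, k + conj lam • f) ∈ T := by
      rw [← hT]
      intro y hy
      have h1 := hf (y.2 - lam • y.1)
      rw [hR, relResolvent_minus h hy] at h1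
      simp only [S.ip_sub_right, S.ip_smul_right] at h1
      simp only [S.ip_add_left, S.ip_smul_left]
      linear_combination -h1
    refine ⟨⟨_, hmem⟩, ?_⟩
    rw [minus_apply]
    simp

/-- `[R_λ k, x] = [k, R_λ̄ x]`. -/
theorem ip_relResolvent (hT : adj S T = T) (h : lam ∈ regularPoints T) (k x : H) :
    S.ip (relResolvent T lam k) x = S.ip k (relResolvent T (conj lam) x) := by
  have h1 : (relResolvent T lam k, k + lam • relResolvent T lam k) ∈ adj S T := by
    rw [hT]
    exact relResolvent_mem h k
  have h2 := relResolvent_mem (conj_mem_regularPoints hT h) x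
  have := h1 _ h2
  simp only [S.ip_add_left, S.ip_smul_left, S.ip_add_right, S.ip_smul_right,
    Complex.conj_conj] at this
  linear_combination -this

/-- The resolvent identity, in the form `R_λ R_μ = R_μ R_λ`. -/
theorem relResolvent_comm {mu : ℂ} (h : lam ∈ regularPoints T) (h' : mu ∈ regularPoints T)
    (k : H) : relResolvent T lam (relResolvent T mu k) =
      relResolvent T mu (relResolvent T lam k) := by
  by_cases hne : lam = mu
  · rw [hne]
  have h1 := relResolvent_mem h k
  have h2 := relResolvent_mem h' k
  -- The first component R_λ k - R_μ k of one element of T is recovered by either resolvent, as (λ -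
  -- μ)R_λR_μ k or as (λ - μ)R_μR_λ k.
  have h3 := relResolvent_minus h (T.sub_mem h1 h2)
  have h4 := relResolvent_minus h' (T.sub_mem h1 h2)
  simp only [Prod.fst_sub, Prod.snd_sub] at h3 h4
  have e3 : k + lam • relResolvent T lam k - (k + mu • relResolvent T mu k) -
      lam • (relResolvent T lam k - relResolvent T mu k) = (lam - mu) • relResolvent T mu k := by
    module
  have e4 : k + lam • relResolvent T lam k - (k + mu • relResolvent T mu k) -
      mu • (relResolvent T lam k - relResolvent T mu k) = (lam - mu) • relResolvent T lam k := by
    module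
  rw [e3, map_smul] at h3
  rw [e4, map_smul] at h4
  have h5 : lam - mu ≠ 0 := sub_ne_zero.2 hne
  exact smul_right_injective H h5 (h3.trans h4.symm)

end Resolvent

end Relations

end

section

/-! ### The rigging -/

section Rigging

variable {H : Type*} [NormedAddCommGroup H] [InnerProductSpace ℂ H] [CompleteSpace H]
variable {S : FundamentalSymmetry H} {A : Submodule ℂ (H × H)}

theorem HPlus.snd_mem (x : HPlus S A) : (x : WithLp 2 (H × H)).snd ∈ domClosure A :=
  ((mem_HPlus_iff S A x).1 x.2).1

theorem HPlus.inner_snd (x : HPlus S A) {y : H × H} (hy : y ∈ A) :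
    ⟪y.1, (x : WithLp 2 (H × H)).snd⟫_ℂ = S.ip (incl S A x) y.2 :=
  ((mem_HPlus_iff S A x).1 x.2).2 y hy

theorem fst_mem_domClosure {x : H × H} (hx : x ∈ A) : x.1 ∈ domClosure A :=
  Submodule.le_topologicalClosure _ ⟨x, hx, rfl⟩

theorem eq_zero_of_mem_domClosure {x : H} (hx : x ∈ domClosure A)
    (h : ∀ y ∈ A, ⟪y.1, x⟫_ℂ = 0) : x = 0 := by
  have : x ∈ (A.map (LinearMap.fst ℂ H H))ᗮ := by
    rw [Submodule.mem_orthogonal]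
    rintro _ ⟨y, hy, rfl⟩
    exact h y hy
  have h2 : x ∈ (domClosure A)ᗮ := by
    rw [domClosure, Submodule.orthogonal_closure]
    exact this
  have h3 := (Submodule.mem_orthogonal _ _).1 h2 x hx
  exact inner_self_eq_zero.1 h3

theorem mem_domClosure_of_inner {x : H}
    (h : ∀ z : H, (∀ y ∈ A, ⟪y.1, z⟫_ℂ = 0) → ⟪z, x⟫_ℂ = 0) : x ∈ domClosure A := by
  rw [domClosure, ← Submodule.orthogonal_orthogonal_eq_closure, Submodule.mem_orthogonal]
  intro z hz
  refine h z fun y hy => ?_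
  exact (Submodule.mem_orthogonal _ _).1 hz y.1 ⟨y, hy, rfl⟩

/-- If the first entry vanishes, the second one is orthogonal to dom A and also lies in its closure
H₀. Hence P_{H₀}Jf' depends on f alone, even if A^{[*]} is multivalued. -/
theorem incl_injective : Function.Injective (incl S A) := by
  rw [← LinearMap.ker_eq_bot, LinearMap.ker_eq_bot']
  intro x hx
  have h1 : (x : WithLp 2 (H × H)).fst = 0 := hx
  have h2 : (x : WithLp 2 (H × H)).snd = 0 := by
    refine eq_zero_of_mem_domClosure x.snd_mem fun y hy => ?_
    rw [x.inner_snd hy, hx, S.ip_zero_left]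
  apply Subtype.ext
  apply WithLp.ofLp_injective
  exact Prod.ext h1 h2

/-- The inclusion `H₊ ⊂ H` as a bounded operator. -/
def inclL : HPlus S A →L[ℂ] H :=
  WithLp.fstL 2 ℂ H H ∘L ((adj S A).map (graphMap S A) : Submodule ℂ (WithLp 2 (H × H))).subtypeL

variable (S A) in
/-- The vector `f`, viewed as an element of `H₊`, as a bounded function of `(f, f') ∈ A^{[*]}`;
it is extended to all of `H × H` by an orthogonal projection. -/
def plus : H × H →L[ℂ] HPlus S A :=
  ((adj S A).map (graphMap S A) : Submodule ℂ (WithLp 2 (H × H))).orthogonalProjectionOnto ∘L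
    (WithLp.prodContinuousLinearEquiv 2 ℂ H H).symm.toContinuousLinearMap ∘L
    (ContinuousLinearMap.fst ℂ H H).prod
      (((domClosure A).starProjection ∘L S.J) ∘L ContinuousLinearMap.snd ℂ H H)

theorem plus_coe {x : H × H} (hx : x ∈ adj S A) :
    (plus S A x : WithLp 2 (H × H)) = graphMap S A x := by
  have h : graphMap S A x ∈ (adj S A).map (graphMap S A) := ⟨x, hx, rfl⟩
  exact congrArg Subtype.val (Submodule.orthogonalProjectionOnto_mem_subspace_eq_self
    (K := (adj S A).map (graphMap S A)) ⟨_, h⟩)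

theorem incl_plus {x : H × H} (hx : x ∈ adj S A) : incl S A (plus S A x) = x.1 := by
  change (plus S A x : WithLp 2 (H × H)).fst = x.1
  rw [plus_coe hx]
  rfl

theorem eq_plus {h : HPlus S A} {x : H × H} (hx : x ∈ adj S A) (hh : incl S A h = x.1) :
    h = plus S A x := incl_injective (by rw [hh, incl_plus hx])

theorem exists_adj (h : HPlus S A) : ∃ h' : H, (incl S A h, h') ∈ adj S A := by
  obtain ⟨x, hx, hxh⟩ := h.2
  refine ⟨x.2, ?_⟩
  have : incl S A h = x.1 := by
    change (h : WithLp 2 (H × H)).fst = x.1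
    rw [← hxh]
    rfl
  rw [this]
  exact hx

theorem liftPlus_eq {E : Type*} [AddCommMonoid E] [Module ℂ E] {T : E →ₗ[ℂ] H}
    (R : E →ₗ[ℂ] HPlus S A) (h : ∀ x, incl S A (R x) = T x) : liftPlus S A T = R := by
  have hex : ∃ R : E →ₗ[ℂ] HPlus S A, incl S A ∘ₗ R = T := ⟨R, LinearMap.ext h⟩
  rw [liftPlus, dif_pos hex]
  refine LinearMap.ext fun x => incl_injective ?_
  rw [h]
  exact LinearMap.congr_fun hex.choose_spec x

theorem norm_iota_le (f : H) :
    ‖iota S A f‖ ≤ ‖S.J ∘L (inclL : HPlus S A →L[ℂ] H)‖ * ‖f‖ := by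
  refine ContinuousLinearMap.opNorm_le_bound _
    (mul_nonneg (ContinuousLinearMap.opNorm_nonneg _) (norm_nonneg _)) fun h => ?_
  have h1 : ‖iota S A f h‖ ≤ ‖S.J (inclL h)‖ * ‖f‖ := norm_inner_le_norm _ _
  have h2 := (S.J ∘L (inclL : HPlus S A →L[ℂ] H)).le_opNorm h
  rw [ContinuousLinearMap.comp_apply] at h2
  nlinarith [norm_nonneg f]

/-- The canonical map `H → H₋` as a bounded operator. -/
def iotaL : H →L[ℂ] HMinus S A :=
  ⟨iota S A, AddMonoidHomClass.continuous_of_bound (iota S A) _ norm_iota_le⟩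

/-- Every bounded functional on `H₋` is the evaluation at an element of `H₊`. -/
theorem exists_eval (φ : HMinus S A →L[ℂ] ℂ) : ∃ a : HPlus S A, ∀ f, φ f = f a := by
  refine ⟨dualAdjFromMinus S A φ 1, fun f => ?_⟩
  rw [dualAdjFromMinus_spec]
  simp

/-- `H` is dense in `H₋`. -/
theorem denseRange_iota : DenseRange (iota S A) := by
  have hcl : IsClosed ((LinearMap.range (iota S A)).topologicalClosure : Set (HMinus S A)) :=
    Submodule.isClosed_topologicalClosure _
  intro f
  by_contra hf
  obtain ⟨φ, h1, h2⟩ := exists_functional_of_notMem (x := f) hcl hf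
  obtain ⟨a, ha⟩ := exists_eval φ
  have h3 : ∀ x, S.ip x (incl S A a) = 0 := by
    intro x
    rw [← iota_apply, ← ha]
    exact h2 _ (Submodule.le_topologicalClosure _ ⟨x, rfl⟩)
  have h4 : a = 0 := by
    apply incl_injective
    rw [map_zero]
    refine S.eq_of_ip fun x => ?_
    rw [← S.conj_ip, h3, S.ip_zero_left, map_zero]
  apply h1
  rw [ha, h4, map_zero]

/-! ### The relation 𝐀 as a bounded operator from H₀ to H₋ -/

variable (S A) in
/-- The operator `𝐀`, `⟨𝐀 f, h⟩_{-,+} = (f, P_{H₀} J h')`, defined on all of `H`. -/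
def boldOp : H →L[ℂ] HMinus S A :=
  LinearMap.mkContinuous
    { toFun := fun f => (innerSLFlip ℂ f).comp (WithLp.sndL 2 ℂ H H ∘L
        ((adj S A).map (graphMap S A) : Submodule ℂ (WithLp 2 (H × H))).subtypeL)
      map_add' := fun f g => by ext h; simp
      map_smul' := fun c f => by ext h; simp }
    ‖WithLp.sndL 2 ℂ H H ∘L
      ((adj S A).map (graphMap S A) : Submodule ℂ (WithLp 2 (H × H))).subtypeL‖ (fun f => by
      refine ContinuousLinearMap.opNorm_le_bound _ (by positivity) fun h => ?_
      refine (norm_inner_le_norm (𝕜 := ℂ) (h : WithLp 2 (H × H)).snd f).trans ?_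
      have h2 := (WithLp.sndL 2 ℂ H H ∘L
        ((adj S A).map (graphMap S A) : Submodule ℂ (WithLp 2 (H × H))).subtypeL).le_opNorm h
      change ‖(h : WithLp 2 (H × H)).snd‖ ≤ _ at h2
      nlinarith [norm_nonneg f])

theorem boldOp_apply (f : H) (h : HPlus S A) :
    boldOp S A f h = ⟪(h : WithLp 2 (H × H)).snd, f⟫_ℂ := rfl

theorem HPlus.snd_eq (h : HPlus S A) {h' : H} (hh : (incl S A h, h') ∈ adj S A) :
    (h : WithLp 2 (H × H)).snd = (domClosure A).starProjection (S.J h') := by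
  rw [eq_plus hh rfl, plus_coe hh]
  rfl

/-- `⟨𝐀 f, h⟩_{-,+} = [f, h']` for `f ∈ H₀`. -/
theorem boldOp_apply_adj {f : H} (hf : f ∈ domClosure A) {h : HPlus S A} {h' : H}
    (hh : (incl S A h, h') ∈ adj S A) : boldOp S A f h = S.ip f h' := by
  rw [boldOp_apply, h.snd_eq hh, FundamentalSymmetry.ip]
  rw [Submodule.inner_starProjection_left_eq_right, Submodule.starProjection_eq_self_iff.2 hf]

/-- The relation `𝐀` is the graph of the restriction of `boldOp` to `H₀`. -/
theorem mem_boldA_iff {x : H × HMinus S A} :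
    x ∈ boldA S A ↔ x.1 ∈ domClosure A ∧ x.2 = boldOp S A x.1 := by
  constructor
  · intro hx
    have h1 : x.1 ∈ domClosure A := by
      refine mem_domClosure_of_inner fun z hz => ?_
      -- Elements (0, Jz) with z ⟂ dom A form the multivalued part of A^{[*]}; testing against them
      -- forces the first entry into H₀.
      have hz' : (incl S A 0, S.J z) ∈ adj S A := by
        intro y hy
        rw [map_zero, S.ip_zero_left, S.ip_J_left, hz y hy]
      have := hx 0 _ hz'
      rwa [map_zero, S.ip_J_right, eq_comm] at this
    refine ⟨h1, ?_⟩
    ext h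
    obtain ⟨h', hh⟩ := exists_adj h
    rw [boldOp_apply_adj h1 hh]
    exact hx h h' hh
  · rintro ⟨h1, h2⟩ h h' hh
    rw [h2]
    exact boldOp_apply_adj h1 hh

/-- After passage to H₋ the operator 𝐀 extends A. The multivalued part of A is annihilated by
`iota`, as (0, f') ∈ A gives `iota` f' = 𝐀0 = 0. -/
theorem boldOp_eq_iota {x : H × H} (hx : x ∈ A) : boldOp S A x.1 = iota S A x.2 := by
  ext h
  obtain ⟨h', hh⟩ := exists_adj h
  rw [boldOp_apply_adj (fst_mem_domClosure hx) hh, iota_apply]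
  have := hh x hx
  simp only at this
  rw [← S.conj_ip, this, S.conj_ip]

/-- If `𝐀 f` belongs to `H`, then `(f, 𝐀 f) ∈ A`. -/
theorem mem_of_boldOp_eq_iota (hA : IsClosed (A : Set (H × H))) {f f' : H}
    (hf : f ∈ domClosure A) (h : boldOp S A f = iota S A f') : (f, f') ∈ A := by
  refine mem_of_mem_adj_adj S hA fun y hy => ?_
  have h1 := boldOp_apply_adj (S := S) (A := A) hf (h := plus S A y) (h' := y.2)
    (by rw [incl_plus hy]; exact hy)
  rw [h, iota_apply, incl_plus hy] at h1
  exact h1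

theorem mem_adjHat_of_adj {x : H × H} (hx : x ∈ adj S A) : (x.1, iota S A x.2) ∈ adjHat S A :=
  mem_adjHat S A ⟨x, hx⟩

theorem mem_adj_of_adjHat {x : H × H} (hsymm : A ≤ adj S A)
    (hx : (x.1, iota S A x.2) ∈ adjHat S A) : x ∈ adj S A := by
  intro y hy
  have h := hx (plus S A y) y.2 (by rw [incl_plus (hsymm hy)]; exact hy)
  rw [iota_apply, incl_plus (hsymm hy)] at h
  exact h

/-! ### Dual adjoints of operators in `H` -/

/-- The defining relation of R^{⟨*⟩}. A bounded factorization R' through H₊ guarantees that the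
default values in `liftPlus` and `toCLM` do not occur. -/
theorem ip_opDual {R : H →ₗ[ℂ] H} (R' : H →L[ℂ] HPlus S A) (hR : ∀ x, incl S A (R' x) = R x)
    (f : HMinus S A) (k : H) : S.ip (opDual S A R f) k = f (R' k) := by
  have h1 : toCLM (liftPlus S A R) = R' := by
    rw [liftPlus_eq R'.toLinearMap hR, toCLM_coe]
  rw [opDual, h1, LinearMap.comp_apply]
  change S.ip (S.J _) k = _
  rw [S.ip_J_left, dualAdjOfPlus_spec]

theorem continuous_dualAdjOfPlus {K : Type*} [NormedAddCommGroup K] [InnerProductSpace ℂ K]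
    [CompleteSpace K] (G : K →L[ℂ] HPlus S A) : Continuous (dualAdjOfPlus S A G) := by
  refine AddMonoidHomClass.continuous_of_bound (dualAdjOfPlus S A G) ‖G‖ fun f => ?_
  have h := dualAdjOfPlus_spec S A G f (dualAdjOfPlus S A G f)
  rw [inner_self_eq_norm_sq_to_K] at h
  have h1 : ‖dualAdjOfPlus S A G f‖ ^ 2 ≤ ‖f‖ * (‖G‖ * ‖dualAdjOfPlus S A G f‖) := by
    have h2 : ‖dualAdjOfPlus S A G f‖ ^ 2 = ‖f (G (dualAdjOfPlus S A G f))‖ := by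
      rw [← h]
      simp
    rw [h2]
    exact (f.le_opNorm _).trans (by gcongr; exact G.le_opNorm _)
  by_contra! hlt
  have h3 : 0 < ‖dualAdjOfPlus S A G f‖ := lt_of_le_of_lt (by positivity) hlt
  nlinarith

theorem continuous_opDual (R : H →ₗ[ℂ] H) : Continuous (opDual S A R) :=
  S.J.continuous.comp (continuous_dualAdjOfPlus _)

end Rigging

end

section

/-! ### Regular points of a gauge -/

section Gauge

variable {H : Type*} [NormedAddCommGroup H] [InnerProductSpace ℂ H] [CompleteSpace H]
variable {S : FundamentalSymmetry H} {A : Submodule ℂ (H × H)} {p : ℕ}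
variable {𝔏 : Submodule ℂ (HMinus S A)} (L : Cp p ≃L[ℂ] 𝔏)

theorem mem_boldRange_iff {lam : ℂ} {y : HMinus S A} :
    y ∈ boldRange S A lam ↔ ∃ f ∈ domClosure A, boldOp S A f - lam • iota S A f = y := by
  constructor
  · rintro ⟨⟨x, hx⟩, rfl⟩
    have h := mem_boldA_iff.1 hx
    exact ⟨x.1, h.1, by rw [← h.2]; rfl⟩
  · rintro ⟨f, hf, rfl⟩
    exact ⟨⟨(f, boldOp S A f), mem_boldA_iff.2 ⟨hf, rfl⟩⟩, rfl⟩

/-- The operator `(f, v) ↦ (𝐀 - λ) f + L v` from `H₀ × ℂ^p` to `H₋`. -/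
def gaugeOp (lam : ℂ) : (domClosure A × Cp p) →L[ℂ] HMinus S A :=
  ((boldOp S A - lam • iotaL) ∘L (domClosure A).subtypeL).coprod (gaugeMap L)

theorem gaugeOp_apply (lam : ℂ) (x : domClosure A × Cp p) : gaugeOp L lam x =
    boldOp S A (x.1 : H) - lam • iota S A (x.1 : H) + gaugeMap L x.2 := rfl

theorem gaugeMap_apply (v : Cp p) : gaugeMap L v = (L v : HMinus S A) := rfl

theorem gaugeMap_injective : Function.Injective (gaugeMap L) := fun _ _ h =>
  L.injective (Subtype.ext h)

theorem mem_gauge_iff {y : HMinus S A} : y ∈ 𝔏 ↔ ∃ v, gaugeMap L v = y :=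
  ⟨fun h => ⟨L.symm ⟨y, h⟩, by simp [gaugeMap_apply]⟩, by rintro ⟨v, rfl⟩; exact (L v).2⟩

variable (S) in
theorem eq_zero_of_boldOp_eq (hA : IsClosed (A : Set (H × H))) {lam : ℂ}
    (h : ∀ f : H, (f, lam • f) ∈ A → f = 0) {f : H} (hf : f ∈ domClosure A)
    (h0 : boldOp S A f - lam • iota S A f = 0) : f = 0 := by
  refine h f (mem_of_boldOp_eq_iota hA hf (S := S) ?_)
  rw [map_smul]
  exact sub_eq_zero.1 h0

/-- The sum ran (𝐀 - λ) ∔ 𝔏 being direct separates the two summands, and 𝐀 - λ is injective because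
a solution of 𝐀f = λf in H₋ is an eigenvector of the closed relation A itself. -/
theorem gaugeOp_bijective (hA : IsClosed (A : Set (H × H))) {lam : ℂ}
    (h : lam ∈ gaugeRegular S A 𝔏) : Function.Bijective (gaugeOp L lam) := by
  obtain ⟨⟨hker, -⟩, hc⟩ := h
  constructor
  · rw [injective_iff_map_eq_zero]
    rintro ⟨⟨f, hf⟩, v⟩ h0
    rw [gaugeOp_apply] at h0
    have h1 : gaugeMap L v ∈ boldRange S A lam := by
      rw [eq_neg_of_add_eq_zero_right h0]
      exact Submodule.neg_mem _ (mem_boldRange_iff.2 ⟨f, hf, rfl⟩)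
    have h2 : gaugeMap L v = 0 :=
      (Submodule.disjoint_def.1 hc.disjoint) _ h1 ((mem_gauge_iff L).2 ⟨v, rfl⟩)
    have h3 : v = 0 := gaugeMap_injective L (by rw [h2, map_zero])
    rw [h2, add_zero] at h0
    have h4 : f = 0 := eq_zero_of_boldOp_eq S hA hker hf h0
    subst h3 h4
    rfl
  · intro y
    have : y ∈ boldRange S A lam ⊔ 𝔏 := by rw [hc.sup_eq_top]; trivial
    obtain ⟨a, ha, b, hb, rfl⟩ := Submodule.mem_sup.1 this
    obtain ⟨f, hf, rfl⟩ := mem_boldRange_iff.1 ha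
    obtain ⟨v, rfl⟩ := (mem_gauge_iff L).1 hb
    exact ⟨(⟨f, hf⟩, v), rfl⟩

theorem gaugeOp_isInvertible (hA : IsClosed (A : Set (H × H))) {lam : ℂ}
    (h : lam ∈ gaugeRegular S A 𝔏) : (gaugeOp L lam).IsInvertible := by
  obtain ⟨h1, h2⟩ := gaugeOp_bijective L hA h
  have hker : LinearMap.ker (gaugeOp L lam).toLinearMap = ⊥ := LinearMap.ker_eq_bot.2 h1
  have hran : LinearMap.range (gaugeOp L lam).toLinearMap = ⊤ := LinearMap.range_eq_top.2 h2
  exact ⟨ContinuousLinearEquiv.ofBijective _ hker hran, rfl⟩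

theorem isCompl_of_isInvertible {lam : ℂ} (h : (gaugeOp L lam).IsInvertible) :
    IsCompl (boldRange S A lam) 𝔏 := by
  obtain ⟨e, he⟩ := h
  have he' : ∀ x, e x = gaugeOp L lam x := fun x => by rw [← he]; rfl
  constructor
  · rw [Submodule.disjoint_def]
    intro y hy1 hy2
    obtain ⟨f, hf, rfl⟩ := mem_boldRange_iff.1 hy1
    obtain ⟨v, hv⟩ := (mem_gauge_iff L).1 hy2
    have h1 : e (⟨f, hf⟩, 0) = e (0, v) := by
      rw [he', he', gaugeOp_apply, gaugeOp_apply, hv]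
      simp
    have h2 := congrArg Prod.snd (e.injective h1)
    simp only at h2
    rw [← hv, ← h2, map_zero]
  · rw [codisjoint_iff, eq_top_iff]
    intro y _
    obtain ⟨⟨f, v⟩, hfv⟩ := e.surjective y
    rw [← hfv, he', gaugeOp_apply]
    exact Submodule.add_mem_sup (mem_boldRange_iff.2 ⟨f, f.2, rfl⟩)
      ((mem_gauge_iff L).2 ⟨v, rfl⟩)

/-- On elements of A the operator `gaugeOp` acts as A - λ, so its bounded inverse gives the lower
bound. This recovers λ ∈ ρ̂(A) from invertibility alone, as needed to show that ρ(A, 𝔏) is open. -/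
theorem exists_bound_of_isInvertible {lam : ℂ} (h : (gaugeOp L lam).IsInvertible) :
    ∃ C : ℝ, ∀ x ∈ A, ‖x.1‖ ≤ C * ‖x.2 - lam • x.1‖ := by
  obtain ⟨e, he⟩ := h
  have he' : ∀ x, e x = gaugeOp L lam x := fun x => by rw [← he]; rfl
  let T : H →L[ℂ] domClosure A := ContinuousLinearMap.fst ℂ _ _ ∘L
    e.symm.toContinuousLinearMap ∘L iotaL
  obtain ⟨C, -, hC⟩ := T.bound
  refine ⟨C, fun x hx => ?_⟩
  have h1 : e (⟨x.1, fst_mem_domClosure hx⟩, 0) = iota S A (x.2 - lam • x.1) := by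
    rw [he', gaugeOp_apply, map_zero, add_zero, map_sub, map_smul]
    rw [boldOp_eq_iota hx]
  have h2 : T (x.2 - lam • x.1) = ⟨x.1, fst_mem_domClosure hx⟩ := by
    change (e.symm (iota S A (x.2 - lam • x.1))).1 = _
    rw [← h1, e.symm_apply_apply]
  have h3 := hC (x.2 - lam • x.1)
  rw [h2] at h3
  exact h3

/-- The range of a relation that is bounded from below is closed. -/
theorem isClosed_range_minus {T : Submodule ℂ (H × H)} (hT : IsClosed (T : Set (H × H))) {lam : ℂ}
    {C : ℝ} (hC : ∀ x ∈ T, ‖x.1‖ ≤ C * ‖x.2 - lam • x.1‖) :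
    IsClosed (LinearMap.range (minus T lam) : Set H) := by
  have : CompleteSpace T := hT.completeSpace_coe
  let m : T →L[ℂ] H :=
    (ContinuousLinearMap.snd ℂ H H - lam • ContinuousLinearMap.fst ℂ H H) ∘L T.subtypeL
  have hm : ∀ x : T, m x = x.1.2 - lam • x.1.1 := fun _ => rfl
  -- This dominates the constants for both entries: ‖f‖ ≤ C‖f' - λf‖ and ‖f'‖ ≤ (1 + |λ|C)‖f' - λf‖.
  -- The maximum with 1 covers a negative C.
  let C' : NNReal := ⟨max C 1 + ‖lam‖ * max C 1 + 1, by positivity⟩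
  have hanti : AntilipschitzWith C' m := by
    refine AddMonoidHomClass.antilipschitz_of_bound m fun x => ?_
    have h1 := hC x.1 x.2
    rw [← hm] at h1
    have h2 : ‖x.1.1‖ ≤ max C 1 * ‖m x‖ :=
      h1.trans (mul_le_mul_of_nonneg_right (le_max_left _ _) (norm_nonneg _))
    have h3 : ‖x.1.2‖ ≤ ‖m x‖ + ‖lam‖ * ‖x.1.1‖ := by
      have : x.1.2 = m x + lam • x.1.1 := by rw [hm]; abel
      calc ‖x.1.2‖ = ‖m x + lam • x.1.1‖ := by rw [← this]
        _ ≤ _ := by rw [← norm_smul]; exact norm_add_le _ _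
    have h4 : ‖lam‖ * ‖x.1.1‖ ≤ ‖lam‖ * (max C 1 * ‖m x‖) :=
      mul_le_mul_of_nonneg_left h2 (norm_nonneg _)
    have h5 : (C' : ℝ) * ‖m x‖ =
        max C 1 * ‖m x‖ + ‖lam‖ * (max C 1 * ‖m x‖) + ‖m x‖ := by
      change (max C 1 + ‖lam‖ * max C 1 + 1) * ‖m x‖ = _
      ring
    rw [h5]
    have h6 : (0 : ℝ) ≤ max C 1 * ‖m x‖ := by positivity
    have h7 : (0 : ℝ) ≤ ‖lam‖ * (max C 1 * ‖m x‖) := by positivity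
    refine max_le ?_ ?_
    · change ‖x.1.1‖ ≤ _
      linarith [norm_nonneg (m x)]
    · change ‖x.1.2‖ ≤ _
      linarith
  have := hanti.isClosed_range m.uniformContinuous
  exact this

theorem mem_gaugeRegular_of_isInvertible (hA : IsClosed (A : Set (H × H))) {lam : ℂ}
    (h : (gaugeOp L lam).IsInvertible) : lam ∈ gaugeRegular S A 𝔏 := by
  obtain ⟨C, hC⟩ := exists_bound_of_isInvertible L h
  refine ⟨⟨fun f hf => ?_, isClosed_range_minus hA hC⟩, isCompl_of_isInvertible L h⟩
  have := hC _ hf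
  simp only [sub_self, norm_zero, mul_zero, norm_le_zero_iff] at this
  exact this

theorem differentiable_gaugeOp : Differentiable ℂ (fun z => gaugeOp L z) := by
  have : (fun z => gaugeOp L z) = fun z =>
      (boldOp S A ∘L (domClosure A).subtypeL).coprod (gaugeMap L) -
        z • (iotaL ∘L (domClosure A).subtypeL).coprod (0 : Cp p →L[ℂ] HMinus S A) := by
    funext z
    ext x
    · simp [gaugeOp]
    · simp [gaugeOp]
  rw [this]
  exact (differentiable_const _).sub (differentiable_id.smul_const _)

/-- The set `ρ(A, 𝔏)` is open. -/
theorem isOpen_gaugeRegular (hA : IsClosed (A : Set (H × H))) (L : Cp p ≃L[ℂ] 𝔏) :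
    IsOpen (gaugeRegular S A 𝔏) := by
  have h1 : gaugeRegular S A 𝔏 = (fun z => gaugeOp L z) ⁻¹'
      Set.range ((↑) : ((domClosure A × Cp p) ≃L[ℂ] HMinus S A) → _) := by
    ext z
    exact ⟨fun h => gaugeOp_isInvertible L hA h, fun h => mem_gaugeRegular_of_isInvertible L hA h⟩
  rw [h1]
  exact (ContinuousLinearEquiv.isOpen (𝕜 := ℂ)).preimage (differentiable_gaugeOp L).continuous

/-- The inverse of `gaugeOp`. -/
def gaugeInv (lam : ℂ) : HMinus S A →L[ℂ] (domClosure A × Cp p) := (gaugeOp L lam).inverse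

theorem differentiableAt_gaugeInv (hA : IsClosed (A : Set (H × H))) {lam : ℂ}
    (h : lam ∈ gaugeRegular S A 𝔏) : DifferentiableAt ℂ (fun z => gaugeInv L z) lam := by
  have h1 := (gaugeOp_isInvertible L hA h).contDiffAt_map_inverse (𝕜 := ℂ) (n := 1)
  exact (h1.differentiableAt one_ne_zero).comp lam (differentiable_gaugeOp L lam)

/-- The component `(𝐀 - λ)⁻¹ (1 - Π)` of the inverse of `gaugeOp`. -/
def boldRes (lam : ℂ) : HMinus S A →L[ℂ] H :=
  (domClosure A).subtypeL ∘L ContinuousLinearMap.fst ℂ _ _ ∘L gaugeInv L lam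

/-- The component `L⁻¹ Π` of the inverse of `gaugeOp`. -/
def gaugeCoord (lam : ℂ) : HMinus S A →L[ℂ] Cp p :=
  ContinuousLinearMap.snd ℂ _ _ ∘L gaugeInv L lam

theorem boldRes_mem (lam : ℂ) (x : HMinus S A) : boldRes L lam x ∈ domClosure A :=
  (gaugeInv L lam x).1.2

section

variable (hA : IsClosed (A : Set (H × H))) {lam : ℂ} (h : lam ∈ gaugeRegular S A 𝔏)

include hA h

theorem gauge_decomp (x : HMinus S A) : boldOp S A (boldRes L lam x) -
    lam • iota S A (boldRes L lam x) + gaugeMap L (gaugeCoord L lam x) = x :=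
  (gaugeOp_isInvertible L hA h).self_apply_inverse x

theorem gauge_unique {f : H} (hf : f ∈ domClosure A) {v : Cp p} {x : HMinus S A}
    (hx : boldOp S A f - lam • iota S A f + gaugeMap L v = x) :
    boldRes L lam x = f ∧ gaugeCoord L lam x = v := by
  have h1 : gaugeInv L lam x = (⟨f, hf⟩, v) := by
    rw [← hx]
    exact (gaugeOp_isInvertible L hA h).inverse_apply_self (⟨f, hf⟩, v)
  constructor
  · change ((gaugeInv L lam x).1 : H) = f
    rw [h1]
  · change (gaugeInv L lam x).2 = v
    rw [h1]

theorem boldRes_gaugeMap (v : Cp p) : boldRes L lam (gaugeMap L v) = 0 :=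
  (gauge_unique L hA h (v := v) (Submodule.zero_mem _) (by simp)).1

theorem gaugeCoord_gaugeMap (v : Cp p) : gaugeCoord L lam (gaugeMap L v) = v :=
  (gauge_unique L hA h (v := v) (Submodule.zero_mem _) (by simp)).2

theorem boldRes_iota {x : H × H} (hx : x ∈ A) :
    boldRes L lam (iota S A (x.2 - lam • x.1)) = x.1 ∧
      gaugeCoord L lam (iota S A (x.2 - lam • x.1)) = 0 := by
  refine gauge_unique L hA h (fst_mem_domClosure hx) ?_
  rw [map_zero, add_zero, boldOp_eq_iota hx, map_sub, map_smul]

theorem gaugeProj_eq (x : HMinus S A) :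
    (gaugeProj S A 𝔏 lam x : HMinus S A) = gaugeMap L (gaugeCoord L lam x) := by
  rw [gaugeProj, dif_pos h.2]
  conv_lhs => rw [← gauge_decomp L hA h x]
  rw [map_add]
  have h1 : (Submodule.projectionOnto 𝔏 (boldRange S A lam) h.2.symm)
      (boldOp S A (boldRes L lam x) - lam • iota S A (boldRes L lam x)) = 0 := by
    rw [Submodule.projectionOnto_apply_eq_zero_iff]
    exact mem_boldRange_iff.2 ⟨_, boldRes_mem L lam x, rfl⟩
  rw [h1, zero_add, gaugeMap_apply, Submodule.projectionOnto_apply_left]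

theorem boldInv_eq (x : HMinus S A) :
    boldInv S A lam (x - gaugeProj S A 𝔏 lam x) = boldRes L lam x := by
  have h1 : x - gaugeProj S A 𝔏 lam x = boldMinus S A lam
      ⟨(boldRes L lam x, boldOp S A (boldRes L lam x)),
        mem_boldA_iff.2 ⟨boldRes_mem L lam x, rfl⟩⟩ := by
    rw [gaugeProj_eq L hA h, sub_eq_iff_eq_add, eq_comm]
    exact gauge_decomp L hA h x
  have hinj : Function.Injective (boldMinus S A lam) := by
    rw [← LinearMap.ker_eq_bot, LinearMap.ker_eq_bot']
    rintro ⟨⟨f, f'⟩, hf⟩ h0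
    obtain ⟨h2, h3⟩ := mem_boldA_iff.1 hf
    simp only at h3
    subst h3
    have := eq_zero_of_boldOp_eq S hA h.1.1 h2 h0
    simp only at this
    subst this
    ext1
    simp
  rw [boldInv, h1]
  simp only [LinearMap.comp_apply]
  rw [leftInv_apply_of_injective _ hinj]
  rfl

theorem calP_eq : calP L lam = gaugeCoord L lam := by
  refine toCLM_eq _ fun x => ?_
  have h1 : gaugeProj S A 𝔏 lam x = L (gaugeCoord L lam x) :=
    Subtype.ext (gaugeProj_eq L hA h x)
  simp only [LinearMap.comp_apply, h1]
  exact L.symm_apply_apply _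

end

end Gauge

end

section

/-! ### Boundary triples -/

section Triples

variable {H : Type*} [NormedAddCommGroup H] [InnerProductSpace ℂ H] [CompleteSpace H]
variable {S : FundamentalSymmetry H} {A : Submodule ℂ (H × H)} {p : ℕ}

/-- If `T ⊂ A^{[*]}` and `λ ∈ ρ(T)`, then the resolvent of `T` is bounded from `H` to `H₊`. -/
theorem exists_resolvent_plus {T : Submodule ℂ (H × H)} (hT : IsClosed (T : Set (H × H)))
    (hTA : T ≤ adj S A) {lam : ℂ} (h : lam ∈ regularPoints T) :
    ∃ R : H →L[ℂ] HPlus S A, ∀ k, incl S A (R k) = relResolvent T lam k := by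
  obtain ⟨R, hR⟩ := exists_resolventL hT h
  refine ⟨plus S A ∘L R.prod (ContinuousLinearMap.id ℂ H + lam • R), fun k => ?_⟩
  have h1 : R.prod (ContinuousLinearMap.id ℂ H + lam • R) k ∈ adj S A := by
    have := hTA (relResolvent_mem h k)
    rw [← hR] at this
    exact this
  rw [ContinuousLinearMap.comp_apply, incl_plus h1]
  exact hR k

namespace BoundaryTriple

variable (B : BoundaryTriple S A p)

theorem mem_A0_iff {x : H × H} : x ∈ B.A0 ↔ ∃ h : x ∈ adj S A, B.Γ0 ⟨x, h⟩ = 0 := by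
  constructor
  · rintro ⟨⟨y, hy⟩, h0, rfl⟩
    exact ⟨hy, h0⟩
  · rintro ⟨h, h0⟩
    exact ⟨⟨x, h⟩, h0, rfl⟩

theorem A0_le : B.A0 ≤ adj S A := fun _ hx => (B.mem_A0_iff.1 hx).1

theorem exists_boundary (u v : Cp p) : ∃ g : adj S A, B.Γ0 g = u ∧ B.Γ1 g = v := by
  obtain ⟨g, hg⟩ := B.surj (u, v)
  exact ⟨g, congrArg Prod.fst hg, congrArg Prod.snd hg⟩

/-- Green's identity is tested on an element with boundary values (0, Γ₀x̂). The left side vanishes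
as x̂ ∈ A, the right side is -‖Γ₀x̂‖². The same choice of test element recurs wherever a Γ₀-value is
shown to be zero. -/
theorem le_A0 (hsymm : A ≤ adj S A) : A ≤ B.A0 := by
  intro x hx
  refine B.mem_A0_iff.2 ⟨hsymm hx, ?_⟩
  obtain ⟨g, hg0, hg1⟩ := B.exists_boundary 0 (B.Γ0 ⟨x, hsymm hx⟩)
  have h1 := B.green ⟨x, hsymm hx⟩ g
  have h2 := g.2 x hx
  rw [hg0, hg1, inner_zero_left, zero_sub] at h1
  simp only at h1
  rw [← S.conj_ip, ← h2, S.conj_ip, sub_self, eq_comm, neg_eq_zero] at h1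
  exact inner_self_eq_zero.1 h1

theorem adj_A0 (hsymm : A ≤ adj S A) : adj S B.A0 = B.A0 := by
  apply le_antisymm
  · intro x hx
    have hx' : x ∈ adj S A := fun y hy => hx y (B.le_A0 hsymm hy)
    refine B.mem_A0_iff.2 ⟨hx', ?_⟩
    obtain ⟨g, hg0, hg1⟩ := B.exists_boundary 0 (B.Γ0 ⟨x, hx'⟩)
    have h1 := B.green ⟨x, hx'⟩ g
    have h2 := hx g (B.mem_A0_iff.2 ⟨g.2, hg0⟩)
    rw [hg0, hg1, inner_zero_left, zero_sub, sub_eq_zero.2 h2, eq_comm, neg_eq_zero] at h1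
    exact inner_self_eq_zero.1 h1
  · intro x hx y hy
    obtain ⟨hx1, hx0⟩ := B.mem_A0_iff.1 hx
    obtain ⟨hy1, hy0⟩ := B.mem_A0_iff.1 hy
    have h1 := B.green ⟨x, hx1⟩ ⟨y, hy1⟩
    rw [hx0, hy0, inner_zero_left, inner_zero_right, sub_zero] at h1
    exact sub_eq_zero.1 h1

variable (hsymm : A ≤ adj S A)

include hsymm

theorem isClosed_A0 : IsClosed (B.A0 : Set (H × H)) := by
  rw [← B.adj_A0 hsymm]
  exact isClosed_adj S _

theorem conj_mem_regularPoints {lam : ℂ} (h : lam ∈ regularPoints B.A0) :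
    conj lam ∈ regularPoints B.A0 :=
  LResolvent.conj_mem_regularPoints (B.adj_A0 hsymm) h

theorem neg_I_mem (hI : Complex.I ∈ regularPoints B.A0) : -Complex.I ∈ regularPoints B.A0 := by
  rw [← Complex.conj_I]
  exact B.conj_mem_regularPoints hsymm hI

theorem mem_A0_of_ip {x : H × H} (h : ∀ y ∈ B.A0, S.ip x.2 y.1 = S.ip x.1 y.2) : x ∈ B.A0 := by
  rw [← B.adj_A0 hsymm]
  exact h

theorem exists_res0_plus {lam : ℂ} (h : lam ∈ regularPoints B.A0) :
    ∃ R : H →L[ℂ] HPlus S A, ∀ k, incl S A (R k) = B.res0 lam k :=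
  exists_resolvent_plus (B.isClosed_A0 hsymm) B.A0_le h

/-- The extended resolvent satisfies `[R̃_λ 𝔣, h'] - λ [R̃_λ 𝔣, h] = ⟨𝔣, h⟩` for `(h, h') ∈ A₀`. -/
theorem extRes0_spec {lam : ℂ} (h : lam ∈ regularPoints B.A0) (f : HMinus S A) {x : H × H}
    (hx : x ∈ B.A0) : S.ip (B.extRes0 lam f) x.2 - lam * S.ip (B.extRes0 lam f) x.1 =
      f (plus S A x) := by
  have h' := B.conj_mem_regularPoints hsymm h
  obtain ⟨R, hR⟩ := B.exists_res0_plus hsymm h'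
  have h1 := ip_opDual (R := B.res0 (conj lam)) R hR f (x.2 - conj lam • x.1)
  have h2 : R (x.2 - conj lam • x.1) = plus S A x := by
    refine eq_plus (B.A0_le hx) ?_
    rw [hR]
    exact relResolvent_minus h' hx
  rw [h2, S.ip_sub_right, S.ip_smul_right, Complex.conj_conj] at h1
  exact h1

theorem extRes0_iota {lam : ℂ} (h : lam ∈ regularPoints B.A0) (k : H) :
    B.extRes0 lam (iota S A k) = B.res0 lam k := by
  have h' := B.conj_mem_regularPoints hsymm h
  obtain ⟨R, hR⟩ := B.exists_res0_plus hsymm h'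
  refine S.eq_of_ip fun x => ?_
  rw [extRes0, ip_opDual R hR, iota_apply, hR, res0, res0,
    ip_relResolvent (B.adj_A0 hsymm) h]

omit hsymm in
theorem continuous_extRes0 (lam : ℂ) : Continuous (B.extRes0 lam) := continuous_opDual _

omit hsymm in
/-- The operator `½ (i R̃_i - i R̃_{-i})`, the second component of the regularization. -/
def regSnd : HMinus S A →ₗ[ℂ] H :=
  (Complex.I / 2) • (B.extRes0 Complex.I - B.extRes0 (-Complex.I))

omit hsymm in
theorem regSnd_apply (f : HMinus S A) : B.regSnd f =
    (Complex.I / 2) • (B.extRes0 Complex.I f - B.extRes0 (-Complex.I) f) := rfl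

omit hsymm in
theorem continuous_regSnd : Continuous B.regSnd :=
  ((B.continuous_extRes0 _).sub (B.continuous_extRes0 _)).const_smul _

omit hsymm in
theorem continuous_extRegularizer : Continuous B.extRegularizer := continuous_opDual _

variable (hI : Complex.I ∈ regularPoints B.A0)

include hI

/-- Taking dual adjoints exchanges the resolvents at i and -i and conjugates the coefficient; the
average is unchanged because ½ is real. -/
theorem extRegularizer_eq (f : HMinus S A) : B.extRegularizer f =
    (1 / 2 : ℂ) • (B.extRes0 Complex.I f + B.extRes0 (-Complex.I) f) := by
  have hI' := B.neg_I_mem hsymm hI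
  obtain ⟨R1, hR1⟩ := B.exists_res0_plus hsymm hI
  obtain ⟨R2, hR2⟩ := B.exists_res0_plus hsymm hI'
  refine S.eq_of_ip fun k => ?_
  have h1 := ip_opDual (R := B.regularizer) ((1 / 2 : ℂ) • (R1 + R2))
    (fun k => by
      simp only [regularizer, smul_apply, add_apply, map_smul, map_add, hR1, hR2,
        LinearMap.smul_apply, LinearMap.add_apply]) f k
  have h2 := ip_opDual (R := B.res0 (conj Complex.I)) R2
    (by rw [Complex.conj_I]; exact hR2) f k
  have h3 := ip_opDual (R := B.res0 (conj (-Complex.I))) R1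
    (by rw [map_neg, Complex.conj_I, neg_neg]; exact hR1) f k
  rw [extRegularizer, h1, S.ip_smul_left, S.ip_add_left, extRes0, extRes0, h2, h3]
  have h4 : conj (1 / 2 : ℂ) = 1 / 2 := by
    rw [map_div₀, map_one, Complex.conj_ofNat]
  simp only [smul_apply, add_apply, map_smulₛₗ, map_add, smul_eq_mul, h4]
  ring

/-- `[𝐑̃ 𝔣, h'] - [𝐑' 𝔣, h] = ⟨𝔣, h⟩` for `(h, h') ∈ A₀`. -/
theorem reg_spec (f : HMinus S A) {x : H × H} (hx : x ∈ B.A0) :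
    S.ip (B.extRegularizer f) x.2 - S.ip (B.regSnd f) x.1 = f (plus S A x) := by
  have hI' := B.neg_I_mem hsymm hI
  have h1 := B.extRes0_spec hsymm hI f hx
  have h2 := B.extRes0_spec hsymm hI' f hx
  rw [B.extRegularizer_eq hsymm hI, regSnd_apply]
  simp only [S.ip_smul_left, S.ip_add_left, S.ip_sub_left]
  -- Averaging the resolvent relations at i and -i collects the terms iR̃_i and -iR̃_{-i} into 𝐑'.
  linear_combination (1 / 2) * h1 + (1 / 2) * h2

/-- For a regular functional the regularization lies in A₀, where the given boundary triple applies.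
Density of H in H₋ carries identities from there to all functionals. -/
theorem reg_iota_mem (k : H) :
    (B.extRegularizer (iota S A k), B.regSnd (iota S A k) + k) ∈ B.A0 := by
  refine B.mem_A0_of_ip hsymm fun y hy => ?_
  have h1 := B.reg_spec hsymm hI (iota S A k) hy
  rw [iota_apply, incl_plus (B.A0_le hy)] at h1
  rw [S.ip_add_left]
  linear_combination -h1

/-- `(𝐑̃ 𝔣, 𝐑' 𝔣 + 𝔣)` belongs to `A^{⟨*⟩}`. -/
theorem reg_mem_adjHat (f : HMinus S A) :
    (B.extRegularizer f, iota S A (B.regSnd f) + f) ∈ adjHat S A := by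
  intro h h' hh
  have h1 := B.reg_spec hsymm hI f (B.le_A0 hsymm hh)
  rw [← eq_plus (hsymm hh) rfl] at h1
  simp only [add_apply, iota_apply]
  linear_combination -h1

/-- The regularization `𝔣 ↦ (𝐑̃ 𝔣, 𝐑' 𝔣 + 𝔣)` as a map into `A^{⟨*⟩}`. -/
def regHat (f : HMinus S A) : adjHat S A := ⟨_, B.reg_mem_adjHat hsymm hI f⟩

theorem continuous_regHat : Continuous (B.regHat hsymm hI) := by
  refine Continuous.subtype_mk ?_ _
  exact B.continuous_extRegularizer.prodMk
    ((iotaL.continuous.comp B.continuous_regSnd).add continuous_id)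

/-- `[𝐑̃ 𝔣, 𝐑' 𝔤] = [𝐑' 𝔣, 𝐑̃ 𝔤]`. -/
theorem ip_reg_regSnd (f g : HMinus S A) :
    S.ip (B.extRegularizer f) (B.regSnd g) = S.ip (B.regSnd f) (B.extRegularizer g) := by
  have hI' := B.neg_I_mem hsymm hI
  have hA0 := B.adj_A0 hsymm
  have hR := B.continuous_extRegularizer
  have hR' := B.continuous_regSnd
  -- On H, moving all resolvents to the left argument leaves (i/4)[(R_i² - R_{-i}²)k, l] on both
  -- sides: the mixed products cancel because the resolvents commute. The two remaining claims
  -- extend this by density, one argument at a time.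
  have key : ∀ k l : H, S.ip (B.extRegularizer (iota S A k)) (B.regSnd (iota S A l)) =
      S.ip (B.regSnd (iota S A k)) (B.extRegularizer (iota S A l)) := by
    intro k l
    rw [B.extRegularizer_eq hsymm hI, B.extRegularizer_eq hsymm hI, regSnd_apply, regSnd_apply]
    simp only [B.extRes0_iota hsymm hI, B.extRes0_iota hsymm hI', S.ip_smul_left, S.ip_add_left,
      S.ip_sub_left, S.ip_smul_right, S.ip_add_right, S.ip_sub_right]
    have e : ∀ mu nu, mu ∈ regularPoints B.A0 → nu ∈ regularPoints B.A0 →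
        S.ip (B.res0 mu k) (B.res0 nu l) = S.ip (B.res0 (conj nu) (B.res0 mu k)) l := by
      intro mu nu hmu hnu
      rw [res0, res0, res0, ip_relResolvent hA0 (LResolvent.conj_mem_regularPoints hA0 hnu),
        Complex.conj_conj]
    rw [e _ _ hI hI, e _ _ hI hI', e _ _ hI' hI, e _ _ hI' hI']
    simp only [map_neg, Complex.conj_I, neg_neg]
    have hc : B.res0 (-Complex.I) (B.res0 Complex.I k) =
        B.res0 Complex.I (B.res0 (-Complex.I) k) := relResolvent_comm hI' hI k
    rw [hc]
    simp
    ring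
  have key2 : ∀ k, S.ip (B.extRegularizer (iota S A k)) (B.regSnd g) =
      S.ip (B.regSnd (iota S A k)) (B.extRegularizer g) := by
    intro k
    refine congrFun (denseRange_iota.equalizer (S.continuous_ip continuous_const hR')
      (S.continuous_ip continuous_const hR) ?_) g
    funext l
    exact key k l
  refine congrFun (denseRange_iota.equalizer (S.continuous_ip hR continuous_const)
    (S.continuous_ip hR' continuous_const) ?_) f
  funext k
  exact key2 k

/-- Removing the singular part of an element of `A^{⟨*⟩}`. -/
theorem sub_reg_mem {f x : H} {g : HMinus S A} (h : (f, iota S A x + g) ∈ adjHat S A) :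
    (f - B.extRegularizer g, x - B.regSnd g) ∈ adj S A := by
  refine mem_adj_of_adjHat hsymm ?_
  have h1 := (adjHat S A).sub_mem h (B.reg_mem_adjHat hsymm hI g)
  have h2 : (f, iota S A x + g) - (B.extRegularizer g, iota S A (B.regSnd g) + g) =
      (f - B.extRegularizer g, iota S A (x - B.regSnd g)) := by
    rw [Prod.mk_sub_mk, map_sub]
    congr 1
    abel
  rw [h2] at h1
  exact h1

end BoundaryTriple

/-! ### Green's identity between `A^{⟨*⟩}` and `A^{[*]}` -/

namespace ExtendedBoundaryTriple

variable (B : ExtendedBoundaryTriple S A p) (hsymm : A ≤ adj S A)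

/-- The embedding of `A^{[*]}` into `A^{⟨*⟩}`. -/
def emb (_B : ExtendedBoundaryTriple S A p) (x : adj S A) : adjHat S A :=
  ⟨_, mem_adjHat S A x⟩

/-- The defect in the extended Green identity. -/
def greenDefect (g : adj S A) (F : adjHat S A) : ℂ :=
  (F.1.2 (plus S A g.1) - S.ip F.1.1 g.1.2) - (⟪B.Γ0 g, B.Γ1hat F⟫_ℂ - ⟪B.Γ1 g, B.Γ0hat F⟫_ℂ)

theorem greenDefect_add (g : adj S A) (F G : adjHat S A) :
    B.greenDefect g (F + G) = B.greenDefect g F + B.greenDefect g G := by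
  simp only [greenDefect, Submodule.coe_add, Prod.fst_add, Prod.snd_add, add_apply, S.ip_add_left,
    map_add, inner_add_right]
  ring

theorem greenDefect_emb (g f : adj S A) : B.greenDefect g (B.emb f) = 0 := by
  have h0 : B.Γ0hat (B.emb f) = B.Γ0 f := B.ext0 f _
  have h1 : B.Γ1hat (B.emb f) = B.Γ1 f := B.ext1 f _
  rw [greenDefect, h0, h1, ← B.green]
  simp only [emb, iota_apply, incl_plus g.2, sub_self]

theorem continuous_greenDefect (g : adj S A) : Continuous (B.greenDefect g) := by
  have h1 : Continuous fun F : adjHat S A => F.1.2 (plus S A g.1) :=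
    (continuous_eval_const (F := HMinus S A) (plus S A g.1)).comp
      (continuous_snd.comp continuous_subtype_val)
  refine (h1.sub (S.continuous_ip (continuous_fst.comp continuous_subtype_val)
    continuous_const)).sub (Continuous.sub ?_ ?_)
  · exact continuous_const.inner B.Γ1hat.continuous
  · exact continuous_const.inner B.Γ0hat.continuous

include hsymm

variable (hI : Complex.I ∈ regularPoints B.A0)

include hI

/-- The Green identity between `A^{⟨*⟩}` and `A^{[*]}`. -/
theorem green_ext (F : adjHat S A) (g : adj S A) :
    F.1.2 (plus S A g.1) - S.ip F.1.1 g.1.2 =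
      ⟪B.Γ0 g, B.Γ1hat F⟫_ℂ - ⟪B.Γ1 g, B.Γ0hat F⟫_ℂ := by
  -- For f ∈ H the regularization lies in A₀ ⊂ A^{[*]} and the ordinary identity holds. The defect
  -- is continuous because Γ̂₀ and Γ̂₁ are bounded.
  have h1 : ∀ f, B.greenDefect g (B.regHat hsymm hI f) = 0 := by
    refine congrFun (denseRange_iota.equalizer
      ((B.continuous_greenDefect g).comp (B.continuous_regHat hsymm hI)) continuous_const ?_)
    funext k
    have h2 : B.regHat hsymm hI (iota S A k) = B.emb ⟨_, B.A0_le (B.reg_iota_mem hsymm hI k)⟩ := by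
      apply Subtype.ext
      simp [BoundaryTriple.regHat, emb]
    simp only [Function.comp_apply, h2, greenDefect_emb]
  have h3 : (F.1.1, iota S A 0 + F.1.2) ∈ adjHat S A := by
    rw [map_zero, zero_add]
    exact F.2
  -- The whole second entry of F is treated as its singular part, so F splits into an element of
  -- A^{[*]} and a regularization.
  have h4 : F = B.emb ⟨_, B.sub_reg_mem hsymm hI h3⟩ + B.regHat hsymm hI F.1.2 := by
    apply Subtype.ext
    simp [BoundaryTriple.regHat, emb]
  have h5 : B.greenDefect g F = 0 := by
    rw [h4, greenDefect_add, greenDefect_emb, h1, add_zero]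
  exact sub_eq_zero.1 h5

end ExtendedBoundaryTriple

end Triples

end

section

section Triples

variable {H : Type*} [NormedAddCommGroup H] [InnerProductSpace ℂ H] [CompleteSpace H]
variable {S : FundamentalSymmetry H} {A : Submodule ℂ (H × H)} {p : ℕ}

/-! ### Compressed resolvents -/

namespace SelfAdjointExtension

variable {K : Type*} [NormedAddCommGroup K] [InnerProductSpace ℂ K] [CompleteSpace K]
variable (X : SelfAdjointExtension S A K)

theorem isClosed_rel : IsClosed (X.rel : Set (K × K)) := by
  rw [← X.selfAdjoint]
  exact isClosed_adj X.SK _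

theorem ip_proj (a : K) (h : H) :
    S.ip (S.J (ContinuousLinearMap.adjoint X.V (X.SK.J a))) h = X.SK.ip a (X.V h) := by
  rw [S.ip_J_left, ContinuousLinearMap.adjoint_inner_right, FundamentalSymmetry.ip, X.SK.symm]

theorem ip_genRes_left (mu : ℂ) (k h : H) :
    S.ip (X.genRes mu k) h = X.SK.ip (relResolvent X.rel mu (X.V k)) (X.V h) := X.ip_proj _ _

variable {X} {mu : ℂ} (hmu : mu ∈ regularPoints X.rel)

include hmu

theorem genRes_mem (k : H) : (X.genRes mu k, k + mu • X.genRes mu k) ∈ adj S A := by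
  intro y hy
  have h1 : (relResolvent X.rel mu (X.V k), X.V k + mu • relResolvent X.rel mu (X.V k)) ∈
      adj X.SK X.rel := by
    rw [X.selfAdjoint]
    exact relResolvent_mem hmu _
  have h2 := h1 _ (X.extends_A y hy)
  simp only [X.SK.ip_add_left, X.SK.ip_smul_left, X.isometry] at h2
  simp only [S.ip_add_left, S.ip_smul_left, ip_genRes_left]
  exact h2

theorem exists_genRes_plus : ∃ R : H →L[ℂ] HPlus S A, ∀ k, incl S A (R k) = X.genRes mu k := by
  obtain ⟨R, hR⟩ := exists_resolventL X.isClosed_rel hmu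
  let G : H →L[ℂ] H := (S.J ∘L ContinuousLinearMap.adjoint X.V ∘L X.SK.J) ∘L R ∘L X.V
  have hG : ∀ k, G k = X.genRes mu k := fun k => by
    change S.J (ContinuousLinearMap.adjoint X.V (X.SK.J (R (X.V k)))) = _
    rw [hR]
    rfl
  refine ⟨plus S A ∘L G.prod (ContinuousLinearMap.id ℂ H + mu • G), fun k => ?_⟩
  have h1 : G.prod (ContinuousLinearMap.id ℂ H + mu • G) k ∈ adj S A := by
    have := genRes_mem hmu k
    rw [← hG] at this
    exact this
  rw [ContinuousLinearMap.comp_apply, incl_plus h1]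
  exact hG k

theorem ip_genRes (k h : H) : S.ip (X.genRes mu k) h = S.ip k (X.genRes (conj mu) h) := by
  rw [X.ip_genRes_left, ip_relResolvent X.selfAdjoint hmu,
    ← S.conj_ip (X.genRes (conj mu) h), X.ip_genRes_left, X.SK.conj_ip]

end SelfAdjointExtension

/-! ### The functions `𝒫`, `𝒬` and `𝒢` -/

variable {𝔏 : Submodule ℂ (HMinus S A)} (L : Cp p ≃L[ℂ] 𝔏)

theorem inner_Lstar (h : HPlus S A) (ξ : Cp p) : ⟪Lstar L h, ξ⟫_ℂ = gaugeMap L ξ h :=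
  dualAdjOfMinus_spec S A _ _ _

/-- The decomposition x = (𝐀 - λ)f + Lv, evaluated on the domain element of a pair in A^{[*]}.
Membership of f in H₀ allows 𝐀 to be moved to the other side. -/
theorem boldRes_spec (hA : IsClosed (A : Set (H × H))) {lam : ℂ} (h : lam ∈ gaugeRegular S A 𝔏)
    (x : HMinus S A) {y : H × H} (hy : y ∈ adj S A) :
    S.ip (boldRes L lam x) y.2 - lam * S.ip (boldRes L lam x) y.1 +
      gaugeMap L (gaugeCoord L lam x) (plus S A y) = x (plus S A y) := by
  have hy' : (incl S A (plus S A y), y.2) ∈ adj S A := by rwa [incl_plus hy]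
  have h1 := congrArg (fun f : HMinus S A => f (plus S A y)) (gauge_decomp L hA h x)
  simp only [add_apply, sub_apply, smul_apply, smul_eq_mul, iota_apply, incl_plus hy,
    boldOp_apply_adj (boldRes_mem L lam x) hy'] at h1
  exact h1

section Pstar

variable (hA : IsClosed (A : Set (H × H))) {lam : ℂ} (h : lam ∈ gaugeRegular S A 𝔏)

theorem apply_calPstar (f : HMinus S A) (v : Cp p) :
    f (calPstar L lam v) = ⟪v, calP L lam f⟫_ℂ := dualAdjFromMinus_spec S A _ _ _

include hA h

/-- 𝒫(λ) annihilates ran (A - λ), so the range of its adjoint consists of defect vectors at λ̄. -/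
theorem calPstar_mem (v : Cp p) : (incl S A (calPstar L lam v),
    conj lam • incl S A (calPstar L lam v)) ∈ adj S A := by
  intro y hy
  have h1 := apply_calPstar L (lam := lam) (iota S A (y.2 - lam • y.1)) v
  rw [calP_eq L hA h, (boldRes_iota L hA h hy).2, inner_zero_right, iota_apply, S.ip_sub_left,
    S.ip_smul_left] at h1
  have h2 := congrArg conj h1
  simp only [map_sub, map_mul, S.conj_ip, map_zero] at h2
  simp only [S.ip_smul_left]
  linear_combination -h2

/-- The adjoint form of 𝒫(λ)L = I. -/
theorem Lstar_calPstar (v : Cp p) : Lstar L (calPstar L lam v) = v := by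
  refine ext_inner_right ℂ fun ξ => ?_
  rw [inner_Lstar, apply_calPstar, calP_eq L hA h, gaugeCoord_gaugeMap L hA h]

end Pstar

namespace BoundaryTriple

variable (B : BoundaryTriple S A p)

/-- `𝐑̃` as a bounded operator. -/
def regL : HMinus S A →L[ℂ] H := ⟨B.extRegularizer, B.continuous_extRegularizer⟩

/-- The second component of the regularization as a bounded operator. -/
def regSndL : HMinus S A →L[ℂ] H := ⟨B.regSnd, B.continuous_regSnd⟩

/-- The first component of the regularized resolvent `(𝐀 - λ)⁻¹ (1 - Π) + 𝐑̃ Π`. -/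
def regResFst (lam : ℂ) : H →L[ℂ] H :=
  (boldRes L lam + B.regL ∘L gaugeMap L ∘L gaugeCoord L lam) ∘L iotaL

/-- The second component of the regularized resolvent. -/
def regResSnd (lam : ℂ) : H →L[ℂ] H :=
  ContinuousLinearMap.id ℂ H +
    (lam • boldRes L lam + B.regSndL ∘L gaugeMap L ∘L gaugeCoord L lam) ∘L iotaL

theorem regResFst_apply (lam : ℂ) (k : H) : B.regResFst L lam k = boldRes L lam (iota S A k) +
    B.extRegularizer (gaugeMap L (gaugeCoord L lam (iota S A k))) := rfl

theorem regResSnd_apply (lam : ℂ) (k : H) : B.regResSnd L lam k =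
    k + (lam • boldRes L lam (iota S A k) +
    B.regSnd (gaugeMap L (gaugeCoord L lam (iota S A k)))) := rfl

/-- The operator `(𝐀 - λ)⁻¹ (1 - Π) + 𝐑̃ Π` from `H` to `H₊`. -/
def regRes (lam : ℂ) : H →L[ℂ] HPlus S A :=
  plus S A ∘L (B.regResFst L lam).prod (B.regResSnd L lam)

theorem regRes_apply (lam : ℂ) (k : H) :
    B.regRes L lam k = plus S A (B.regResFst L lam k, B.regResSnd L lam k) := rfl

variable (hA : IsClosed (A : Set (H × H))) (hsymm : A ≤ adj S A)
  (hI : Complex.I ∈ regularPoints B.A0) {lam : ℂ} (h : lam ∈ gaugeRegular S A 𝔏)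

theorem differentiableAt_boldRes_apply (x : HMinus S A) (hA : IsClosed (A : Set (H × H)))
    (h : lam ∈ gaugeRegular S A 𝔏) : DifferentiableAt ℂ (fun z => boldRes L z x) lam := by
  have h1 : DifferentiableAt ℂ (fun z => gaugeInv L z x) lam :=
    (differentiableAt_gaugeInv L hA h).clm_apply (differentiableAt_const x)
  exact ((domClosure A).subtypeL ∘L ContinuousLinearMap.fst ℂ _ _).differentiableAt.comp lam h1

theorem differentiableAt_gaugeCoord_apply (x : HMinus S A) (hA : IsClosed (A : Set (H × H)))
    (h : lam ∈ gaugeRegular S A 𝔏) : DifferentiableAt ℂ (fun z => gaugeCoord L z x) lam := by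
  have h1 : DifferentiableAt ℂ (fun z => gaugeInv L z x) lam :=
    (differentiableAt_gaugeInv L hA h).clm_apply (differentiableAt_const x)
  exact (ContinuousLinearMap.snd ℂ (domClosure A) (Cp p)).differentiableAt.comp lam h1

include hA h in
theorem differentiableAt_regRes_apply (k : H) :
    DifferentiableAt ℂ (fun z => B.regRes L z k) lam := by
  have h1 := differentiableAt_boldRes_apply L (iota S A k) hA h
  have h2 := differentiableAt_gaugeCoord_apply L (iota S A k) hA h
  have h3 : DifferentiableAt ℂ (fun z => B.regResFst L z k) lam :=
    h1.add ((B.regL ∘L gaugeMap L).differentiableAt.comp lam h2)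
  have h4 : DifferentiableAt ℂ (fun z => B.regResSnd L z k) lam :=
    (differentiableAt_const k).add ((differentiableAt_id.smul h1).add
      ((B.regSndL ∘L gaugeMap L).differentiableAt.comp lam h2))
  exact (plus S A).differentiableAt.comp lam (h3.prodMk h4)

include hA hsymm hI h

/-- (𝐀 - λ)⁻¹(I - Π)k solves its equation up to the error -Πk in H₋, and the regularization of Πk
supplies exactly this missing term. The sum is therefore orthogonal to A₀ in the graph sense, and in
particular its first entry lies in H₊. -/
theorem regRes_mem (k : H) : (B.regResFst L lam k, B.regResSnd L lam k) ∈ B.A0 := by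
  refine B.mem_A0_of_ip hsymm fun y hy => ?_
  have h1 := boldRes_spec L hA h (iota S A k) (B.A0_le hy)
  have h2 := B.reg_spec hsymm hI (gaugeMap L (gaugeCoord L lam (iota S A k))) hy
  rw [iota_apply, incl_plus (B.A0_le hy)] at h1
  simp only [regResFst_apply, regResSnd_apply, S.ip_add_left, S.ip_smul_left]
  linear_combination -h1 - h2

theorem incl_regRes (k : H) : incl S A (B.regRes L lam k) = B.regResFst L lam k := by
  rw [regRes_apply, incl_plus (B.A0_le (B.regRes_mem L hA hsymm hI h k))]

theorem calQ_eq : B.calQ L lam = Lstar L ∘L B.regRes L lam := by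
  refine toCLM_eq _ fun k => ?_
  have h1 : liftPlus S A ((boldInv S A lam ∘ₗ
      (LinearMap.id - 𝔏.subtype ∘ₗ gaugeProj S A 𝔏 lam) +
      B.extRegularizer ∘ₗ 𝔏.subtype ∘ₗ gaugeProj S A 𝔏 lam) ∘ₗ iota S A) =
      (B.regRes L lam).toLinearMap := by
    refine liftPlus_eq _ fun k => ?_
    have h2 := boldInv_eq L hA h (iota S A k)
    have h3 := gaugeProj_eq L hA h (iota S A k)
    change incl S A (B.regRes L lam k) = boldInv S A lam (iota S A k -
      (gaugeProj S A 𝔏 lam (iota S A k) : HMinus S A)) +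
      B.extRegularizer (gaugeProj S A 𝔏 lam (iota S A k) : HMinus S A)
    rw [h2, h3, B.incl_regRes L hA hsymm hI h, regResFst_apply]
  rw [h1]
  rfl

/-- `𝒬(λ)` in terms of a generalized resolvent. -/
theorem calQ_eq_Qgen {K : Type*} [NormedAddCommGroup K] [InnerProductSpace ℂ K] [CompleteSpace K]
    (X : SelfAdjointExtension S A K) (hX : lam ∈ regularPoints X.rel) :
    (B.calQ L lam).toLinearMap = B.Qgen L X lam := by
  have hX' := LResolvent.conj_mem_regularPoints X.selfAdjoint hX
  obtain ⟨R, hR⟩ := SelfAdjointExtension.exists_genRes_plus hX'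
  rw [B.calQ_eq L hA hsymm hI h, Qgen, liftPlus_eq (B.regRes L lam).toLinearMap]
  · rfl
  intro k
  have h3 := gaugeProj_eq L hA h (iota S A k)
  change incl S A (B.regRes L lam k) = X.genRes lam k -
    (opDual S A (X.genRes (conj lam)) (gaugeProj S A 𝔏 lam (iota S A k) : HMinus S A) -
    B.extRegularizer (gaugeProj S A 𝔏 lam (iota S A k) : HMinus S A))
  rw [h3, B.incl_regRes L hA hsymm hI h, regResFst_apply]
  -- The terms with 𝐑̃ agree, so only (𝐀 - λ)⁻¹(I - Π) remains. It is identified by pairing the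
  -- decomposition of k with the element (𝐑_λ̄ x, x + λ̄𝐑_λ̄ x) of A^{[*]}.
  suffices hs : boldRes L lam (iota S A k) = X.genRes lam k -
      opDual S A (X.genRes (conj lam)) (gaugeMap L (gaugeCoord L lam (iota S A k))) by
    rw [hs]
    abel
  refine S.eq_of_ip fun x => ?_
  have hx := SelfAdjointExtension.genRes_mem hX' x
  have h4 := boldRes_spec L hA h (iota S A k) hx
  have h5 : plus S A (X.genRes (conj lam) x, x + conj lam • X.genRes (conj lam) x) = R x :=
    (eq_plus hx (hR x)).symm
  rw [h5, iota_apply, hR] at h4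
  simp only [S.ip_add_right, S.ip_smul_right, Complex.conj_conj] at h4
  rw [S.ip_sub_left, ip_opDual R hR, SelfAdjointExtension.ip_genRes hX]
  linear_combination h4

omit hA hsymm hI h in
theorem ip_calQstar (f : H) (u : Cp p) :
    S.ip f (B.calQstar L lam u) = ⟪u, B.calQ L lam f⟫_ℂ := S.ip_hAdj _ _ _

theorem ip_calQstar_left (f : H) (u : Cp p) :
    S.ip (B.calQstar L lam u) f = gaugeMap L u (B.regRes L lam f) := by
  rw [← S.conj_ip, ip_calQstar, inner_conj_symm, B.calQ_eq L hA hsymm hI h, ← inner_Lstar]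
  rfl

/-- On ran (A - λ) the projection Π vanishes and 𝒬(λ) acts as L^{⟨*⟩}(A - λ)⁻¹. The adjoint form of
this is membership in A^{⟨*⟩} with singular part Lu. -/
theorem calQstar_mem (u : Cp p) : (B.calQstar L lam u,
    iota S A (conj lam • B.calQstar L lam u) + gaugeMap L u) ∈ adjHat S A := by
  intro y y' hy
  obtain ⟨h1, h2⟩ := boldRes_iota L hA h hy
  have h3 := B.ip_calQstar_left L hA hsymm hI h (y' - lam • incl S A y) u
  have h4 : B.regRes L lam (y' - lam • incl S A y) = y := by
    apply incl_injective
    rw [B.incl_regRes L hA hsymm hI h, regResFst_apply, h1, h2, map_zero, map_zero, add_zero]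
  rw [h4, S.ip_sub_right, S.ip_smul_right] at h3
  simp only [add_apply, iota_apply, S.ip_smul_left]
  linear_combination -h3

/-- `L^{⟨*⟩} (𝒬(λ)^{⟨*⟩} - 𝐑̃ L) = 0`. -/
theorem Lstar_calQstar_sub (u : Cp p) : Lstar L (plus S A
    (B.calQstar L lam u - B.extRegularizer (gaugeMap L u),
      conj lam • B.calQstar L lam u - B.regSnd (gaugeMap L u))) = 0 := by
  have hmem := B.sub_reg_mem hsymm hI (B.calQstar_mem L hA hsymm hI h u)
  set g := plus S A (B.calQstar L lam u - B.extRegularizer (gaugeMap L u),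
      conj lam • B.calQstar L lam u - B.regSnd (gaugeMap L u)) with hg
  -- Q is I - Π. The operator s below is the regularized resolvent minus the regularization 𝐑̃: in
  -- this difference the term k cancels from the second entry, so s is continuous on all of H₋.
  let Q : HMinus S A →L[ℂ] HMinus S A :=
    ContinuousLinearMap.id ℂ _ - gaugeMap L ∘L gaugeCoord L lam
  let s : HMinus S A →L[ℂ] HPlus S A := plus S A ∘L
    (boldRes L lam - B.regL ∘L Q).prod (lam • boldRes L lam - B.regSndL ∘L Q)
  have hs : ∀ k, s (iota S A k) = B.regRes L lam k -
      plus S A (B.extRegularizer (iota S A k), B.regSnd (iota S A k) + k) := by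
    intro k
    rw [regRes_apply, ← map_sub]
    change plus S A (boldRes L lam (iota S A k) -
      B.extRegularizer (iota S A k - gaugeMap L (gaugeCoord L lam (iota S A k))),
      lam • boldRes L lam (iota S A k) -
      B.regSnd (iota S A k - gaugeMap L (gaugeCoord L lam (iota S A k)))) = _
    rw [regResFst_apply, regResSnd_apply, map_sub, map_sub, Prod.mk_sub_mk]
    congr 2 <;> abel
  -- Thus g is the dual adjoint of s applied to Lu. By density it suffices to check x ∈ H, where the
  -- symmetry of 𝐑̃ against 𝐑' matches the singular terms.
  have key : ∀ x : HMinus S A, conj (x g) = gaugeMap L u (s x) := by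
    refine congrFun (denseRange_iota.equalizer
      (Complex.continuous_conj.comp (continuous_eval_const (F := HMinus S A) g))
      ((gaugeMap L u).continuous.comp s.continuous) ?_)
    funext k
    have hk := B.reg_iota_mem hsymm hI k
    have h1 := B.reg_spec hsymm hI (gaugeMap L u) hk
    have h2 := B.ip_reg_regSnd hsymm hI (gaugeMap L u) (iota S A k)
    have h3 := B.ip_calQstar_left L hA hsymm hI h k u
    simp only [Function.comp_apply]
    rw [hs, map_sub, iota_apply, hg, incl_plus hmem, S.conj_ip, ← h1, ← h3]
    simp only [S.ip_sub_left, S.ip_add_right]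
    linear_combination h2
  refine ext_inner_right ℂ fun ξ => ?_
  have h1 := key (gaugeMap L ξ)
  -- On 𝔏 both I - Π and (𝐀 - λ)⁻¹(I - Π) vanish, hence so does s.
  have h2 : s (gaugeMap L ξ) = 0 := by
    change plus S A (boldRes L lam (gaugeMap L ξ) -
      B.extRegularizer (gaugeMap L ξ - gaugeMap L (gaugeCoord L lam (gaugeMap L ξ))),
      lam • boldRes L lam (gaugeMap L ξ) -
      B.regSnd (gaugeMap L ξ - gaugeMap L (gaugeCoord L lam (gaugeMap L ξ)))) = _
    rw [boldRes_gaugeMap L hA h, gaugeCoord_gaugeMap L hA h, sub_self, map_zero, map_zero,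
      smul_zero, sub_zero]
    exact map_zero _
  rw [h2, map_zero, map_eq_zero] at h1
  rw [inner_Lstar, h1, inner_zero_left]

omit hA hsymm hI h in
/-- The pairing of `ℂ^p × ℂ^p`, linear in the second argument. -/
def pairing (x y : Cp p × Cp p) : ℂ := ⟪x.1, y.1⟫_ℂ + ⟪x.2, y.2⟫_ℂ

omit hA hsymm hI h in
theorem Gstar_apply (w : Cp p × Cp p) : B.Gstar L lam w =
    -B.calQstar L lam w.1 + incl S A (calPstar L lam w.2) := rfl

omit hA hsymm hI h in
theorem ip_Gstar (f : H) (w : Cp p × Cp p) :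
    S.ip f (B.Gstar L lam w) = pairing w (B.G L lam f) := by
  rw [Gstar_apply, S.ip_add_right, S.ip_neg_right, ip_calQstar, ← iota_apply, apply_calPstar,
    pairing]
  simp [G, inner_neg_right]

/-- Only the 𝒬-component of 𝒢̂(λ)^{⟨*⟩} is singular. The second entry is displayed as a regular
vector plus the functional -Lw₁, the splitting on which the regularized Green identity operates. -/
theorem Gstar_mem (w : Cp p × Cp p) : (B.Gstar L lam w,
    iota S A (conj lam • B.Gstar L lam w) + gaugeMap L (-w.1)) ∈ adjHat S A := by
  have h1 := (adjHat S A).neg_mem (B.calQstar_mem L hA hsymm hI h w.1)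
  have h2 := mem_adjHat_of_adj (calPstar_mem L hA h w.2)
  have h3 := (adjHat S A).add_mem h1 h2
  have h4 : iota S A (conj lam • B.Gstar L lam w) + gaugeMap L (-w.1) =
      -(iota S A (conj lam • B.calQstar L lam w.1) + gaugeMap L w.1) +
        iota S A (conj lam • incl S A (calPstar L lam w.2)) := by
    simp only [Gstar_apply, smul_add, map_add, smul_neg, map_neg]
    abel
  rw [h4]
  exact h3

theorem GhatStar_coe (w : Cp p × Cp p) : (B.GhatStar L lam w : H × HMinus S A) =
    (B.Gstar L lam w, iota S A (conj lam • B.Gstar L lam w) + gaugeMap L (-w.1)) := by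
  have key : ∀ w : Cp p × Cp p, ((-(B.hatQstar L lam)).coprod (hatPstar L lam)) w =
      (B.Gstar L lam w, iota S A (conj lam • B.Gstar L lam w) + gaugeMap L (-w.1)) := by
    intro w
    change -(B.calQstar L lam w.1, conj lam • iota S A (B.calQstar L lam w.1) + gaugeMap L w.1) +
      (incl S A (calPstar L lam w.2), conj lam • iota S A (incl S A (calPstar L lam w.2))) = _
    rw [Prod.neg_mk, Prod.mk_add_mk]
    congr 1
    simp only [Gstar_apply, smul_add, map_add, smul_neg, map_neg, map_smul]
    abel
  rw [GhatStar, intoSub_coe, key]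
  intro w
  rw [key]
  exact B.Gstar_mem L hA hsymm hI h w

/-- `L^{⟨*⟩}` of the regular part of `𝒢̂(λ)^{⟨*⟩}`. -/
theorem Lstar_Gstar (w : Cp p × Cp p) : Lstar L (plus S A
    (B.Gstar L lam w - B.extRegularizer (gaugeMap L (-w.1)),
      conj lam • B.Gstar L lam w - B.regSnd (gaugeMap L (-w.1)))) = w.2 := by
  have h1 := B.Lstar_calQstar_sub L hA hsymm hI h w.1
  have h2 := Lstar_calPstar L hA h w.2
  have h3 := eq_plus (calPstar_mem L hA h w.2) rfl
  rw [h3] at h2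
  have h4 : (B.Gstar L lam w - B.extRegularizer (gaugeMap L (-w.1)),
      conj lam • B.Gstar L lam w - B.regSnd (gaugeMap L (-w.1))) =
      -(B.calQstar L lam w.1 - B.extRegularizer (gaugeMap L w.1),
      conj lam • B.calQstar L lam w.1 - B.regSnd (gaugeMap L w.1)) +
      (incl S A (calPstar L lam w.2), conj lam • incl S A (calPstar L lam w.2)) := by
    rw [Prod.neg_mk, Prod.mk_add_mk]
    simp only [Gstar_apply, smul_add, smul_neg, map_neg]
    congr 1 <;> abel
  rw [h4, map_add, map_neg, map_add, map_neg, h1, h2, neg_zero, zero_add]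

end BoundaryTriple

end Triples

end

section

/-! ### Block matrices as operators in `ℂ^p × ℂ^p` -/

section Matrices

open Matrix

variable {p : ℕ}

/-- The identification of `ℂ^{2p}` with `ℂ^p × ℂ^p`. -/
def pair : (Fin p ⊕ Fin p → ℂ) →ₗ[ℂ] Cp p × Cp p where
  toFun w := (WithLp.toLp 2 fun i => w (Sum.inl i), WithLp.toLp 2 fun i => w (Sum.inr i))
  map_add' _ _ := rfl
  map_smul' _ _ := rfl

theorem pair_fst_apply (w : Fin p ⊕ Fin p → ℂ) (i : Fin p) : (pair w).1 i = w (Sum.inl i) := rfl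

theorem pair_snd_apply (w : Fin p ⊕ Fin p → ℂ) (i : Fin p) : (pair w).2 i = w (Sum.inr i) := rfl

theorem pair_surjective : Function.Surjective (pair (p := p)) := by
  intro x
  exact ⟨Sum.elim x.1 x.2, rfl⟩

theorem mat_mulVec (T : Cp p →ₗ[ℂ] Cp p) (u : Cp p) : mat T *ᵥ (u : Fin p → ℂ) = T u := by
  funext i
  have h : u = ∑ j, u j • EuclideanSpace.single j (1 : ℂ) := by
    ext k
    simp [Pi.single_apply]
  conv_rhs => rw [h]
  rw [map_sum, WithLp.ofLp_sum, Finset.sum_apply, mulVec, dotProduct]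
  refine Finset.sum_congr rfl fun j _ => ?_
  rw [map_smul, mat, Matrix.of_apply, mul_comm]
  rfl

theorem mat_mul (T R : Cp p →ₗ[ℂ] Cp p) : mat T * mat R = mat (T ∘ₗ R) := by
  ext i j
  have := congrFun (mat_mulVec T (R (EuclideanSpace.single j 1))) i
  exact this

theorem mat_id : mat (LinearMap.id : Cp p →ₗ[ℂ] Cp p) = 1 := by
  ext i j
  simp [mat, Matrix.one_apply]

theorem mat_conjTranspose {T R : Cp p →ₗ[ℂ] Cp p} (h : ∀ u v, ⟪T u, v⟫_ℂ = ⟪u, R v⟫_ℂ) :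
    (mat T)ᴴ = mat R := by
  ext i j
  have h1 := h (EuclideanSpace.single i 1) (EuclideanSpace.single j 1)
  simp only [EuclideanSpace.inner_single_right, EuclideanSpace.inner_single_left, one_mul,
    map_one] at h1
  exact h1

theorem pair_blockMat_mulVec (T : (Cp p × Cp p) →ₗ[ℂ] (Cp p × Cp p)) (w : Fin p ⊕ Fin p → ℂ) :
    pair (blockMat T *ᵥ w) = T (pair w) := by
  have hw : T (pair w) = T ((pair w).1, 0) + T (0, (pair w).2) := by
    rw [← map_add]
    simp
  rw [hw, blockMat, fromBlocks_mulVec]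
  refine Prod.ext ?_ ?_
  · ext i
    rw [pair_fst_apply, Sum.elim_inl]
    exact congrArg₂ (· + ·)
      (congrFun (mat_mulVec (LinearMap.fst ℂ _ _ ∘ₗ T ∘ₗ LinearMap.inl ℂ _ _) (pair w).1) i)
      (congrFun (mat_mulVec (LinearMap.fst ℂ _ _ ∘ₗ T ∘ₗ LinearMap.inr ℂ _ _) (pair w).2) i)
  · ext i
    rw [pair_snd_apply, Sum.elim_inr]
    exact congrArg₂ (· + ·)
      (congrFun (mat_mulVec (LinearMap.snd ℂ _ _ ∘ₗ T ∘ₗ LinearMap.inl ℂ _ _) (pair w).1) i)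
      (congrFun (mat_mulVec (LinearMap.snd ℂ _ _ ∘ₗ T ∘ₗ LinearMap.inr ℂ _ _) (pair w).2) i)

theorem star_dotProduct_eq_pairing (a b : Fin p ⊕ Fin p → ℂ) :
    star a ⬝ᵥ b = BoundaryTriple.pairing (pair a) (pair b) := by
  rw [BoundaryTriple.pairing, dotProduct, Fintype.sum_sum_type, PiLp.inner_apply,
    PiLp.inner_apply]
  congr 1 <;> refine Finset.sum_congr rfl fun i _ => ?_
  · rw [pair_fst_apply, pair_fst_apply, RCLike.inner_apply, mul_comm]
    rfl
  · rw [pair_snd_apply, pair_snd_apply, RCLike.inner_apply, mul_comm]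
    rfl

theorem pair_Jp_mulVec (w : Fin p ⊕ Fin p → ℂ) :
    pair (Jp p *ᵥ w) = (-Complex.I • (pair w).2, Complex.I • (pair w).1) := by
  rw [Jp, fromBlocks_mulVec]
  refine Prod.ext ?_ ?_
  · ext i
    rw [pair_fst_apply, Sum.elim_inl, zero_mulVec, smul_mulVec, one_mulVec]
    simp [pair_snd_apply]
  · ext i
    rw [pair_snd_apply, Sum.elim_inr, zero_mulVec, smul_mulVec, one_mulVec]
    simp [pair_fst_apply]

theorem Jp_mul_Jp : Jp p * Jp p = 1 := by
  rw [Jp, fromBlocks_multiply]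
  simp [smul_smul]

/-- A matrix is determined by its sesquilinear form. -/
theorem ext_form {m : Type*} [Fintype m] {M N : Matrix m m ℂ}
    (h : ∀ a b, star a ⬝ᵥ (M *ᵥ b) = star a ⬝ᵥ (N *ᵥ b)) : M = N := by
  classical
  ext i j
  have := h (Pi.single i 1) (Pi.single j 1)
  rw [← Pi.single_star] at this
  simpa using this

theorem form_conjTranspose {m : Type*} [Fintype m] (M : Matrix m m ℂ) (a b : m → ℂ) :
    star a ⬝ᵥ (Mᴴ *ᵥ b) = star (M *ᵥ a) ⬝ᵥ b := by
  rw [star_mulVec, dotProduct_mulVec]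

theorem conj_form {m : Type*} [Fintype m] (M : Matrix m m ℂ) (a b : m → ℂ) :
    star (star a ⬝ᵥ (M *ᵥ b)) = star b ⬝ᵥ (Mᴴ *ᵥ a) := by
  rw [form_conjTranspose, star_dotProduct]
  simp [dotProduct_comm]

end Matrices

/-! ### The factorization of the kernel -/

section Triples

variable {H : Type*} [NormedAddCommGroup H] [InnerProductSpace ℂ H] [CompleteSpace H]
variable {S : FundamentalSymmetry H} {A : Submodule ℂ (H × H)} {p : ℕ}
variable {𝔏 : Submodule ℂ (HMinus S A)} (L : Cp p ≃L[ℂ] 𝔏)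

open Matrix BoundaryTriple

namespace ExtendedBoundaryTriple

variable (B : ExtendedBoundaryTriple S A p)

/-! ### The regularized Green identity -/

section Green

variable (hsymm : A ≤ adj S A) (hI : Complex.I ∈ regularPoints B.A0)

include hsymm hI

/-- The extended Green identity is tested on an element of A₀ whose Γ₁-value is the vector in
question; `reg_spec` makes its left side vanish. -/
theorem Γ0hat_regHat (f : HMinus S A) : B.Γ0hat (B.regHat hsymm hI f) = 0 := by
  obtain ⟨g, hg0, hg1⟩ := B.exists_boundary 0 (B.Γ0hat (B.regHat hsymm hI f))
  have h1 := B.green_ext hsymm hI (B.regHat hsymm hI f) g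
  have h2 := B.reg_spec hsymm hI f (B.mem_A0_iff.2 ⟨g.2, hg0⟩)
  rw [hg0, hg1, inner_zero_left] at h1
  simp only [regHat, _root_.add_apply, iota_apply, incl_plus g.2] at h1
  rw [← h2] at h1
  refine (inner_self_eq_zero (𝕜 := ℂ)).1 ?_
  rw [regHat]
  linear_combination h1

/-- The regularized Green identity between two elements of `A^{⟨*⟩}`. -/
theorem green_regularized (F G : adjHat S A) {x y : H} {f g : HMinus S A}
    (hF : F.1.2 = iota S A x + f) (hG : G.1.2 = iota S A y + g) :
    ⟪B.Γ0hat G, B.Γ1hat F⟫_ℂ - ⟪B.Γ1hat G, B.Γ0hat F⟫_ℂ =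
      S.ip x G.1.1 - S.ip F.1.1 y +
        f (plus S A (G.1.1 - B.extRegularizer g, y - B.regSnd g)) -
        conj (g (plus S A (F.1.1 - B.extRegularizer f, x - B.regSnd f))) := by
  have hF' : (F.1.1, iota S A x + f) ∈ adjHat S A := by rw [← hF]; exact F.2
  have hG' : (G.1.1, iota S A y + g) ∈ adjHat S A := by rw [← hG]; exact G.2
  have mF := B.sub_reg_mem hsymm hI hF'
  have mG := B.sub_reg_mem hsymm hI hG'
  have eF : F = B.emb ⟨_, mF⟩ + B.regHat hsymm hI f := by
    apply Subtype.ext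
    simp only [emb, regHat, Submodule.coe_add, Prod.mk_add_mk, sub_add_cancel]
    refine Prod.ext rfl ?_
    rw [hF, ← add_assoc, ← map_add, sub_add_cancel]
  have eG : G = B.emb ⟨_, mG⟩ + B.regHat hsymm hI g := by
    apply Subtype.ext
    simp only [emb, regHat, Submodule.coe_add, Prod.mk_add_mk, sub_add_cancel]
    refine Prod.ext rfl ?_
    rw [hG, ← add_assoc, ← map_add, sub_add_cancel]
  have F0 : B.Γ0hat F = B.Γ0 ⟨_, mF⟩ := by
    refine (congrArg B.Γ0hat eF).trans ?_
    rw [map_add, Γ0hat_regHat, add_zero]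
    exact B.ext0 _ _
  have G0 : B.Γ0hat G = B.Γ0 ⟨_, mG⟩ := by
    refine (congrArg B.Γ0hat eG).trans ?_
    rw [map_add, Γ0hat_regHat, add_zero]
    exact B.ext0 _ _
  have G1 : B.Γ1hat G = B.Γ1 ⟨_, mG⟩ + B.Γ1hat (B.regHat hsymm hI g) := by
    refine (congrArg B.Γ1hat eG).trans ?_
    rw [map_add]
    congr 1
    exact B.ext1 _ _
  have h1 := B.green_ext hsymm hI F ⟨_, mG⟩
  have h2 := B.green_ext hsymm hI (B.regHat hsymm hI g) ⟨_, mF⟩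
  -- This removes the products of the two singular parts. The identity itself comes from pairing F
  -- with the regular part of G, and the regularization of g with the regular part of F.
  have h3 := B.ip_reg_regSnd hsymm hI f g
  rw [Γ0hat_regHat, inner_zero_right, sub_zero] at h2
  have h4 := congrArg conj h2
  simp only [regHat, _root_.add_apply, iota_apply, incl_plus mF, map_sub, map_add, S.conj_ip,
    inner_conj_symm] at h4
  rw [hF] at h1
  simp only [_root_.add_apply, iota_apply, incl_plus mG] at h1
  rw [F0] at h1
  rw [G1, inner_add_left, F0, G0]
  simp only [regHat, S.ip_sub_left, S.ip_sub_right] at h1 h4 ⊢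
  linear_combination -h1 + h4 + h3

end Green

variable (hA : IsClosed (A : Set (H × H))) (hsymm : A ≤ adj S A)
  (hI : Complex.I ∈ regularPoints B.A0) {lam ω : ℂ}

/-- The operator `Γ̂ 𝒢̂(λ)^{⟨*⟩}`. -/
def boundaryG (lam : ℂ) : (Cp p × Cp p) →ₗ[ℂ] (Cp p × Cp p) :=
  (B.Γ0hat.toLinearMap.prod B.Γ1hat.toLinearMap) ∘ₗ B.toBoundaryTriple.GhatStar L lam

theorem What_conjTranspose : (B.What L lam)ᴴ = blockMat (B.boundaryG L lam) :=
  conjTranspose_conjTranspose _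

/-- Here the matrix kernel becomes a Gram kernel in the Pontryagin space, which reduces the count of
negative squares to subspaces of H. -/
theorem form_G (a b : Fin p ⊕ Fin p → ℂ) :
    star a ⬝ᵥ (blockMat (B.G L lam ∘ₗ B.Gstar L ω) *ᵥ b) =
      S.ip (B.Gstar L ω (pair b)) (B.Gstar L lam (pair a)) := by
  rw [star_dotProduct_eq_pairing, pair_blockMat_mulVec, ip_Gstar]
  rfl

include hA hsymm hI

/-- In the regularized identity the regular terms give the factor ω̄ - λ. The singular parts -Lv₁
and -Lw₁ pair with the regular parts through L^{⟨*⟩}, whose values there are w₂ and v₂; these terms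
form J_p. -/
theorem green_GhatStar (hlam : lam ∈ gaugeRegular S A 𝔏) (hω : ω ∈ gaugeRegular S A 𝔏)
    (v w : Cp p × Cp p) :
    ⟪(B.boundaryG L lam w).1, (B.boundaryG L ω v).2⟫_ℂ -
      ⟪(B.boundaryG L lam w).2, (B.boundaryG L ω v).1⟫_ℂ =
      (conj ω - lam) * S.ip (B.Gstar L ω v) (B.Gstar L lam w) - ⟪w.2, v.1⟫_ℂ + ⟪w.1, v.2⟫_ℂ := by
  have hF := B.GhatStar_coe L hA hsymm hI hω v
  have hG := B.GhatStar_coe L hA hsymm hI hlam w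
  have h1 := B.green_regularized hsymm hI (B.GhatStar L ω v) (B.GhatStar L lam w)
    (congrArg Prod.snd hF) (congrArg Prod.snd hG)
  have e1 : (B.GhatStar L ω v).1.1 = B.Gstar L ω v := congrArg Prod.fst hF
  have e2 : (B.GhatStar L lam w).1.1 = B.Gstar L lam w := congrArg Prod.fst hG
  rw [e1, e2, ← inner_Lstar, ← inner_Lstar, B.Lstar_Gstar L hA hsymm hI hω,
    B.Lstar_Gstar L hA hsymm hI hlam, inner_conj_symm, inner_neg_left, inner_neg_right,
    S.ip_smul_left, S.ip_smul_right, Complex.conj_conj] at h1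
  refine Eq.trans h1 ?_
  ring

/-- The factorization of the kernel, without denominators. -/
theorem Jp_sub (hlam : lam ∈ gaugeRegular S A 𝔏) (hω : ω ∈ gaugeRegular S A 𝔏) :
    Jp p - B.What L lam * Jp p * (B.What L ω)ᴴ =
      (-Complex.I * (lam - conj ω)) • blockMat (B.G L lam ∘ₗ B.Gstar L ω) := by
  refine ext_form fun a b => ?_
  have h1 := B.green_GhatStar L hA hsymm hI hlam hω (pair b) (pair a)
  rw [sub_mulVec, dotProduct_sub, smul_mulVec, dotProduct_smul, form_G, smul_eq_mul]
  have h2 : star a ⬝ᵥ ((B.What L lam * Jp p * (B.What L ω)ᴴ) *ᵥ b) =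
      pairing (B.boundaryG L lam (pair a))
        (-Complex.I • (B.boundaryG L ω (pair b)).2, Complex.I • (B.boundaryG L ω (pair b)).1) := by
    have h3 : B.What L lam = ((B.What L lam)ᴴ)ᴴ := (conjTranspose_conjTranspose _).symm
    rw [Matrix.mul_assoc, ← mulVec_mulVec, h3, form_conjTranspose, star_dotProduct_eq_pairing,
      ← mulVec_mulVec, pair_Jp_mulVec, What_conjTranspose, What_conjTranspose,
      pair_blockMat_mulVec, pair_blockMat_mulVec]
  rw [h2, star_dotProduct_eq_pairing, pair_Jp_mulVec, pairing, pairing]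
  simp only [inner_smul_right]
  linear_combination Complex.I * h1

/-- `Ŵ(λ)` is invertible if `λ` and `λ̄` belong to `ρ(A, 𝔏)`. -/
theorem isUnit_What (hlam : lam ∈ gaugeRegular S A 𝔏) (hlam' : conj lam ∈ gaugeRegular S A 𝔏) :
    IsUnit (B.What L lam) := by
  have h1 := B.Jp_sub L hA hsymm hI hlam hlam'
  -- For ω = λ̄ the scalar factor vanishes, leaving J_p = Ŵ(λ)J_pŴ(λ̄)^*. Since J_p² = I, this
  -- exhibits a right inverse.
  rw [Complex.conj_conj, sub_self, mul_zero, zero_smul, sub_eq_zero] at h1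
  have h2 : B.What L lam * (Jp p * (B.What L (conj lam))ᴴ * Jp p) = 1 := by
    rw [← Matrix.mul_assoc, ← Matrix.mul_assoc, ← h1, Jp_mul_Jp]
  exact IsUnit.of_mul_eq_one _ h2

/-! ### Analyticity and the kernel on the diagonal -/

omit hsymm hI in
theorem differentiableAt_calQ_apply (hsymm : A ≤ adj S A)
    (hI : Complex.I ∈ regularPoints B.A0) (hlam : lam ∈ gaugeRegular S A 𝔏) (k : H) :
    DifferentiableAt ℂ (fun z => B.calQ L z k) lam := by
  have h1 : DifferentiableAt ℂ (fun z => Lstar L (B.regRes L z k)) lam :=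
    (Lstar L).differentiableAt.comp lam (B.differentiableAt_regRes_apply L hA hlam k)
  refine h1.congr_of_eventuallyEq ?_
  filter_upwards [(isOpen_gaugeRegular hA L).mem_nhds hlam] with z hz
  rw [B.calQ_eq L hA hsymm hI hz]
  rfl

theorem differentiableAt_G_apply (hlam : lam ∈ gaugeRegular S A 𝔏) (k : H) :
    DifferentiableAt ℂ (fun z => B.G L z k) lam := by
  have h1 : DifferentiableAt ℂ (fun z => calP L z (iota S A k)) lam := by
    refine (differentiableAt_gaugeCoord_apply L (iota S A k) hA hlam).congr_of_eventuallyEq ?_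
    filter_upwards [(isOpen_gaugeRegular hA L).mem_nhds hlam] with z hz
    rw [calP_eq L hA hz]
  exact (B.differentiableAt_calQ_apply L hA hsymm hI hlam k).neg.prodMk h1

omit hA hsymm hI in
theorem differentiableAt_pairing {f : ℂ → Cp p × Cp p} (w : Cp p × Cp p)
    (hf : DifferentiableAt ℂ f lam) : DifferentiableAt ℂ (fun z => pairing w (f z)) lam := by
  have h1 : DifferentiableAt ℂ (fun z => (innerSL ℂ w.1) (f z).1) lam :=
    (innerSL ℂ w.1).differentiableAt.comp lam hf.fst
  have h2 : DifferentiableAt ℂ (fun z => (innerSL ℂ w.2) (f z).2) lam :=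
    (innerSL ℂ w.2).differentiableAt.comp lam hf.snd
  exact h1.add h2

/-- Green's identity against a fixed element of A^{[*]} expresses boundary values of 𝒢̂(λ)^{⟨*⟩}
through 𝒢(λ) on fixed vectors. The conjugate makes the dependence on λ holomorphic. -/
theorem conj_boundaryG (hlam : lam ∈ gaugeRegular S A 𝔏) (g : adj S A) (w : Cp p × Cp p) :
    conj (⟪B.Γ0 g, (B.boundaryG L lam w).2⟫_ℂ - ⟪B.Γ1 g, (B.boundaryG L lam w).1⟫_ℂ) =
      -pairing w (B.G L lam (g.1.2 - lam • g.1.1)) - ⟪w.1, Lstar L (plus S A g.1)⟫_ℂ := by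
  have hF := B.GhatStar_coe L hA hsymm hI hlam w
  have h1 := B.green_ext hsymm hI (B.GhatStar L lam w) g
  have h2 := B.ip_Gstar L (lam := lam) (g.1.2 - lam • g.1.1) w
  rw [hF] at h1
  simp only [_root_.add_apply, iota_apply, incl_plus g.2, ← inner_Lstar] at h1
  have h3 := congrArg conj h1
  rw [map_sub, map_add, inner_conj_symm, S.conj_ip, S.conj_ip, S.ip_smul_right,
    Complex.conj_conj, inner_neg_left] at h3
  rw [← h2, S.ip_sub_left, S.ip_smul_left]
  refine Eq.trans h3.symm ?_
  ring

theorem differentiableAt_What_form (hlam : lam ∈ gaugeRegular S A 𝔏)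
    (a b : Fin p ⊕ Fin p → ℂ) :
    DifferentiableAt ℂ (fun z => star a ⬝ᵥ (B.What L z *ᵥ b)) lam := by
  -- With the boundary values (b₂, -b₁) the symplectic pairing in Green's identity becomes the
  -- Euclidean pairing with b.
  obtain ⟨g, hg0, hg1⟩ := B.exists_boundary (pair b).2 (-(pair b).1)
  have h1 : ∀ z ∈ gaugeRegular S A 𝔏, star a ⬝ᵥ (B.What L z *ᵥ b) =
      -(pairing (pair a) (B.G L z g.1.2) - z * pairing (pair a) (B.G L z g.1.1)) -
        ⟪(pair a).1, Lstar L (plus S A g.1)⟫_ℂ := by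
    intro z hz
    have h2 := B.conj_boundaryG L hA hsymm hI hz g (pair a)
    have h3 : B.What L z = ((B.What L z)ᴴ)ᴴ := (conjTranspose_conjTranspose _).symm
    rw [h3, form_conjTranspose, star_dotProduct_eq_pairing, What_conjTranspose,
      pair_blockMat_mulVec]
    rw [hg0, hg1, map_sub, inner_neg_left, inner_conj_symm, map_neg, inner_conj_symm, map_sub,
      map_smul] at h2
    have h4 : pairing (pair a) (B.G L z g.1.2 - z • B.G L z g.1.1) =
        pairing (pair a) (B.G L z g.1.2) - z * pairing (pair a) (B.G L z g.1.1) := by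
      simp only [pairing, Prod.fst_sub, Prod.snd_sub, Prod.smul_fst, Prod.smul_snd,
        inner_sub_right, inner_smul_right]
      ring
    rw [← h4, ← h2, pairing]
    ring
  have h2 : ∀ k, DifferentiableAt ℂ (fun z => pairing (pair a) (B.G L z k)) lam := fun k =>
    differentiableAt_pairing _ (B.differentiableAt_G_apply L hA hsymm hI hlam k)
  have h3 := (((h2 g.1.2).sub (differentiableAt_id.mul (h2 g.1.1))).neg).sub
    (differentiableAt_const ⟪(pair a).1, Lstar L (plus S A g.1)⟫_ℂ)
  refine h3.congr_of_eventuallyEq ?_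
  filter_upwards [(isOpen_gaugeRegular hA L).mem_nhds hlam] with z hz
  exact h1 z hz

omit hA hsymm hI in
theorem entry_eq_form {m : Type*} [Fintype m] [DecidableEq m] (M : Matrix m m ℂ) (i j : m) :
    M i j = star (Pi.single i 1) ⬝ᵥ (M *ᵥ Pi.single j 1) := by
  rw [← Pi.single_star]
  simp

theorem differentiableAt_What (hlam : lam ∈ gaugeRegular S A 𝔏) (i j : Fin p ⊕ Fin p) :
    DifferentiableAt ℂ (fun z => B.What L z i j) lam := by
  simp_rw [entry_eq_form (B.What L _) i j]
  exact B.differentiableAt_What_form L hA hsymm hI hlam _ _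

/-- Both sides of `Jp_sub` are differentiated in λ at ω̄. On the right the factor λ - ω̄ vanishes
there, so continuity of the other factor suffices. -/
theorem deriv_What (hω : ω ∈ gaugeRegular S A 𝔏) (hω' : conj ω ∈ gaugeRegular S A 𝔏) :
    (Matrix.of fun i j => deriv (fun z => B.What L z i j) (conj ω)) * Jp p * (B.What L ω)ᴴ =
      Complex.I • blockMat (B.G L (conj ω) ∘ₗ B.Gstar L ω) := by
  ext i j
  have hW : ∀ i j, HasDerivAt (fun z => B.What L z i j)
      ((Matrix.of fun i j => deriv (fun z => B.What L z i j) (conj ω)) i j) (conj ω) :=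
    fun i j => (B.differentiableAt_What L hA hsymm hI hω' i j).hasDerivAt
  have hN : ContinuousAt (fun z => blockMat (B.G L z ∘ₗ B.Gstar L ω) i j) (conj ω) := by
    have h1 : ∀ z, blockMat (B.G L z ∘ₗ B.Gstar L ω) i j =
        pairing (pair (Pi.single i 1)) (B.G L z (B.Gstar L ω (pair (Pi.single j 1)))) := by
      intro z
      rw [entry_eq_form (blockMat _), form_G, ip_Gstar]
    simp_rw [h1]
    exact (differentiableAt_pairing _
      (B.differentiableAt_G_apply L hA hsymm hI hω' _)).continuousAt
  have hL : HasDerivAt (fun z => (Jp p - B.What L z * Jp p * (B.What L ω)ᴴ) i j)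
      (-((Matrix.of fun i j => deriv (fun z => B.What L z i j) (conj ω)) * Jp p *
        (B.What L ω)ᴴ) i j) (conj ω) := by
    simp_rw [Matrix.mul_assoc, Matrix.sub_apply, Matrix.mul_apply]
    refine HasDerivAt.const_sub _ (HasDerivAt.fun_sum fun k _ => ?_)
    exact (hW i k).mul_const _
  have hR : HasDerivAt (fun z => (Jp p - B.What L z * Jp p * (B.What L ω)ᴴ) i j)
      (-Complex.I * blockMat (B.G L (conj ω) ∘ₗ B.Gstar L ω) i j) (conj ω) := by
    have h2 : HasDerivAt (fun z => (z - conj ω) *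
        (-Complex.I * blockMat (B.G L z ∘ₗ B.Gstar L ω) i j))
        (-Complex.I * blockMat (B.G L (conj ω) ∘ₗ B.Gstar L ω) i j) (conj ω) := by
      rw [hasDerivAt_iff_tendsto_slope]
      refine ((continuousAt_const.mul hN).tendsto.mono_left nhdsWithin_le_nhds).congr' ?_
      filter_upwards [self_mem_nhdsWithin] with z hz
      have hz' : z - conj ω ≠ 0 := sub_ne_zero.2 hz
      rw [slope_def_field, sub_self, zero_mul, sub_zero, mul_div_cancel_left₀ _ hz']
      rfl
    refine h2.congr_of_eventuallyEq ?_
    filter_upwards [(isOpen_gaugeRegular hA L).mem_nhds hω'] with z hz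
    rw [B.Jp_sub L hA hsymm hI hz hω, Matrix.smul_apply, smul_eq_mul]
    ring
  have h3 := hL.unique hR
  rw [Matrix.smul_apply, smul_eq_mul]
  linear_combination -h3

/-- The factorization of the kernel. -/
theorem kernelW_eq (hlam : lam ∈ gaugeRegular S A 𝔏) (hω : ω ∈ gaugeRegular S A 𝔏) :
    kernelW (B.What L) ω lam = blockMat (B.G L lam ∘ₗ B.Gstar L ω) := by
  rw [kernelW]
  split_ifs with h
  · subst h
    rw [B.deriv_What L hA hsymm hI hω hlam, smul_smul]
    simp
  · have h1 : -Complex.I * (lam - conj ω) ≠ 0 :=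
      mul_ne_zero (neg_ne_zero.2 Complex.I_ne_zero) (sub_ne_zero.2 h)
    rw [B.Jp_sub L hA hsymm hI hlam hω, smul_smul, inv_mul_cancel₀ h1, one_smul]

end ExtendedBoundaryTriple

end Triples

end

section

section Triples

variable {H : Type*} [NormedAddCommGroup H] [InnerProductSpace ℂ H] [CompleteSpace H]
variable {S : FundamentalSymmetry H} {A : Submodule ℂ (H × H)} {p : ℕ}
variable {𝔏 : Submodule ℂ (HMinus S A)} (L : Cp p ≃L[ℂ] 𝔏)

open scoped Matrix

/-! ### The `γ`-field and the Weyl function -/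

namespace BoundaryTriple

variable (B : BoundaryTriple S A p) {lam : ℂ}

theorem defect_coe (x : B.defect lam) : x.1.1.2 = lam • x.1.1.1 :=
  sub_eq_zero.1 (LinearMap.mem_ker.1 x.2)

section

variable (h : lam ∈ regularPoints B.A0)

include h

theorem Γ0_defect_injective :
    Function.Injective (B.Γ0 ∘ₗ (B.defect lam).subtype) := by
  rw [injective_iff_map_eq_zero]
  intro x hx
  have h1 : x.1.1 ∈ B.A0 := B.mem_A0_iff.2 ⟨x.1.2, hx⟩
  have h2 := B.defect_coe x
  have h3 : (x.1.1.1, lam • x.1.1.1) ∈ B.A0 := by rw [← h2]; exact h1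
  have h4 := h.1 _ h3
  rw [h4, smul_zero] at h2
  exact Subtype.ext (Subtype.ext (Prod.ext h4 h2))

theorem gammaHat_Γ0 (x : B.defect lam) : B.gammaHat lam (B.Γ0 x) = x :=
  leftInv_apply_of_injective _ (B.Γ0_defect_injective h) x

/-- Any element with Γ₀-value u becomes a defect element after subtracting the element of A₀ with
the same image under the map f' - λf; the Γ₀-value does not change. -/
theorem Γ0_gammaHat (u : Cp p) : B.Γ0 (B.gammaHat lam u : adj S A) = u := by
  obtain ⟨g, hg, -⟩ := B.exists_boundary u 0
  have h1 := relResolvent_mem h (g.1.2 - lam • g.1.1)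
  obtain ⟨h2, h3⟩ := B.mem_A0_iff.1 h1
  have h4 : g - ⟨_, h2⟩ ∈ B.defect lam := by
    rw [defect, LinearMap.mem_ker, minus_apply]
    simp only [Submodule.coe_sub, Prod.fst_sub, Prod.snd_sub]
    module
  have h5 : B.Γ0 (⟨_, h4⟩ : B.defect lam) = u := by
    rw [map_sub, h3, sub_zero, hg]
  rw [← h5, B.gammaHat_Γ0 h]

end

theorem gammaHat_coe (u : Cp p) :
    (B.gammaHat lam u).1.1 = (B.gamma lam u, lam • B.gamma lam u) :=
  Prod.ext rfl (B.defect_coe _)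

theorem gamma_mem (u : Cp p) : (B.gamma lam u, lam • B.gamma lam u) ∈ adj S A := by
  rw [← B.gammaHat_coe]
  exact (B.gammaHat lam u).1.2

theorem gammaPlus_apply (u : Cp p) :
    B.gammaPlus lam u = plus S A (B.gamma lam u, lam • B.gamma lam u) := by
  let T : Cp p →ₗ[ℂ] HPlus S A :=
    (plus S A).toLinearMap ∘ₗ (B.gamma lam).prod (lam • B.gamma lam)
  have h1 : liftPlus S A (B.gamma lam) = T := liftPlus_eq T fun u => incl_plus (B.gamma_mem u)
  have h2 : toCLM (liftPlus S A (B.gamma lam)) = LinearMap.toContinuousLinearMap T :=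
    toCLM_eq _ fun u => by rw [h1]; rfl
  rw [gammaPlus, h2]
  rfl

variable (hsymm : A ≤ adj S A) (h : lam ∈ regularPoints B.A0)

include hsymm h

/-- `M(λ̄)^* = M(λ)`. -/
theorem inner_weyl (u v : Cp p) :
    ⟪B.weyl (conj lam) u, v⟫_ℂ = ⟪u, B.weyl lam v⟫_ℂ := by
  have h' := B.conj_mem_regularPoints hsymm h
  have h1 := B.green (B.gammaHat lam v).1 (B.gammaHat (conj lam) u).1
  rw [B.Γ0_gammaHat h, B.Γ0_gammaHat h', B.gammaHat_coe, B.gammaHat_coe] at h1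
  simp only [S.ip_smul_left, S.ip_smul_right, Complex.conj_conj, sub_self] at h1
  exact (sub_eq_zero.1 h1.symm).symm

omit hsymm h in
/-- The second component of the regularized extended resolvent. -/
def hatResSnd (lam : ℂ) : HMinus S A →ₗ[ℂ] H := lam • B.extRes0 lam - B.regSnd

variable (hI : Complex.I ∈ regularPoints B.A0)

include hI

/-- The extended resolvent and the regularization carry the same singular part 𝔣, so their
difference is regular. This is why R̂_λ maps H₋ into H₊. -/
theorem hatRes_mem (f : HMinus S A) : (B.hatRes0 lam f, B.hatResSnd lam f) ∈ B.A0 := by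
  refine B.mem_A0_of_ip hsymm fun y hy => ?_
  have h1 := B.extRes0_spec hsymm h f hy
  have h2 := B.reg_spec hsymm hI f hy
  simp only [hatRes0, hatResSnd, LinearMap.sub_apply, LinearMap.smul_apply, S.ip_sub_left,
    S.ip_smul_left]
  linear_combination h2 - h1

theorem liftPlus_hatRes0 (f : HMinus S A) : liftPlus S A (B.hatRes0 lam) f =
    plus S A (B.hatRes0 lam f, B.hatResSnd lam f) := by
  rw [liftPlus_eq ((plus S A).toLinearMap ∘ₗ (B.hatRes0 lam).prod (B.hatResSnd lam))
    fun f => incl_plus (B.A0_le (B.hatRes_mem hsymm h hI f))]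
  rfl

/-- `(R̂_λ)^{⟨*⟩} = R̂_λ̄`. -/
theorem apply_hatRes0 (f g : HMinus S A) :
    f (liftPlus S A (B.hatRes0 (conj lam)) g) = conj (g (liftPlus S A (B.hatRes0 lam) f)) := by
  have h' := B.conj_mem_regularPoints hsymm h
  have h1 := B.extRes0_spec hsymm h f (B.hatRes_mem hsymm h' hI g)
  have h2 := congrArg conj (B.reg_spec hsymm hI g (B.hatRes_mem hsymm h hI f))
  have h3 := B.ip_reg_regSnd hsymm hI f g
  rw [B.liftPlus_hatRes0 hsymm h hI, B.liftPlus_hatRes0 hsymm h' hI, ← h1, ← h2]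
  simp only [hatRes0, hatResSnd, LinearMap.sub_apply, LinearMap.smul_apply, S.ip_sub_right,
    S.ip_smul_right, map_sub, S.conj_ip, Complex.conj_conj, map_mul]
  linear_combination -h3

end BoundaryTriple

/-! ### The resolvent matrix -/

namespace ExtendedBoundaryTriple

open BoundaryTriple

variable (B : ExtendedBoundaryTriple S A p) (hA : IsClosed (A : Set (H × H)))
  (hsymm : A ≤ adj S A) (hI : Complex.I ∈ regularPoints B.A0) {lam : ℂ}

/-- The operator `𝔞₁₂(λ)^* = L^{⟨*⟩} γ(λ̄)`. -/
def a12Star (lam : ℂ) : Cp p →ₗ[ℂ] Cp p :=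
  (Lstar L).toLinearMap ∘ₗ (B.gammaPlus (conj lam)).toLinearMap

/-- The operator `𝔞₂₂(λ)^* = L^{⟨*⟩} R̂_λ̄ L`. -/
def a22Star (lam : ℂ) : Cp p →ₗ[ℂ] Cp p :=
  (Lstar L).toLinearMap ∘ₗ liftPlus S A (B.hatRes0 (conj lam)) ∘ₗ (gaugeMap L).toLinearMap

/-- The block `Γ̂₀ 𝒫̂(λ)^{⟨*⟩}`. -/
def boundaryP (lam : ℂ) : Cp p →ₗ[ℂ] Cp p :=
  LinearMap.fst ℂ _ _ ∘ₗ B.boundaryG L lam ∘ₗ LinearMap.inr ℂ _ _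

theorem a12_conjTranspose : (B.a12 L lam)ᴴ = mat (B.a12Star L lam) := by
  refine mat_conjTranspose fun u v => ?_
  have h1 := inner_Lstar L (B.gammaPlus (conj lam) v) u
  rw [← inner_conj_symm, LinearMap.comp_apply, dualAdjOfPlus_spec]
  rw [← inner_conj_symm]
  exact congrArg conj h1.symm

theorem regular_defect (hlam0 : conj lam ∈ regularPoints B.A0) {n : H}
    (hn : (n, conj lam • n) ∈ adj S A) :
    B.gamma (conj lam) (B.Γ0 ⟨_, hn⟩) = n ∧
      B.weyl (conj lam) (B.Γ0 ⟨_, hn⟩) = B.Γ1 ⟨_, hn⟩ := by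
  have h1 : (⟨_, hn⟩ : adj S A) ∈ B.defect (conj lam) := by
    rw [defect, LinearMap.mem_ker, minus_apply]
    simp
  have h2 := B.gammaHat_Γ0 hlam0 ⟨_, h1⟩
  constructor
  · exact congrArg (fun x : B.defect (conj lam) => x.1.1.1) h2
  · exact congrArg (fun x : B.defect (conj lam) => B.Γ1 x.1) h2

include hA hsymm hI

variable (hlam : lam ∈ gaugeRegular S A 𝔏)

include hlam

theorem boundaryG_inr (v : Cp p) :
    B.boundaryG L lam (0, v) = (B.Γ0 ⟨_, calPstar_mem L hA hlam v⟩,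
      B.Γ1 ⟨_, calPstar_mem L hA hlam v⟩) := by
  have h1 : B.GhatStar L lam (0, v) = B.emb ⟨_, calPstar_mem L hA hlam v⟩ := by
    apply Subtype.ext
    rw [B.GhatStar_coe L hA hsymm hI hlam, Gstar_apply]
    simp [emb]
  change (B.Γ0hat _, B.Γ1hat _) = _
  rw [h1]
  exact Prod.ext (B.ext0 _ _) (B.ext1 _ _)

variable (hlam0 : lam ∈ regularPoints B.A0)

include hlam0

/-- 𝒫(λ)^{⟨*⟩}v is a defect vector at λ̄, hence γ(λ̄) applied to its Γ₀-value. Applying L^{⟨*⟩}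
returns v. -/
theorem a12Star_boundaryP : B.a12Star L lam ∘ₗ B.boundaryP L lam = LinearMap.id := by
  refine LinearMap.ext fun v => ?_
  have h1 : B.boundaryP L lam v = B.Γ0 ⟨_, calPstar_mem L hA hlam v⟩ :=
    congrArg Prod.fst (B.boundaryG_inr L hA hsymm hI hlam v)
  have h2 := (B.regular_defect (B.conj_mem_regularPoints hsymm hlam0)
    (calPstar_mem L hA hlam v)).1
  have h3 := Lstar_calPstar L hA hlam v
  rw [eq_plus (calPstar_mem L hA hlam v) rfl] at h3
  rw [LinearMap.comp_apply, h1]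
  change Lstar L (B.gammaPlus (conj lam) _) = v
  rw [B.gammaPlus_apply, h2, h3]

theorem boundaryP_a12Star : B.boundaryP L lam ∘ₗ B.a12Star L lam = LinearMap.id :=
  (LinearMap.comp_eq_id_comm ℂ (Cp p)).1 (B.a12Star_boundaryP L hA hsymm hI hlam hlam0)

theorem a12_inv : (B.a12 L lam)⁻¹ = (mat (B.boundaryP L lam))ᴴ := by
  refine Matrix.inv_eq_left_inv ?_
  have h1 := B.a12Star_boundaryP L hA hsymm hI hlam hlam0
  rw [← Matrix.conjTranspose_conjTranspose (B.a12 L lam), a12_conjTranspose,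
    ← Matrix.conjTranspose_mul, mat_mul, h1, mat_id, Matrix.conjTranspose_one]

omit hA hI hlam in
/-- `(R̃_λ̄ 𝔣, λ̄ R̃_λ̄ 𝔣 + 𝔣)` belongs to `A^{⟨*⟩}`. -/
theorem extRes0_mem_adjHat (f : HMinus S A) : (B.extRes0 (conj lam) f,
    iota S A (conj lam • B.extRes0 (conj lam) f) + f) ∈ adjHat S A := by
  intro y y' hy
  have h1 := B.extRes0_spec hsymm (B.conj_mem_regularPoints hsymm hlam0) f (B.le_A0 hsymm hy)
  rw [← eq_plus (hsymm hy) rfl] at h1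
  simp only [add_apply, iota_apply, S.ip_smul_left]
  linear_combination -h1

omit hA hlam in
/-- The boundary values of `(R̃_λ̄ 𝔣, λ̄ R̃_λ̄ 𝔣 + 𝔣)`. -/
theorem Γhat_extRes0 (f : HMinus S A) (hf : (B.extRes0 (conj lam) f,
      iota S A (conj lam • B.extRes0 (conj lam) f) + f) ∈ adjHat S A) :
    B.Γ0hat ⟨_, hf⟩ = 0 ∧ ∀ v, ⟪v, B.Γ1hat ⟨_, hf⟩⟫_ℂ = f (B.gammaPlus lam v) := by
  have h' := B.conj_mem_regularPoints hsymm hlam0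
  have h0 : B.Γ0hat ⟨_, hf⟩ = 0 := by
    obtain ⟨g, hg0, hg1⟩ := B.exists_boundary 0 (B.Γ0hat ⟨_, hf⟩)
    have h1 := B.green_ext hsymm hI ⟨_, hf⟩ g
    have h2 := B.extRes0_spec hsymm h' f (B.mem_A0_iff.2 ⟨g.2, hg0⟩)
    rw [hg0, hg1, inner_zero_left] at h1
    simp only [add_apply, iota_apply, incl_plus g.2, S.ip_smul_left] at h1
    rw [← h2] at h1
    refine (inner_self_eq_zero (𝕜 := ℂ)).1 ?_
    linear_combination h1
  refine ⟨h0, fun v => ?_⟩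
  -- Against a defect element at λ the two resolvent terms cancel, and only the functional evaluated
  -- at γ(λ)v remains.
  have h1 := B.green_ext hsymm hI ⟨_, hf⟩ (B.gammaHat lam v).1
  rw [B.Γ0_gammaHat hlam0, h0, inner_zero_right, sub_zero] at h1
  rw [← h1, B.gammaPlus_apply, B.gammaHat_coe]
  simp only [add_apply, iota_apply, incl_plus (B.gamma_mem v), S.ip_smul_left, S.ip_smul_right]
  ring

theorem boundaryG_inl (u : Cp p) :
    (B.boundaryG L lam (u, 0)).1 = B.boundaryP L lam (B.a22Star L lam u) ∧
      ∀ v, ⟪v, (B.boundaryG L lam (u, 0)).2 -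
        B.weyl (conj lam) (B.boundaryP L lam (B.a22Star L lam u))⟫_ℂ =
        -⟪Lstar L (B.gammaPlus lam v), u⟫_ℂ := by
  have h' := B.conj_mem_regularPoints hsymm hlam0
  set f := gaugeMap L (-u) with hf
  set w := B.Gstar L lam (u, 0) with hw
  have hE := B.extRes0_mem_adjHat hsymm hlam0 f
  have hF := B.GhatStar_coe L hA hsymm hI hlam (u, 0)
  simp only at hF
  rw [← hf, ← hw] at hF
  -- The two elements of A^{⟨*⟩} have the same singular part f = -Lu, so their difference is a
  -- defect element at λ̄, governed by γ(λ̄) and M(λ̄).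
  have hn : (w - B.extRes0 (conj lam) f, conj lam • (w - B.extRes0 (conj lam) f)) ∈
      adj S A := by
    refine mem_adj_of_adjHat hsymm ?_
    have h1 := (adjHat S A).sub_mem (B.GhatStar L lam (u, 0)).2 hE
    rw [hF, Prod.mk_sub_mk, add_sub_add_right_eq_sub, ← map_sub, ← smul_sub] at h1
    exact h1
  have hG : B.GhatStar L lam (u, 0) = B.emb ⟨_, hn⟩ + ⟨_, hE⟩ := by
    apply Subtype.ext
    rw [hF]
    simp only [emb, Submodule.coe_add, Prod.mk_add_mk, sub_add_cancel]
    refine Prod.ext rfl ?_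
    rw [← add_assoc, ← map_add, ← smul_add, sub_add_cancel]
  obtain ⟨hE0, hE1⟩ := B.Γhat_extRes0 hsymm hI hlam0 f hE
  obtain ⟨hγ, hM⟩ := B.regular_defect h' hn
  have h0 : (B.boundaryG L lam (u, 0)).1 = B.Γ0 ⟨_, hn⟩ := by
    change B.Γ0hat _ = _
    rw [hG, map_add, hE0, add_zero]
    exact B.ext0 _ _
  have h1 : (B.boundaryG L lam (u, 0)).2 = B.Γ1 ⟨_, hn⟩ + B.Γ1hat ⟨_, hE⟩ := by
    change B.Γ1hat _ = _
    rw [hG, map_add]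
    congr 1
    exact B.ext1 _ _
  -- L^{⟨*⟩} of the regular part of 𝒢̂(λ)^{⟨*⟩}(u, 0) is 0; replacing the regularization by the
  -- extended resolvent changes it by L^{⟨*⟩}R̂_λ̄Lu. This determines the Γ₀-value of the defect
  -- element.
  have h2 : B.a12Star L lam (B.Γ0 ⟨_, hn⟩) = B.a22Star L lam u := by
    have h3 := B.Lstar_Gstar L hA hsymm hI hlam (u, 0)
    simp only at h3
    rw [← hf, ← hw] at h3
    change Lstar L (B.gammaPlus (conj lam) (B.Γ0 ⟨_, hn⟩)) =
      Lstar L (liftPlus S A (B.hatRes0 (conj lam)) (gaugeMap L u))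
    rw [B.gammaPlus_apply, hγ]
    have h4 : (w - B.extRes0 (conj lam) f, conj lam • (w - B.extRes0 (conj lam) f)) =
        (w - B.extRegularizer f, conj lam • w - B.regSnd f) -
          (B.hatRes0 (conj lam) f, B.hatResSnd (conj lam) f) := by
      rw [Prod.mk_sub_mk, smul_sub]
      simp only [hatRes0, hatResSnd, LinearMap.sub_apply, LinearMap.smul_apply]
      congr 1 <;> abel
    rw [h4, map_sub, map_sub, h3, ← B.liftPlus_hatRes0 hsymm h' hI, hf, map_neg, map_neg, map_neg,
      zero_sub, neg_neg]
  have h5 : B.Γ0 ⟨_, hn⟩ = B.boundaryP L lam (B.a22Star L lam u) := by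
    rw [← h2]
    exact (LinearMap.congr_fun (B.boundaryP_a12Star L hA hsymm hI hlam hlam0) _).symm
  refine ⟨h0.trans h5, fun v => ?_⟩
  rw [← h5, hM, h1, add_sub_cancel_left, hE1, hf, ← inner_Lstar, inner_neg_right]

/-- The function `Ŵ` coincides with the `Π𝔏`-resolvent matrix. -/
theorem What_eq_resolventMatrix : B.What L lam = B.resolventMatrix L lam := by
  have hinv := B.a12_inv L hA hsymm hI hlam hlam0
  have h' := B.conj_mem_regularPoints hsymm hlam0
  have hM : (mat (B.weyl (conj lam)))ᴴ = B.a11 lam :=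
    mat_conjTranspose (B.inner_weyl hsymm hlam0)
  have hd : (mat (B.a22Star L lam))ᴴ = B.a22 L lam := by
    refine mat_conjTranspose fun u v => ?_
    have h1 := B.apply_hatRes0 hsymm hlam0 hI (gaugeMap L v) (gaugeMap L u)
    change ⟪Lstar L _, v⟫_ℂ = ⟪u, Lstar L _⟫_ℂ
    rw [inner_Lstar, ← inner_conj_symm, inner_Lstar]
    exact h1
  set T := B.boundaryG L lam with hT
  have e11 : LinearMap.fst ℂ _ _ ∘ₗ T ∘ₗ LinearMap.inl ℂ _ _ =
      B.boundaryP L lam ∘ₗ B.a22Star L lam :=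
    LinearMap.ext fun u => (B.boundaryG_inl L hA hsymm hI hlam hlam0 u).1
  have e22 : LinearMap.snd ℂ _ _ ∘ₗ T ∘ₗ LinearMap.inr ℂ _ _ =
      B.weyl (conj lam) ∘ₗ B.boundaryP L lam := by
    refine LinearMap.ext fun v => ?_
    have h1 := B.boundaryG_inr L hA hsymm hI hlam v
    have h2 := (B.regular_defect h' (calPstar_mem L hA hlam v)).2
    change (T (0, v)).2 = B.weyl (conj lam) (T (0, v)).1
    rw [hT, h1, h2]
  -- The part of the Γ₁-value contributed by the extended resolvent rather than by the defect
  -- element; its adjoint is -𝔞₂₁.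
  let R : Cp p →ₗ[ℂ] Cp p := LinearMap.snd ℂ _ _ ∘ₗ T ∘ₗ LinearMap.inl ℂ _ _ -
    B.weyl (conj lam) ∘ₗ B.boundaryP L lam ∘ₗ B.a22Star L lam
  have e21 : LinearMap.snd ℂ _ _ ∘ₗ T ∘ₗ LinearMap.inl ℂ _ _ =
      B.weyl (conj lam) ∘ₗ B.boundaryP L lam ∘ₗ B.a22Star L lam + R :=
    (add_sub_cancel _ _).symm
  have hadd : ∀ P Q : Cp p →ₗ[ℂ] Cp p, mat (P + Q) = mat P + mat Q := fun _ _ => rfl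
  have hR : (mat R)ᴴ = -B.a21 L lam := by
    have hneg : -B.a21 L lam =
        mat (-((Lstar L).toLinearMap ∘ₗ (B.gammaPlus lam).toLinearMap)) := rfl
    rw [hneg]
    refine mat_conjTranspose fun u v => ?_
    have h1 := (B.boundaryG_inl L hA hsymm hI hlam hlam0 u).2 v
    rw [← inner_conj_symm]
    refine (congrArg conj h1).trans ?_
    rw [map_neg, inner_conj_symm, ← inner_neg_right]
    rfl
  have hW : B.What L lam = (blockMat T)ᴴ := by
    rw [hT, ← What_conjTranspose, Matrix.conjTranspose_conjTranspose]
  have e12 : LinearMap.fst ℂ _ _ ∘ₗ T ∘ₗ LinearMap.inr ℂ _ _ = B.boundaryP L lam := rfl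
  rw [hW, blockMat, Matrix.fromBlocks_conjTranspose, e11, e12, e22, e21, hadd, resolventMatrix,
    Matrix.conjTranspose_add, hR, ← mat_mul, ← mat_mul, ← mat_mul, ← mat_mul]
  simp only [Matrix.conjTranspose_mul, hM, hd, ← hinv]
  rw [← sub_eq_add_neg]

end ExtendedBoundaryTriple

end Triples

end

section

/-! ### Nonpositive eigenvectors of isometries of an indefinite form -/

section Perturbation

variable {X : Type*} [NormedAddCommGroup X] [NormedSpace ℂ X] [CompleteSpace X]

/-- An injective perturbation of the identity by an operator of finite rank is bijective. -/
theorem bijective_one_add_of_finiteRank {K : X →ₗ[ℂ] X}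
    (hK : FiniteDimensional ℂ (LinearMap.range K)) (hinj : ∀ x, x + K x = 0 → x = 0) :
    Function.Bijective (LinearMap.id + K : X →ₗ[ℂ] X) := by
  refine ⟨(injective_iff_map_eq_zero _).2 hinj, fun y => ?_⟩
  let R := LinearMap.range K
  have hR : ∀ x ∈ R, (LinearMap.id + K : X →ₗ[ℂ] X) x ∈ R := fun x hx =>
    R.add_mem hx ⟨x, rfl⟩
  let N : R →ₗ[ℂ] R := (LinearMap.id + K : X →ₗ[ℂ] X).restrict hR
  have hN : Function.Injective N := by
    rw [injective_iff_map_eq_zero]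
    intro x hx
    exact Subtype.ext (hinj x (congrArg Subtype.val hx))
  -- A solution of (1 + K)x = y is sought as y + r with r in the range of K, which reduces
  -- surjectivity to finite dimension.
  obtain ⟨r, hr⟩ := LinearMap.injective_iff_surjective.1 hN ⟨-K y, R.neg_mem ⟨y, rfl⟩⟩
  have hr' : (r : X) + K r = -K y := congrArg Subtype.val hr
  refine ⟨y + r, ?_⟩
  change (y + r) + K (y + r) = y
  rw [map_add, add_add_add_comm, hr']
  abel

theorem isUnit_of_bijective {T : X →L[ℂ] X} (hT : Function.Bijective T) : IsUnit T := by
  have hker : LinearMap.ker T.toLinearMap = ⊥ := LinearMap.ker_eq_bot.2 hT.1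
  have hran : LinearMap.range T.toLinearMap = ⊤ := LinearMap.range_eq_top.2 hT.2
  let e := ContinuousLinearEquiv.ofBijective T hker hran
  refine ⟨⟨T, e.symm.toContinuousLinearMap, ?_, ?_⟩, rfl⟩
  · ext x
    exact e.apply_symm_apply x
  · ext x
    exact e.symm_apply_apply x

/-- A spectral value `z` of `C + F` with `‖C‖ < |z|` and `F` of finite rank is an eigenvalue. -/
theorem exists_eigenvector_of_mem_spectrum [Nontrivial X] {C F : X →L[ℂ] X}
    (hF : FiniteDimensional ℂ (LinearMap.range F.toLinearMap)) {z : ℂ} (hz : ‖C‖ < ‖z‖)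
    (hmem : z ∈ spectrum ℂ (C + F)) : ∃ y ≠ 0, (C + F) y = z • y := by
  obtain ⟨U, hU⟩ := spectrum.mem_resolventSet_of_norm_lt hz
  let U' : X →L[ℂ] X := (U⁻¹ : (X →L[ℂ] X)ˣ)
  have hUU : ∀ x, (U : X →L[ℂ] X) (U' x) = x := fun x => by
    have : (U : X →L[ℂ] X) * U' = 1 := U.mul_inv
    exact congrArg (fun T : X →L[ℂ] X => T x) this
  have hUx : ∀ x, (U : X →L[ℂ] X) x = z • x - C x := fun x => by
    rw [hU]
    simp [Algebra.algebraMap_eq_smul_one]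
  -- With U = z - C invertible, z - (C + F) = U(1 + K) and K has finite rank.
  let K : X →ₗ[ℂ] X := -(U'.toLinearMap ∘ₗ F.toLinearMap)
  have hK : FiniteDimensional ℂ (LinearMap.range K) := by
    have : LinearMap.range K ≤ (LinearMap.range F.toLinearMap).map U'.toLinearMap := by
      rintro _ ⟨x, rfl⟩
      exact ⟨F (-x), ⟨-x, rfl⟩, by simp [K]⟩
    exact Submodule.finiteDimensional_of_le this
  have hUK : ∀ x, (U : X →L[ℂ] X) (x + K x) = z • x - (C + F) x := fun x => by
    have : K x = -U' (F x) := rfl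
    rw [map_add, this, map_neg, hUU, hUx, add_apply]
    abel
  by_contra! hne
  have hinj : ∀ x, x + K x = 0 → x = 0 := by
    intro x hx
    by_contra hx0
    refine hne x hx0 ?_
    have h1 := hUK x
    rw [hx, map_zero] at h1
    exact (sub_eq_zero.1 h1.symm).symm
  have hbij := bijective_one_add_of_finiteRank hK hinj
  refine (spectrum.mem_iff.1 hmem) (isUnit_of_bijective ?_)
  have hcomp : ⇑(algebraMap ℂ (X →L[ℂ] X) z - (C + F)) =
      ⇑(U : X →L[ℂ] X) ∘ ⇑(LinearMap.id + K : X →ₗ[ℂ] X) := by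
    funext x
    refine Eq.trans ?_ (hUK x).symm
    simp [Algebra.algebraMap_eq_smul_one]
  rw [hcomp]
  refine Function.Bijective.comp ⟨fun x y hxy => ?_, fun y => ⟨U' y, hUU y⟩⟩ hbij
  have hUU' : ∀ x, U' ((U : X →L[ℂ] X) x) = x := fun x => by
    have : U' * (U : X →L[ℂ] X) = 1 := U.inv_mul
    exact congrArg (fun T : X →L[ℂ] X => T x) this
  rw [← hUU' x, hxy, hUU']

/-- If some orbit does not tend to zero, then the spectral radius is at least one. -/
theorem exists_one_le_norm_mem_spectrum [Nontrivial X] {T : X →L[ℂ] X} {x : X}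
    (hx : ¬ Filter.Tendsto (fun n => (T ^ n) x) Filter.atTop (nhds 0)) :
    ∃ z ∈ spectrum ℂ T, 1 ≤ ‖z‖ := by
  by_contra! hlt
  obtain ⟨z, hz, hzr⟩ := spectrum.exists_nnnorm_eq_spectralRadius T
  have h1 : spectralRadius ℂ T < 1 := by
    rw [← hzr]
    have : ‖z‖₊ < 1 := hlt z hz
    exact_mod_cast this
  -- By Gelfand's formula ‖T^n‖ ≤ s^n eventually, with s < 1, so every orbit would tend to zero.
  obtain ⟨s, hs1, hs2⟩ := ENNReal.lt_iff_exists_nnreal_btwn.1 h1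
  have hs3 : s < 1 := by exact_mod_cast hs2
  have h2 := spectrum.pow_nnnorm_pow_one_div_tendsto_nhds_spectralRadius T
  refine hx ?_
  have h3 : ∀ᶠ n : ℕ in Filter.atTop, ‖(T ^ n) x‖ ≤ (s : ℝ) ^ n * ‖x‖ := by
    filter_upwards [h2.eventually (gt_mem_nhds hs1), Filter.eventually_gt_atTop 0] with n hn hn0
    have h4 : ‖T ^ n‖₊ ≤ s ^ n := by
      have h5 : ((‖T ^ n‖₊ : ENNReal) ^ (1 / (n : ℝ))) ^ (n : ℝ) ≤ (s : ENNReal) ^ (n : ℝ) :=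
        ENNReal.rpow_le_rpow hn.le (by positivity)
      rw [← ENNReal.rpow_mul, one_div, inv_mul_cancel₀ (by positivity), ENNReal.rpow_one,
        ENNReal.rpow_natCast] at h5
      exact_mod_cast h5
    have h6 : ‖T ^ n‖ ≤ (s : ℝ) ^ n := by exact_mod_cast h4
    exact ((T ^ n).le_opNorm x).trans (mul_le_mul_of_nonneg_right h6 (norm_nonneg _))
  refine squeeze_zero_norm' h3 ?_
  have h7 := (tendsto_pow_atTop_nhds_zero_of_lt_one s.2 (by exact_mod_cast hs3)).mul_const ‖x‖
  rw [zero_mul] at h7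
  exact h7

end Perturbation

section Pontryagin

variable {X : Type*} [NormedAddCommGroup X] [InnerProductSpace ℂ X] [CompleteSpace X]
variable {E : Type*} [NormedAddCommGroup E] [InnerProductSpace ℂ E] [FiniteDimensional ℂ E]
variable (Q : X →L[ℂ] E)

/-- The quadratic form `‖x‖² - 2 ‖Q x‖²`. -/
def indef (x : X) : ℝ := ‖x‖ ^ 2 - 2 * ‖Q x‖ ^ 2

/-- The Gram operator `1 - 2 Q* Q` of the form `indef`. -/
def gramOp : X →L[ℂ] X :=
  have : CompleteSpace E := FiniteDimensional.complete ℂ E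
  1 - (2 : ℂ) • (ContinuousLinearMap.adjoint Q ∘L Q)

theorem inner_gramOp_left (x y : X) : ⟪gramOp Q x, y⟫_ℂ = ⟪x, y⟫_ℂ - 2 * ⟪Q x, Q y⟫_ℂ := by
  have : CompleteSpace E := FiniteDimensional.complete ℂ E
  simp only [gramOp, sub_apply, one_apply_eq_self, smul_apply, ContinuousLinearMap.comp_apply,
    inner_sub_left, inner_smul_left, ContinuousLinearMap.adjoint_inner_left, Complex.conj_ofNat]

theorem inner_gramOp_right (x y : X) : ⟪x, gramOp Q y⟫_ℂ = ⟪x, y⟫_ℂ - 2 * ⟪Q x, Q y⟫_ℂ := by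
  rw [← inner_conj_symm, inner_gramOp_left, map_sub, map_mul, inner_conj_symm, inner_conj_symm,
    Complex.conj_ofNat]

theorem indef_eq (x : X) : ⟪gramOp Q x, x⟫_ℂ = indef Q x := by
  rw [inner_gramOp_left, inner_self_eq_norm_sq_to_K, inner_self_eq_norm_sq_to_K, indef]
  push_cast
  rfl

theorem gramOp_of_eq_zero {x : X} (h : Q x = 0) : gramOp Q x = x := by
  simp [gramOp, h]

theorem indef_sub_smul (ε : ℝ) (x : X) : indef Q (x - (ε : ℂ) • gramOp Q x) =
    indef Q x - 2 * ε * ‖gramOp Q x‖ ^ 2 + ε ^ 2 * indef Q (gramOp Q x) := by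
  have h1 := indef_eq Q (x - (ε : ℂ) • gramOp Q x)
  rw [map_sub, map_smul, inner_sub_left, inner_sub_right, inner_sub_right, inner_smul_right,
    inner_smul_left, inner_smul_left, inner_smul_right, indef_eq, indef_eq, Complex.conj_ofReal]
    at h1
  have h2 : ⟪gramOp Q (gramOp Q x), x⟫_ℂ = ⟪gramOp Q x, gramOp Q x⟫_ℂ := by
    rw [inner_gramOp_left, inner_gramOp_right]
  rw [h2, inner_self_eq_norm_sq_to_K] at h1
  have h3 : ((indef Q x - 2 * ε * ‖gramOp Q x‖ ^ 2 + ε ^ 2 * indef Q (gramOp Q x) : ℝ) : ℂ) =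
      (indef Q (x - (ε : ℂ) • gramOp Q x) : ℝ) := by
    rw [← h1]
    push_cast
    simp only [Complex.coe_algebraMap]
    ring
  exact_mod_cast h3.symm

theorem indef_le (x : X) : indef Q x ≤ ‖x‖ ^ 2 := by
  rw [indef]
  linarith [sq_nonneg ‖Q x‖]

theorem indef_smul (c : ℂ) (x : X) : indef Q (c • x) = ‖c‖ ^ 2 * indef Q x := by
  rw [indef, indef, map_smul, norm_smul, norm_smul]
  ring

theorem continuous_indef : Continuous (indef Q) := by
  unfold indef
  fun_prop

/-- A step against the gradient of the form. The loss is of first order in ε, and the second-order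
term is at most ε‖Gx‖², where G is the Gram operator. -/
theorem indef_sub_smul_le {ε : ℝ} (h0 : 0 ≤ ε) (h1 : ε ≤ 1) (x : X) :
    indef Q (x - (ε : ℂ) • gramOp Q x) ≤ indef Q x - ε * ‖gramOp Q x‖ ^ 2 := by
  rw [indef_sub_smul]
  have h2 := indef_le Q (gramOp Q x)
  have h3 : ε ^ 2 ≤ ε := by nlinarith
  nlinarith [sq_nonneg ‖gramOp Q x‖, sq_nonneg ε]

variable {V : X →L[ℂ] X} (hV : ∀ x, indef Q (V x) = indef Q x)

include hV

/-- A perturbed isometry has a nonpositive eigenvector. -/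
theorem exists_perturbed_eigenvector {ε : ℝ} (h0 : 0 < ε) (h1 : ε ≤ 1) {x : X}
    (hx : indef Q x < 0) : ∃ y : X, ‖y‖ = 1 ∧ indef Q y ≤ 0 ∧
      ∃ z : ℂ, V (y - (ε : ℂ) • gramOp Q y) = z • y := by
  have hx0 : x ≠ 0 := by
    rintro rfl
    simp [indef] at hx
  have : Nontrivial X := ⟨x, 0, hx0⟩
  let D : X →L[ℂ] X := 1 - (ε : ℂ) • gramOp Q
  have hD : ∀ y, D y = y - (ε : ℂ) • gramOp Q y := fun _ => rfl
  let T : X →L[ℂ] X := V * D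
  have hT : ∀ y, T y = V (D y) := fun _ => rfl
  have hTq : ∀ y, indef Q (T y) ≤ indef Q y - ε * ‖gramOp Q y‖ ^ 2 := fun y => by
    rw [hT, hV, hD]
    exact indef_sub_smul_le Q h0.le h1 y
  -- The form does not increase along the orbit, so it stays below its negative initial value and
  -- cannot reach 0.
  have horb : ¬ Filter.Tendsto (fun n => (T ^ n) x) Filter.atTop (nhds 0) := by
    intro h
    have h2 : ∀ n, indef Q ((T ^ n) x) ≤ indef Q x := by
      intro n
      induction n with
      | zero => simp
      | succ n ih =>
        rw [pow_succ', mul_apply_eq_comp]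
        have h3 := hTq ((T ^ n) x)
        nlinarith [sq_nonneg ‖gramOp Q ((T ^ n) x)‖]
    have h3 := le_of_tendsto' (((continuous_indef Q).tendsto 0).comp h) h2
    have h4 : indef Q 0 = 0 := by simp [indef]
    linarith
  obtain ⟨z, hz, hz1⟩ := exists_one_le_norm_mem_spectrum horb
  let Q' : X →L[ℂ] E × E := Q.prod (Q ∘L V)
  -- On this subspace of finite codimension the form is the squared norm both at m and at Vm, so V
  -- preserves norms and T contracts by 1 - ε. Hence spectral values of modulus at least 1 are
  -- eigenvalues.
  let M : Submodule ℂ X := LinearMap.ker Q'.toLinearMap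
  have hMc : IsClosed (M : Set X) := Q'.isClosed_ker
  have : CompleteSpace M := hMc.completeSpace_coe
  let C : X →L[ℂ] X := T ∘L M.starProjection
  let F : X →L[ℂ] X := T ∘L Mᗮ.starProjection
  have hCF : T = C + F := by
    ext y
    change T y = T (M.starProjection y) + T (Mᗮ.starProjection y)
    rw [← map_add]
    congr 1
    exact (M.starProjection_add_starProjection_orthogonal y).symm
  have hperp : FiniteDimensional ℂ Mᗮ := by
    refine FiniteDimensional.of_injective (Q'.toLinearMap ∘ₗ Mᗮ.subtype) ?_
    rw [injective_iff_map_eq_zero]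
    intro y hy
    have hyM : (y : X) ∈ M := hy
    have := (Submodule.mem_orthogonal M y).1 y.2 _ hyM
    exact Subtype.ext (inner_self_eq_zero.1 this)
  have hF : FiniteDimensional ℂ (LinearMap.range F.toLinearMap) := by
    have hle : LinearMap.range F.toLinearMap ≤ Mᗮ.map T.toLinearMap := by
      rintro _ ⟨y, rfl⟩
      exact ⟨Mᗮ.starProjection y, Submodule.starProjection_apply_mem _ _, rfl⟩
    exact Submodule.finiteDimensional_of_le hle
  have hCnorm : ‖C‖ < ‖z‖ := by
    refine lt_of_le_of_lt (ContinuousLinearMap.opNorm_le_bound _ (sub_nonneg.2 h1) fun y => ?_)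
      (lt_of_lt_of_le (sub_lt_self 1 h0) hz1)
    change ‖T (M.starProjection y)‖ ≤ _
    set m := M.starProjection y with hm
    have hmM : m ∈ M := Submodule.starProjection_apply_mem _ _
    have hm' : Q' m = 0 := hmM
    have hQ1 : Q m = 0 := congrArg Prod.fst hm'
    have hQ2 : Q (V m) = 0 := congrArg Prod.snd hm'
    have hTm : T m = ((1 - ε : ℝ) : ℂ) • V m := by
      have h3 : m - (ε : ℂ) • m = ((1 - ε : ℝ) : ℂ) • m := by
        push_cast
        module
      rw [hT, hD, gramOp_of_eq_zero Q hQ1, h3, map_smul]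
    have hVm : ‖V m‖ = ‖m‖ := by
      have h2 := hV m
      rw [indef, indef, hQ1, hQ2] at h2
      simp only [norm_zero] at h2
      have h3 : ‖V m‖ ^ 2 = ‖m‖ ^ 2 := by linarith
      exact (sq_eq_sq₀ (norm_nonneg _) (norm_nonneg _)).1 h3
    rw [hTm, norm_smul, hVm, Complex.norm_real, Real.norm_of_nonneg (sub_nonneg.2 h1)]
    refine mul_le_mul_of_nonneg_left ?_ (sub_nonneg.2 h1)
    exact M.norm_starProjection_apply_le y
  rw [hCF] at hz
  obtain ⟨y, hy0, hy⟩ := exists_eigenvector_of_mem_spectrum hF hCnorm hz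
  rw [← hCF] at hy
  -- If the form were positive at y, |z| ≥ 1 and the decrease under T would force Gy = 0, and then
  -- the form (Gy, y) is zero.
  have hyq : indef Q y ≤ 0 := by
    by_contra! hpos
    have h2 := hTq y
    rw [hy, indef_smul] at h2
    have h3 : 1 ≤ ‖z‖ ^ 2 := by nlinarith
    have h4 : ‖gramOp Q y‖ ^ 2 ≤ 0 := by
      by_contra! h5
      nlinarith [mul_pos h0 h5]
    have h5 : gramOp Q y = 0 := by
      have := le_antisymm h4 (sq_nonneg _)
      exact norm_eq_zero.1 (pow_eq_zero_iff two_ne_zero |>.1 this)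
    have h6 := indef_eq Q y
    rw [h5, inner_zero_left] at h6
    have h7 : indef Q y = 0 := by exact_mod_cast h6.symm
    linarith
  have hny : ‖y‖ ≠ 0 := norm_ne_zero_iff.2 hy0
  refine ⟨((‖y‖⁻¹ : ℝ) : ℂ) • y, ?_, ?_, z, ?_⟩
  · rw [norm_smul, Complex.norm_real, norm_inv, norm_norm, inv_mul_cancel₀ hny]
  · rw [indef_smul]
    exact mul_nonpos_of_nonneg_of_nonpos (sq_nonneg _) hyq
  · rw [← hD, map_smul, map_smul, ← hT, hy, smul_comm]

omit hV in
/-- Bounded families have weak limits along ultrafilters. -/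
theorem exists_weak_limit {ι : Type*} (U : Ultrafilter ι) (y : ι → X) {C : ℝ}
    (hy : ∀ i, ‖y i‖ ≤ C) :
    ∃ a : X, ∀ w, Filter.Tendsto (fun i => ⟪y i, w⟫_ℂ) U (nhds ⟪a, w⟫_ℂ) := by
  have hc := WeakDual.isCompact_closedBall (𝕜 := ℂ) (E := X) 0 C
  let φ : ι → WeakDual ℂ X := fun i =>
    StrongDual.toWeakDual (InnerProductSpace.toDual ℂ X (y i))
  obtain ⟨a, -, ha⟩ := hc.ultrafilter_le_nhds' (U.map φ) (by
    refine Filter.mem_map.2 (Filter.Eventually.of_forall fun i => ?_)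
    simpa [φ] using hy i)
  refine ⟨(InnerProductSpace.toDual ℂ X).symm (WeakDual.toStrongDual a), fun w => ?_⟩
  rw [InnerProductSpace.toDual_symm_apply]
  have h1 : Filter.Tendsto φ U (nhds a) := ha
  exact ((WeakDual.eval_continuous w).tendsto a).comp h1

/-- An isometry of an indefinite form with finitely many negative squares has a nonpositive
eigenvector, if there is a negative vector. -/
theorem exists_eigenvector_of_neg {x : X} (hx : indef Q x < 0) :
    ∃ y : X, y ≠ 0 ∧ indef Q y ≤ 0 ∧ ∃ z : ℂ, V y = z • y := by
  let ε : ℕ → ℝ := fun n => 1 / ((n : ℝ) + 1)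
  have hε0 : ∀ n, 0 < ε n := fun n => Nat.one_div_pos_of_nat
  have hε1 : ∀ n, ε n ≤ 1 := fun n => by
    have : (1 : ℝ) ≤ n + 1 := by linarith [(Nat.cast_nonneg n : (0 : ℝ) ≤ n)]
    exact div_le_one_of_le₀ this (by positivity)
  choose y hy1 hyq z hyz using fun n => exists_perturbed_eigenvector Q hV (hε0 n) (hε1 n) hx
  let U : Ultrafilter ℕ := Filter.hyperfilter ℕ
  have hU : (U : Filter ℕ) ≤ Filter.atTop := Nat.hyperfilter_le_atTop
  have hεU : Filter.Tendsto ε U (nhds 0) := tendsto_one_div_add_atTop_nhds_zero_nat.mono_left hU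
  obtain ⟨a, ha⟩ := exists_weak_limit U y (fun n => (hy1 n).le)
  have hzb : ∀ n, ‖z n‖ ≤ ‖V‖ * (1 + ‖gramOp Q‖) := fun n => by
    have h1 : ‖z n‖ = ‖V (y n - (ε n : ℂ) • gramOp Q (y n))‖ := by
      rw [hyz, norm_smul, hy1, mul_one]
    rw [h1]
    refine (V.le_opNorm _).trans (mul_le_mul_of_nonneg_left ?_ (norm_nonneg _))
    refine (norm_sub_le _ _).trans ?_
    rw [hy1, norm_smul, Complex.norm_real, Real.norm_of_nonneg (hε0 n).le]
    have h2 := (gramOp Q).le_opNorm (y n)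
    rw [hy1, mul_one] at h2
    nlinarith [hε0 n, hε1 n, norm_nonneg (gramOp Q (y n))]
  obtain ⟨c, -, hc⟩ := (isCompact_closedBall (0 : ℂ) (‖V‖ * (1 + ‖gramOp Q‖))).ultrafilter_le_nhds'
    (U.map z) (Filter.mem_map.2 (Filter.Eventually.of_forall fun n => by simpa using hzb n))
  have hc' : Filter.Tendsto z U (nhds c) := hc
  have hQb : ∀ n, ‖Q (y n)‖ ≤ ‖Q‖ := fun n => by
    have := Q.le_opNorm (y n)
    rwa [hy1, mul_one] at this
  have : CompleteSpace E := FiniteDimensional.complete ℂ E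
  have : ProperSpace E := FiniteDimensional.proper ℂ E
  obtain ⟨e, -, he⟩ := (isCompact_closedBall (0 : E) ‖Q‖).ultrafilter_le_nhds'
    (U.map (fun n => Q (y n)))
    (Filter.mem_map.2 (Filter.Eventually.of_forall fun n => by simpa using hQb n))
  have he' : Filter.Tendsto (fun n => Q (y n)) U (nhds e) := he
  -- The range of Q is finite dimensional, so the weak limit of the eigenvectors is a norm limit
  -- after applying Q.
  have hQe : Q a = e := by
    refine ext_inner_right ℂ fun v => ?_
    have h1 := ha (ContinuousLinearMap.adjoint Q v)
    simp only [ContinuousLinearMap.adjoint_inner_right] at h1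
    exact tendsto_nhds_unique h1 (he'.inner tendsto_const_nhds)
  -- Nonpositivity of unit vectors is a lower bound on Qy_n and survives the limit. It shows that a
  -- ≠ 0 and, with ‖a‖ ≤ 1, that a is nonpositive.
  have hQa : 1 ≤ 2 * ‖Q a‖ ^ 2 := by
    have h1 : ∀ n, 1 ≤ 2 * ‖Q (y n)‖ ^ 2 := fun n => by
      have := hyq n
      rw [indef, hy1] at this
      linarith
    rw [hQe]
    exact ge_of_tendsto' ((he'.norm.pow 2).const_mul 2) h1
  have hna : ‖a‖ ≤ 1 := by
    have h1 := (ha a).norm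
    have h2 : ‖⟪a, a⟫_ℂ‖ ≤ ‖a‖ := by
      refine le_of_tendsto' h1 fun n => ?_
      have := norm_inner_le_norm (𝕜 := ℂ) (y n) a
      rwa [hy1, one_mul] at this
    rw [inner_self_eq_norm_sq_to_K] at h2
    have h3 : ‖a‖ ^ 2 ≤ ‖a‖ := by simpa using h2
    by_contra! h4
    nlinarith
  refine ⟨a, ?_, ?_, c, ?_⟩
  · rintro rfl
    rw [map_zero, norm_zero] at hQa
    norm_num at hQa
  · rw [indef]
    nlinarith [norm_nonneg a]
  · refine ext_inner_right ℂ fun w => ?_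
    set v := ContinuousLinearMap.adjoint V w with hv
    have h1 : ∀ n, ⟪y n, v⟫_ℂ - (ε n : ℂ) * ⟪gramOp Q (y n), v⟫_ℂ = conj (z n) * ⟪y n, w⟫_ℂ := by
      intro n
      have h2 : ⟪V (y n - (ε n : ℂ) • gramOp Q (y n)), w⟫_ℂ = ⟪z n • y n, w⟫_ℂ := by rw [hyz]
      rw [← ContinuousLinearMap.adjoint_inner_right, ← hv, inner_sub_left, inner_smul_left,
        inner_smul_left, Complex.conj_ofReal] at h2
      exact h2
    have h3 : Filter.Tendsto (fun n => ⟪y n, v⟫_ℂ - (ε n : ℂ) * ⟪gramOp Q (y n), v⟫_ℂ) U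
        (nhds ⟪a, v⟫_ℂ) := by
      have h4 : Filter.Tendsto (fun n => (ε n : ℂ) * ⟪gramOp Q (y n), v⟫_ℂ) U (nhds 0) := by
        have h6 := hεU.mul_const (‖gramOp Q‖ * ‖v‖)
        rw [zero_mul] at h6
        refine squeeze_zero_norm (fun n => ?_) h6
        rw [norm_mul, Complex.norm_real, Real.norm_of_nonneg (hε0 n).le]
        refine mul_le_mul_of_nonneg_left ?_ (hε0 n).le
        have h5 := (gramOp Q).le_opNorm (y n)
        rw [hy1, mul_one] at h5
        exact (norm_inner_le_norm _ _).trans (mul_le_mul_of_nonneg_right h5 (norm_nonneg _))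
      simpa using (ha v).sub h4
    have h7 : Filter.Tendsto (fun n => conj (z n) * ⟪y n, w⟫_ℂ) U (nhds (conj c * ⟪a, w⟫_ℂ)) :=
      ((Complex.continuous_conj.tendsto c).comp hc').mul (ha w)
    rw [inner_smul_left, ← ContinuousLinearMap.adjoint_inner_right, ← hv]
    exact tendsto_nhds_unique h3 (h7.congr fun n => (h1 n).symm)

/-- An isometry of an indefinite form with finitely many negative squares has a nonpositive
eigenvector, if there is a nonpositive vector. -/
theorem exists_nonpos_eigenvector {x : X} (hx0 : x ≠ 0) (hx : indef Q x ≤ 0) :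
    ∃ y : X, y ≠ 0 ∧ indef Q y ≤ 0 ∧ ∃ z : ℂ, V y = z • y := by
  by_cases hneg : ∃ w, indef Q w < 0
  · obtain ⟨w, hw⟩ := hneg
    exact exists_eigenvector_of_neg Q hV hw
  push Not at hneg
  -- For a nonnegative form a null vector is a minimum, hence in the kernel of the Gram operator.
  -- This kernel is V-invariant and finite dimensional, as Q is injective on it.
  have hker : ∀ w, indef Q w ≤ 0 → gramOp Q w = 0 := by
    intro w hw
    have h1 := indef_sub_smul_le Q zero_le_one le_rfl w
    have h2 := hneg (w - ((1 : ℝ) : ℂ) • gramOp Q w)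
    have h3 : ‖gramOp Q w‖ ^ 2 = 0 := le_antisymm (by linarith) (sq_nonneg _)
    exact norm_eq_zero.1 (pow_eq_zero_iff two_ne_zero |>.1 h3)
  have hker' : ∀ w, gramOp Q w = 0 → indef Q w ≤ 0 := by
    intro w hw
    have h1 := indef_eq Q w
    rw [hw, inner_zero_left] at h1
    have h2 : indef Q w = 0 := by exact_mod_cast h1.symm
    exact h2.le
  let N : Submodule ℂ X := LinearMap.ker (gramOp Q).toLinearMap
  have hVN : ∀ w ∈ N, V.toLinearMap w ∈ N := fun w hw =>
    hker _ ((hV w).le.trans (hker' w hw))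
  have hfin : FiniteDimensional ℂ N := by
    refine FiniteDimensional.of_injective (Q.toLinearMap ∘ₗ N.subtype) ?_
    rw [injective_iff_map_eq_zero]
    intro w hw
    have h1 : gramOp Q w = w := gramOp_of_eq_zero Q hw
    have h2 : gramOp Q w = 0 := w.2
    exact Subtype.ext (h1.symm.trans h2)
  have : Nontrivial N := ⟨⟨x, hker x hx⟩, 0, fun h => hx0 (congrArg Subtype.val h)⟩
  obtain ⟨z, hz⟩ := Module.End.exists_eigenvalue (V.toLinearMap.restrict hVN : Module.End ℂ N)
  obtain ⟨y, hy, hy0⟩ := hz.exists_hasEigenvector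
  rw [Module.End.mem_eigenspace_iff] at hy
  exact ⟨y, fun h => hy0 (Subtype.ext h), hker' _ y.2, z, congrArg Subtype.val hy⟩

end Pontryagin

end

section

open Matrix

/-! ### Negative subspaces and negative squares -/

section NegativeSubspaces

variable {H : Type*} [NormedAddCommGroup H] [InnerProductSpace ℂ H] [CompleteSpace H]
variable (S : FundamentalSymmetry H)

namespace FundamentalSymmetry

/-- The negative eigenspace of the fundamental symmetry. -/
abbrev negSpace : Submodule ℂ H := LinearMap.ker (S.J + 1 : H →L[ℂ] H).toLinearMap

instance : FiniteDimensional ℂ S.negSpace := S.finite_neg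

theorem mem_negSpace {x : H} : x ∈ S.negSpace ↔ S.J x = -x := by
  rw [LinearMap.mem_ker]
  exact add_eq_zero_iff_eq_neg

/-- The orthogonal projection onto the negative eigenspace. -/
def negProj : H →L[ℂ] S.negSpace := S.negSpace.orthogonalProjectionOnto

theorem negProj_coe (x : H) : (S.negProj x : H) = (1 / 2 : ℂ) • (x - S.J x) := by
  refine Submodule.eq_starProjection_of_mem_of_inner_eq_zero ?_ fun w hw => ?_
  · rw [mem_negSpace, map_smul, map_sub, S.invol]
    module
  · have h1 := S.symm w x
    rw [S.mem_negSpace.1 hw, inner_neg_left] at h1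
    have h2 : x - (1 / 2 : ℂ) • (x - S.J x) = (1 / 2 : ℂ) • (x + S.J x) := by module
    rw [h2, inner_smul_left, ← inner_conj_symm, inner_add_right, ← h1]
    simp

theorem J_eq (x : H) : S.J x = x - (2 : ℂ) • (S.negProj x : H) := by
  rw [negProj_coe]
  module

theorem re_ip_self (x : H) : (S.ip x x).re = indef S.negProj x := by
  have h1 : ⟪(S.negProj x : H), x⟫_ℂ = (‖S.negProj x‖ : ℂ) ^ 2 := by
    rw [← S.negSpace.inner_orthogonalProjectionOnto_eq_of_mem_left (S.negProj x) x]
    exact inner_self_eq_norm_sq_to_K _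
  rw [ip, J_eq, inner_sub_left, inner_smul_left, h1, inner_self_eq_norm_sq_to_K, indef,
    Complex.conj_ofNat]
  have h2 : (‖x‖ : ℂ) ^ 2 - 2 * (‖S.negProj x‖ : ℂ) ^ 2 =
      ((‖x‖ ^ 2 - 2 * ‖S.negProj x‖ ^ 2 : ℝ) : ℂ) := by push_cast; rfl
  exact (congrArg Complex.re h2).trans (Complex.ofReal_re _)

/-- The projection onto the negative eigenspace is injective on a nonpositive subspace: a vector in
its kernel satisfies [x, x] = ‖x‖². -/
theorem finrank_le_negIndex {N : Submodule ℂ H} (hN : ∀ x ∈ N, (S.ip x x).re ≤ 0) :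
    Module.finrank ℂ N ≤ S.negIndex := by
  refine LinearMap.finrank_le_finrank_of_injective (f := S.negProj.toLinearMap ∘ₗ N.subtype) ?_
  rw [injective_iff_map_eq_zero]
  intro x hx
  have h1 := hN x x.2
  have h2 : S.negProj (x : H) = 0 := hx
  rw [re_ip_self, indef, h2, norm_zero] at h1
  have h3 : ‖(x : H)‖ = 0 := by nlinarith [sq_nonneg ‖(x : H)‖]
  exact Subtype.ext (norm_eq_zero.1 h3)

theorem ip_sum_left {ι : Type*} (s : Finset ι) (f : ι → H) (g : H) :
    S.ip (∑ i ∈ s, f i) g = ∑ i ∈ s, S.ip (f i) g := inner_sum _ _ _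

theorem ip_sum_right {ι : Type*} (s : Finset ι) (f : H) (g : ι → H) :
    S.ip f (∑ i ∈ s, g i) = ∑ i ∈ s, S.ip f (g i) := by
  rw [ip, map_sum, sum_inner]
  rfl

/-! ### Inertia of Gram matrices -/

/-- The Gram matrix `([y_j, y_k])`. -/
def gram {n : ℕ} (y : Fin n → H) : Matrix (Fin n) (Fin n) ℂ := Matrix.of fun j k => S.ip (y j) (y k)

theorem gram_isHermitian {n : ℕ} (y : Fin n → H) : (S.gram y).IsHermitian :=
  Matrix.IsHermitian.ext fun _ _ => S.conj_ip _ _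

/-- Orthogonal vectors that diagonalize the Gram matrix. -/
theorem exists_diagonal {n : ℕ} (y : Fin n → H) (hM : (S.gram y).IsHermitian) :
    ∃ e : Fin n → H, (∀ i j, S.ip (e i) (e j) = if i = j then (hM.eigenvalues j : ℂ) else 0) ∧
      ∀ k, y k ∈ Submodule.span ℂ (Set.range e) := by
  let v := hM.eigenvectorBasis
  refine ⟨fun i => ∑ k, conj (v i k) • y k, fun i j => ?_, fun k => ?_⟩
  · have h1 : ∀ k, ∑ l, v j l * S.ip (y k) (y l) = hM.eigenvalues j * v j k := fun k => by
      have h2 := congrFun (hM.mulVec_eigenvectorBasis j) k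
      rw [mulVec, dotProduct] at h2
      refine Eq.trans (Finset.sum_congr rfl fun l _ => mul_comm _ _) h2
    have h2 := orthonormal_iff_ite.1 v.orthonormal i j
    rw [PiLp.inner_apply] at h2
    have h3 : ∀ k, S.ip (conj (v i k) • y k) (∑ l, conj (v j l) • y l) =
        hM.eigenvalues j * ⟪v i k, v j k⟫_ℂ := fun k => by
      rw [ip_smul_left, ip_sum_right]
      simp only [ip_smul_right, Complex.conj_conj, h1]
      rw [RCLike.inner_apply]
      ring
    rw [ip_sum_left]
    rw [Finset.sum_congr rfl fun k _ => h3 k, ← Finset.mul_sum, h2]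
    simp
  · have h1 : y k = ∑ i, v i k • ∑ l, conj (v i l) • y l := by
      simp only [Finset.smul_sum, smul_smul]
      rw [Finset.sum_comm]
      simp only [← Finset.sum_smul]
      have h2 : ∀ l, ∑ i, v i k * conj (v i l) = if k = l then 1 else 0 := fun l => by
        have h3 := v.sum_inner_mul_inner (EuclideanSpace.single k 1) (EuclideanSpace.single l 1)
        simpa [EuclideanSpace.inner_single_left, EuclideanSpace.inner_single_right, Pi.single_apply,
          eq_comm] using h3
      simp [h2]
    rw [h1]
    exact Submodule.sum_mem _ fun i _ => Submodule.smul_mem _ _ (Submodule.subset_span ⟨i, rfl⟩)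

theorem ip_sum_smul_of_diagonal {ι : Type*} [Fintype ι] [DecidableEq ι] {e : ι → H} {μ : ι → ℝ}
    (he : ∀ i j, S.ip (e i) (e j) = if i = j then (μ j : ℂ) else 0) (a : ι → ℂ) :
    (∀ j, S.ip (∑ i, a i • e i) (e j) = a j * μ j) ∧
      (S.ip (∑ i, a i • e i) (∑ i, a i • e i)).re = ∑ i, μ i * ‖a i‖ ^ 2 := by
  have h1 : ∀ j, S.ip (∑ i, a i • e i) (e j) = a j * μ j := fun j => by
    rw [ip_sum_left]
    simp [ip_smul_left, he]
  refine ⟨h1, ?_⟩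
  rw [ip_sum_right, Complex.re_sum]
  refine Finset.sum_congr rfl fun j _ => ?_
  rw [ip_smul_right, h1]
  have h2 : conj (a j) * (a j * μ j) = ((μ j * ‖a j‖ ^ 2 : ℝ) : ℂ) := by
    push_cast
    rw [← Complex.conj_mul']
    ring
  rw [h2, Complex.ofReal_re]

/-- The diagonalizing combinations that belong to negative eigenvalues are independent and span a
negative subspace. -/
theorem negEigenvalues_le {n : ℕ} (y : Fin n → H) (hM : (S.gram y).IsHermitian) :
    negEigenvalues hM ≤ S.negIndex := by
  classical
  obtain ⟨e, he, -⟩ := S.exists_diagonal y hM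
  let ι := {i // hM.eigenvalues i < 0}
  let e' : ι → H := fun i => e i
  have he' : ∀ i j : ι, S.ip (e' i) (e' j) = if i = j then (hM.eigenvalues j : ℂ) else 0 :=
    fun i j => by rw [he]; exact if_congr Subtype.ext_iff.symm rfl rfl
  let Φ : (ι → ℂ) →ₗ[ℂ] H := Fintype.linearCombination ℂ e'
  have hΦ : ∀ a, (S.ip (Φ a) (Φ a)).re = ∑ i : ι, hM.eigenvalues i * ‖a i‖ ^ 2 :=
    fun a => (S.ip_sum_smul_of_diagonal he' a).2
  have hinj : Function.Injective Φ := by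
    rw [injective_iff_map_eq_zero]
    intro a ha
    have h1 := fun j => (S.ip_sum_smul_of_diagonal he' a).1 j
    funext j
    have h2 := h1 j
    have h3 : ∑ i, a i • e' i = 0 := ha
    rw [h3, ip_zero_left] at h2
    have h4 : ((hM.eigenvalues j : ℝ) : ℂ) ≠ 0 := by exact_mod_cast j.2.ne
    exact (mul_eq_zero.1 h2.symm).resolve_right h4
  have h1 : negEigenvalues hM = Module.finrank ℂ (LinearMap.range Φ) := by
    rw [LinearMap.finrank_range_of_inj hinj, Module.finrank_fintype_fun_eq_card, negEigenvalues,
      Fintype.card_subtype]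
  rw [h1]
  refine S.finrank_le_negIndex ?_
  rintro _ ⟨a, rfl⟩
  rw [hΦ]
  exact Finset.sum_nonpos fun i _ => mul_nonpos_of_nonpos_of_nonneg i.2.le (sq_nonneg _)

/-- Sylvester's argument: a vector of W orthogonal to all diagonal vectors with negative eigenvalue
has nonnegative form, so it is zero. -/
theorem finrank_le_negEigenvalues {n : ℕ} (y : Fin n → H) (hM : (S.gram y).IsHermitian)
    {W : Submodule ℂ H} (hW : W ≤ Submodule.span ℂ (Set.range y))
    (hneg : ∀ x ∈ W, x ≠ 0 → (S.ip x x).re < 0) : Module.finrank ℂ W ≤ negEigenvalues hM := by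
  classical
  obtain ⟨e, he, hy⟩ := S.exists_diagonal y hM
  let ι := {i // hM.eigenvalues i < 0}
  have hWe : W ≤ Submodule.span ℂ (Set.range e) :=
    hW.trans (Submodule.span_le.2 (by rintro _ ⟨k, rfl⟩; exact hy k))
  let Ψ : W →ₗ[ℂ] (ι → ℂ) := LinearMap.pi fun i =>
    ((innerSL ℂ (S.J (e i))).toLinearMap ∘ₗ W.subtype)
  have hΨ : ∀ (w : W) (i : ι), Ψ w i = S.ip w (e i) := fun _ _ => rfl
  have h1 : negEigenvalues hM = Module.finrank ℂ (ι → ℂ) := by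
    rw [Module.finrank_fintype_fun_eq_card, negEigenvalues, Fintype.card_subtype]
  rw [h1]
  refine LinearMap.finrank_le_finrank_of_injective (f := Ψ) ?_
  rw [injective_iff_map_eq_zero]
  intro w hw
  obtain ⟨a, ha⟩ := (Submodule.mem_span_range_iff_exists_fun ℂ).1 (hWe w.2)
  obtain ⟨h2, h3⟩ := S.ip_sum_smul_of_diagonal he a
  rw [ha] at h2 h3
  by_contra hw0
  have h4 := hneg w w.2 fun h => hw0 (Subtype.ext h)
  rw [h3] at h4
  refine absurd h4 (not_lt.2 (Finset.sum_nonneg fun i _ => ?_))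
  by_cases hi : hM.eigenvalues i < 0
  · have h5 : S.ip w (e i) = 0 := by rw [← hΨ w ⟨i, hi⟩, hw]; rfl
    rw [h2] at h5
    have h6 : ((hM.eigenvalues i : ℝ) : ℂ) ≠ 0 := by exact_mod_cast hi.ne
    rw [(mul_eq_zero.1 h5).resolve_right h6]
    simp
  · exact mul_nonneg (not_lt.1 hi) (sq_nonneg _)

/-- A factorized kernel has `κ` negative squares, if the factors span a subspace with a negative
definite subspace of dimension `κ`. -/
theorem hasNegSquares_of_factorization {m : Type*} [Fintype m] {K : ℂ → ℂ → Matrix m m ℂ}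
    {Ω : Set ℂ} (g : ℂ → (m → ℂ) → H)
    (hK : ∀ ω ∈ Ω, ∀ lam ∈ Ω, ∀ a b, star a ⬝ᵥ (K ω lam *ᵥ b) = S.ip (g ω b) (g lam a))
    (hΩ : Ω.Nonempty) {W : Submodule ℂ H} [FiniteDimensional ℂ W]
    (hWg : W ≤ Submodule.span ℂ {x | ∃ ω ∈ Ω, ∃ b, x = g ω b})
    (hneg : ∀ x ∈ W, x ≠ 0 → (S.ip x x).re < 0) (hW : Module.finrank ℂ W = S.negIndex) :
    HasNegSquares K Ω S.negIndex := by
  classical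
  have hgram : ∀ (n : ℕ) (ω : Fin n → ℂ) (x : Fin n → m → ℂ), (∀ j, ω j ∈ Ω) →
      gramMatrix K ω x = S.gram fun j => g (ω j) (x j) := by
    intro n ω x hω
    ext j k
    exact hK _ (hω j) _ (hω k) _ _
  refine ⟨fun ω hω lam hlam => ext_form fun a b => ?_, fun n ω x hω => ?_, ?_⟩
  · rw [← conj_form, hK ω hω lam hlam, hK lam hlam ω hω]
    exact S.conj_ip _ _
  · rw [hgram n ω x hω]
    exact ⟨S.gram_isHermitian _, S.negEigenvalues_le _ _⟩
  · obtain ⟨t, ht⟩ := IsNoetherian.noetherian (⊤ : Submodule ℂ W)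
    have hfin : ∃ s : Finset H, (s : Set H) ⊆ {x | ∃ ω ∈ Ω, ∃ b, x = g ω b} ∧ s.Nonempty ∧
        W ≤ Submodule.span ℂ (s : Set H) := by
      have h1 : ∀ x : W, ∃ s : Finset H, (s : Set H) ⊆ {x | ∃ ω ∈ Ω, ∃ b, x = g ω b} ∧
          (x : H) ∈ Submodule.span ℂ (s : Set H) := fun x =>
        Submodule.mem_span_finite_of_mem_span (hWg x.2)
      choose s hs hxs using h1
      obtain ⟨ω0, hω0⟩ := hΩ
      -- The additional vector keeps the list nonempty when W is trivial, as `HasNegSquares` demands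
      -- 0 < n.
      refine ⟨insert (g ω0 0) (t.biUnion s), ?_, Finset.insert_nonempty _ _, ?_⟩
      · rw [Finset.coe_insert, Set.insert_subset_iff]
        refine ⟨⟨ω0, hω0, 0, rfl⟩, ?_⟩
        intro y hy
        obtain ⟨x, -, hx⟩ := Finset.mem_biUnion.1 (Finset.mem_coe.1 hy)
        exact hs x hx
      · have h2 : W = (Submodule.span ℂ (t : Set W)).map W.subtype := by
          rw [ht, Submodule.map_top, Submodule.range_subtype]
        refine h2.le.trans ?_
        rw [Submodule.map_span, Submodule.span_le]
        rintro _ ⟨x, hx, rfl⟩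
        refine Submodule.span_mono ?_ (hxs x)
        intro y hy
        exact Finset.mem_insert_of_mem (Finset.mem_biUnion.2 ⟨x, hx, hy⟩)
    obtain ⟨s, hs, hs0, hWs⟩ := hfin
    let y : Fin s.card → H := fun j => s.equivFin.symm j
    have hy : ∀ j, ∃ ω ∈ Ω, ∃ b, y j = g ω b := fun j => hs (s.equivFin.symm j).2
    choose ω hω b hb using hy
    have hyr : (s : Set H) ⊆ Set.range y := fun x hx =>
      ⟨s.equivFin ⟨x, hx⟩, by simp [y]⟩
    refine ⟨s.card, ω, b, hs0.card_pos, hω, ?_⟩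
    rw [hgram _ ω b hω]
    have hyg : (fun j => g (ω j) (b j)) = y := funext fun j => (hb j).symm
    rw [hyg]
    refine ⟨S.gram_isHermitian y, le_antisymm (S.negEigenvalues_le _ _) ?_⟩
    rw [← hW]
    exact S.finrank_le_negEigenvalues y _ (hWs.trans (Submodule.span_mono hyr)) hneg

/-! ### Negative subspaces from positive orthogonal complements -/

/-- The `[·, ·]`-projection onto the closed subspace `N` of a negative vector is negative, if the
`[·, ·]`-orthogonal complement of `N` is positive. -/
theorem exists_negative_map {N : Submodule ℂ H} (hN : IsClosed (N : Set H))
    (hpos : ∀ x, (∀ n ∈ N, S.ip x n = 0) → x ≠ 0 → 0 < (S.ip x x).re) :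
    ∃ φ : S.negSpace →ₗ[ℂ] H, (∀ x, φ x ∈ N) ∧ ∀ x, (S.ip (φ x) (φ x)).re ≤ -‖x‖ ^ 2 := by
  have : CompleteSpace N := hN.completeSpace_coe
  let P : H →ₗ[ℂ] N := N.orthogonalProjectionOnto.toLinearMap
  have hP : ∀ (x : H) (n : N), ⟪P x, n⟫_ℂ = ⟪x, (n : H)⟫_ℂ := fun x n =>
    N.inner_orthogonalProjectionOnto_eq_of_mem_right n x
  have hPN : ∀ n : N, P n = n := fun n => N.orthogonalProjectionOnto_mem_subspace_eq_self n
  have horth : ∀ x, P (S.J x) = 0 → ∀ n ∈ N, S.ip x n = 0 := fun x hx n hn => by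
    rw [← S.conj_ip, ip, ← hP _ ⟨n, hn⟩, hx, inner_zero_left, map_zero]
  have hnn : ∀ x, 0 ≤ (S.ip x x).re ∨ P (S.J x) ≠ 0 := fun x => by
    by_cases h : P (S.J x) = 0
    · refine Or.inl ?_
      by_cases hx : x = 0
      · rw [hx, ip_zero_left, Complex.zero_re]
      · exact (hpos x (horth x h) hx).le
    · exact Or.inr h
  -- The compression of J to N is the identity plus this finite-rank operator. It is injective
  -- because an isotropic vector of N lies in the positive complement, hence it is invertible and
  -- yields the projection φ.
  let K : N →ₗ[ℂ] N := -((2 : ℂ) • (P ∘ₗ S.negSpace.subtype ∘ₗ S.negProj.toLinearMap ∘ₗ N.subtype))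
  have hK : ∀ n : N, (LinearMap.id + K : N →ₗ[ℂ] N) n = P (S.J n) := fun n => by
    rw [J_eq, map_sub, map_smul, hPN, sub_eq_add_neg]
    rfl
  have hfin : FiniteDimensional ℂ (LinearMap.range K) := by
    have : LinearMap.range K ≤ LinearMap.range (P ∘ₗ S.negSpace.subtype) := by
      rintro _ ⟨n, rfl⟩
      exact ⟨-((2 : ℂ) • S.negProj n), by
        rw [map_neg, map_smul]
        rfl⟩
    exact Submodule.finiteDimensional_of_le this
  have hbij := bijective_one_add_of_finiteRank hfin fun n hn => by
    have h1 : P (S.J n) = 0 := (hK n).symm.trans hn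
    by_contra h0
    have h2 := hpos n (horth n h1) fun h => h0 (Subtype.ext h)
    rw [horth n h1 n n.2] at h2
    exact lt_irrefl _ h2
  let T := LinearEquiv.ofBijective _ hbij
  let φ : S.negSpace →ₗ[ℂ] N := T.symm.toLinearMap ∘ₗ P ∘ₗ S.J.toLinearMap ∘ₗ S.negSpace.subtype
  have hφ : ∀ x : S.negSpace, P (S.J ((x : H) - φ x)) = 0 := fun x => by
    rw [map_sub, map_sub, ← hK, sub_eq_zero]
    exact (T.apply_symm_apply _).symm
  refine ⟨N.subtype ∘ₗ φ, fun x => (φ x).2, fun x => ?_⟩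
  change (S.ip (φ x) (φ x)).re ≤ _
  have h1 := horth _ (hφ x) (φ x) (φ x).2
  -- Since x - φx has nonnegative form and is orthogonal to φx, [φx, φx] ≤ [x, x] = -‖x‖².
  have h2 := (hnn ((x : H) - φ x)).resolve_right fun h => h (hφ x)
  have h3 : S.ip (φ x) ((x : H) - φ x) = 0 := by rw [← S.conj_ip, h1, map_zero]
  have h4 : S.ip ((x : H) - φ x) ((x : H) - φ x) = S.ip x x - S.ip (φ x) (φ x) := by
    have h5 : S.ip (x : H) (φ x) = S.ip (φ x) (φ x) := by
      rw [← sub_eq_zero, ← S.ip_sub_left, h1]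
    rw [S.ip_sub_left, h3, S.ip_sub_right, h5, sub_zero]
  have h5 : S.ip (x : H) x = -(‖(x : H)‖ : ℂ) ^ 2 := by
    rw [ip, S.mem_negSpace.1 x.2, inner_neg_left, inner_self_eq_norm_sq_to_K]
    rfl
  have h6 : (S.ip (x : H) x).re = -‖x‖ ^ 2 := by
    rw [h5]
    norm_cast
  rw [h4, Complex.sub_re, h6] at h2
  linarith

/-- Negative definiteness on the image is stable under small perturbations. -/
theorem re_ip_lt_zero_of_near {x y : H} {r C η : ℝ} (hx : (S.ip x x).re ≤ -r ^ 2)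
    (hxC : ‖x‖ ≤ C * r) (hxy : ‖y - x‖ ≤ η * r) (hr : 0 < r) (hη : ‖S.J‖ * (2 * C + η) * η < 1)
    (hC : 0 ≤ C) (hη0 : 0 ≤ η) : (S.ip y y).re < 0 := by
  have hip : ∀ a b : H, |(S.ip a b).re| ≤ ‖S.J‖ * ‖b‖ * ‖a‖ := fun a b =>
    (Complex.abs_re_le_norm _).trans ((norm_inner_le_norm _ _).trans
      (mul_le_mul_of_nonneg_right (S.J.le_opNorm b) (norm_nonneg _)))
  have h1 : S.ip y y = S.ip x x + S.ip (y - x) x + S.ip y (y - x) := by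
    rw [S.ip_sub_left, S.ip_sub_right]
    ring
  have h2 := le_of_abs_le (hip (y - x) x)
  have h3 := le_of_abs_le (hip y (y - x))
  have hy : ‖y‖ ≤ (C + η) * r := by
    have := norm_add_le (y - x) x
    rw [sub_add_cancel] at this
    linarith
  have hJ := norm_nonneg S.J
  have h4 : ‖S.J‖ * ‖x‖ * ‖y - x‖ ≤ ‖S.J‖ * (C * r) * (η * r) := by gcongr
  have h5 : ‖S.J‖ * ‖y - x‖ * ‖y‖ ≤ ‖S.J‖ * (η * r) * ((C + η) * r) := by gcongr
  rw [h1, Complex.add_re, Complex.add_re]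
  have h6 : 0 < (1 - ‖S.J‖ * (2 * C + η) * η) * r ^ 2 := mul_pos (sub_pos.2 hη) (by positivity)
  linarith

/-- If the `[·, ·]`-orthogonal complement of `D` is positive, then `D` contains a negative definite
subspace of the maximal dimension. -/
theorem exists_negative_subspace {D : Submodule ℂ H}
    (hpos : ∀ x, (∀ n ∈ D, S.ip x n = 0) → x ≠ 0 → 0 < (S.ip x x).re) :
    ∃ W ≤ D, FiniteDimensional ℂ W ∧ Module.finrank ℂ W = S.negIndex ∧
      ∀ x ∈ W, x ≠ 0 → (S.ip x x).re < 0 := by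
  obtain ⟨φ, hφD, hφ⟩ := S.exists_negative_map D.isClosed_topologicalClosure fun x hx hx0 =>
    hpos x (fun n hn => hx n (D.le_topologicalClosure hn)) hx0
  let C := ‖LinearMap.toContinuousLinearMap φ‖
  have hC : ∀ x, ‖φ x‖ ≤ C * ‖x‖ := fun x => (LinearMap.toContinuousLinearMap φ).le_opNorm x
  have hC0 : 0 ≤ C := norm_nonneg _
  let b := stdOrthonormalBasis ℂ S.negSpace
  set κ := Module.finrank ℂ S.negSpace with hκ
  -- Small enough for `re_ip_lt_zero_of_near`. Each image of a basis vector is moved from the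
  -- closure into D by less than η/(κ + 1), so the total error is at most η‖x‖.
  let η : ℝ := 1 / (‖S.J‖ * (2 * C + 1) + 1)
  have hden : 0 < ‖S.J‖ * (2 * C + 1) + 1 := by positivity
  have hη : 0 < η := by positivity
  have hη1 : η ≤ 1 := by
    rw [div_le_one hden]
    have : 0 ≤ ‖S.J‖ * (2 * C + 1) := by positivity
    linarith
  have hη2 : ‖S.J‖ * (2 * C + η) * η < 1 := by
    have h1 : ‖S.J‖ * (2 * C + η) ≤ ‖S.J‖ * (2 * C + 1) := by gcongr
    have h2 : (‖S.J‖ * (2 * C + 1) + 1) * η = 1 := mul_one_div_cancel hden.ne'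
    nlinarith
  have hd : ∀ i, ∃ d ∈ D, ‖d - φ (b i)‖ < η / (κ + 1) := fun i => by
    have h1 : φ (b i) ∈ closure (D : Set H) := hφD _
    obtain ⟨d, hd, h2⟩ := Metric.mem_closure_iff.1 h1 (η / (κ + 1)) (by positivity)
    refine ⟨d, hd, ?_⟩
    rwa [dist_comm, dist_eq_norm] at h2
  choose d hdD hd using hd
  let ψ : S.negSpace →ₗ[ℂ] H := b.toBasis.constr ℂ d
  have hψ : ∀ x, ψ x = ∑ i, ⟪b i, x⟫_ℂ • d i := fun x => by
    rw [Module.Basis.constr_apply_fintype]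
    refine Finset.sum_congr rfl fun i _ => ?_
    rw [← b.repr_apply_apply]
    rfl
  have hφb : ∀ x, φ x = ∑ i, ⟪b i, x⟫_ℂ • φ (b i) := fun x => by
    conv_lhs => rw [← b.sum_repr' x]
    simp
  have hdiff : ∀ x, ‖ψ x - φ x‖ ≤ η * ‖x‖ := fun x => by
    rw [hψ, hφb, ← Finset.sum_sub_distrib]
    have h1 : ∀ i ∈ Finset.univ, ‖⟪b i, x⟫_ℂ • d i - ⟪b i, x⟫_ℂ • φ (b i)‖ ≤
        ‖x‖ * (η / (κ + 1)) := fun i _ => by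
      rw [← smul_sub, norm_smul]
      have h2 := norm_inner_le_norm (𝕜 := ℂ) (b i) x
      rw [b.orthonormal.1 i, one_mul] at h2
      exact mul_le_mul h2 (hd i).le (norm_nonneg _) (norm_nonneg _)
    refine (norm_sum_le_of_le _ h1).trans ?_
    rw [Finset.sum_const, Finset.card_univ, Fintype.card_fin, nsmul_eq_mul]
    have h3 : (κ : ℝ) / (κ + 1) ≤ 1 := (div_le_one (by positivity)).2 (by linarith)
    calc (κ : ℝ) * (‖x‖ * (η / (κ + 1))) = κ / (κ + 1) * (η * ‖x‖) := by ring
      _ ≤ 1 * (η * ‖x‖) := by gcongr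
      _ = η * ‖x‖ := one_mul _
  have hneg : ∀ x, x ≠ 0 → (S.ip (ψ x) (ψ x)).re < 0 := fun x hx =>
    S.re_ip_lt_zero_of_near (hφ x) (hC x) (hdiff x) (norm_pos_iff.2 hx) hη2 hC0 hη.le
  have hinj : Function.Injective ψ := by
    rw [injective_iff_map_eq_zero]
    intro x hx
    by_contra h0
    have h1 := hneg x h0
    rw [hx, ip_zero_left] at h1
    exact lt_irrefl _ h1
  refine ⟨LinearMap.range ψ, ?_, inferInstance, ?_, ?_⟩
  · rintro _ ⟨x, rfl⟩
    rw [hψ]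
    exact Submodule.sum_mem _ fun i _ => Submodule.smul_mem _ _ (hdD i)
  · rw [LinearMap.finrank_range_of_inj hinj]
    rfl
  · rintro _ ⟨x, rfl⟩ hx
    exact hneg x fun h => hx (by rw [h, map_zero])

end FundamentalSymmetry

end NegativeSubspaces

end

section

/-! ### The number of negative squares of the kernel -/

section Positivity

variable {H : Type*} [NormedAddCommGroup H] [InnerProductSpace ℂ H] [CompleteSpace H]
variable {S : FundamentalSymmetry H}

/-- The `[·, ·]`-orthogonal complement of a subspace with the full negative index is positive. -/
theorem FundamentalSymmetry.HasNegIndex.pos {M : Submodule ℂ H}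
    (hM : S.HasNegIndex M S.negIndex) {y : H} (hy : ∀ m ∈ M, S.ip m y = 0) (hy0 : y ≠ 0) :
    0 < (S.ip y y).re := by
  by_contra! hle
  obtain ⟨N, hNM, hNfin, hNrank, hN⟩ := hM.1
  have hy' : ∀ m ∈ N, S.ip m y = 0 := fun m hm => hy m (hNM hm)
  have hdisj : Disjoint N (Submodule.span ℂ {y}) := by
    rw [Submodule.disjoint_span_singleton' hy0]
    intro hyN
    have h1 := hN y hyN hy0
    rw [hy' y hyN] at h1
    exact lt_irrefl _ h1
  have h1 := Submodule.finrank_sup_add_finrank_inf_eq N (Submodule.span ℂ {y})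
  rw [hdisj.eq_bot, finrank_bot, add_zero, finrank_span_singleton hy0, hNrank] at h1
  -- Adjoining y to a negative subspace of dimension κ would produce a nonpositive subspace of
  -- dimension κ + 1.
  have h2 := S.finrank_le_negIndex (N := N ⊔ Submodule.span ℂ {y}) fun x hx => by
    obtain ⟨m, hm, w, hw, rfl⟩ := Submodule.mem_sup.1 hx
    obtain ⟨t, rfl⟩ := Submodule.mem_span_singleton.1 hw
    have h3 : S.ip y m = 0 := by rw [← S.conj_ip, hy' m hm, map_zero]
    have h4 : S.ip (m + t • y) (m + t • y) = S.ip m m + (Complex.normSq t : ℂ) * S.ip y y := by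
      simp only [S.ip_add_left, S.ip_add_right, S.ip_smul_left, S.ip_smul_right, hy' m hm, h3,
        Complex.normSq_eq_conj_mul_self]
      ring
    rw [h4, Complex.add_re, Complex.re_ofReal_mul]
    have h5 : (S.ip m m).re ≤ 0 := by
      by_cases h0 : m = 0
      · rw [h0, S.ip_zero_left, Complex.zero_re]
      · exact (hN m hm h0).le
    have h6 := mul_nonpos_of_nonneg_of_nonpos (Complex.normSq_nonneg t) hle
    linarith
  omega

end Positivity

namespace ExtendedBoundaryTriple

variable {H : Type*} [NormedAddCommGroup H] [InnerProductSpace ℂ H] [CompleteSpace H]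
variable {S : FundamentalSymmetry H} {A : Submodule ℂ (H × H)} {p : ℕ}
variable (B : ExtendedBoundaryTriple S A p) {𝔏 : Submodule ℂ (HMinus S A)} (L : Cp p ≃L[ℂ] 𝔏)

/-! ### The common kernel of the operators 𝒢(ω) -/

omit B in
/-- The restriction of `A` to the kernel of `L^{⟨*⟩}`. -/
def gaugeKernel : Submodule ℂ (H × H) :=
  A ⊓ LinearMap.ker (Lstar L ∘L plus S A).toLinearMap

omit B in
theorem mem_gaugeKernel {x : H × H} : x ∈ gaugeKernel L ↔ x ∈ A ∧ Lstar L (plus S A x) = 0 :=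
  Iff.rfl

/-- The common kernel of the operators `𝒢(ω)`, `ω ∈ Ω`. -/
def unobservable (Ω : Set ℂ) : Submodule ℂ H := ⨅ ω ∈ Ω, LinearMap.ker (B.G L ω)

theorem mem_unobservable {Ω : Set ℂ} {x : H} :
    x ∈ B.unobservable L Ω ↔ ∀ ω ∈ Ω, B.G L ω x = 0 := by
  simp only [unobservable, Submodule.mem_iInf, LinearMap.mem_ker]

theorem isClosed_unobservable (Ω : Set ℂ) : IsClosed (B.unobservable L Ω : Set H) := by
  have h1 : (B.unobservable L Ω : Set H) = ⋂ ω ∈ Ω, {x | B.G L ω x = 0} := by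
    ext x
    simp only [SetLike.mem_coe, mem_unobservable, Set.mem_iInter, Set.mem_ofPred_eq]
  rw [h1]
  refine isClosed_biInter fun ω _ => isClosed_eq ?_ continuous_const
  exact (B.calQ L ω).continuous.neg.prodMk ((calP L ω).continuous.comp iotaL.continuous)

section

variable (hA : IsClosed (A : Set (H × H))) (hsymm : A ≤ adj S A)
  (hI : Complex.I ∈ regularPoints B.A0) {lam : ℂ}

include hA hsymm hI

theorem G_eq_of_gaugeCoord (hlam : lam ∈ gaugeRegular S A 𝔏) {x f : H}
    (hf : boldRes L lam (iota S A x) = f) (hx : gaugeCoord L lam (iota S A x) = 0) :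
    B.G L lam x = (-Lstar L (plus S A (f, x + lam • f)), 0) := by
  have h1 : B.calQ L lam x = Lstar L (plus S A (f, x + lam • f)) := by
    rw [B.calQ_eq L hA hsymm hI hlam, ContinuousLinearMap.comp_apply, B.regRes_apply,
      B.regResFst_apply, B.regResSnd_apply, hx, hf]
    simp only [map_zero, add_zero]
  have h2 : calP L lam (iota S A x) = 0 := by rw [calP_eq L hA hlam, hx]
  rw [← h1, ← h2]
  rfl

/-- 𝒫(λ)x = 0 puts x into ran (𝐀 - λ); as x lies in H, the solution belongs to A itself. Then 𝒬(λ)x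
= 0 says that L^{⟨*⟩} annihilates it. With `G_sub_eq_zero`, ker 𝒢(λ) is the range of A - λ on the
kernel of L^{⟨*⟩}. -/
theorem mem_gaugeKernel_of_G_eq_zero (hlam : lam ∈ gaugeRegular S A 𝔏) {x : H}
    (hx : B.G L lam x = 0) : (boldRes L lam (iota S A x),
      x + lam • boldRes L lam (iota S A x)) ∈ gaugeKernel L := by
  have h1 : gaugeCoord L lam (iota S A x) = 0 := by
    rw [← calP_eq L hA hlam]
    exact congrArg Prod.snd hx
  refine (mem_gaugeKernel L).2 ⟨?_, ?_⟩
  · refine mem_of_boldOp_eq_iota (S := S) hA (boldRes_mem L lam _) ?_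
    have h2 := gauge_decomp L hA hlam (iota S A x)
    rw [h1, map_zero, add_zero, sub_eq_iff_eq_add] at h2
    rw [h2, map_add, map_smul]
  · have h2 := B.G_eq_of_gaugeCoord L hA hsymm hI hlam rfl h1
    rw [hx] at h2
    exact neg_eq_zero.1 (congrArg Prod.fst h2).symm

theorem G_sub_eq_zero (hlam : lam ∈ gaugeRegular S A 𝔏) {y : H × H} (hy : y ∈ gaugeKernel L) :
    B.G L lam (y.2 - lam • y.1) = 0 := by
  obtain ⟨hyA, hyL⟩ := (mem_gaugeKernel L).1 hy
  obtain ⟨h1, h2⟩ := boldRes_iota L hA hlam hyA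
  rw [B.G_eq_of_gaugeCoord L hA hsymm hI hlam h1 h2, sub_add_cancel, hyL, neg_zero]
  rfl

/-- The common kernel is invariant under the resolvents of `A`. -/
theorem boldRes_mem_unobservable {Ω : Set ℂ} (hΩ : IsOpen Ω) (hΩA : Ω ⊆ gaugeRegular S A 𝔏)
    (hlam : lam ∈ Ω) {x : H} (hx : x ∈ B.unobservable L Ω) :
    boldRes L lam (iota S A x) ∈ B.unobservable L Ω := by
  rw [mem_unobservable] at hx ⊢
  set f := boldRes L lam (iota S A x) with hf
  have hfA := B.mem_gaugeKernel_of_G_eq_zero L hA hsymm hI (hΩA hlam) (hx lam hlam)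
  -- The resolvent identity: the difference of the solutions at λ and ω is sent by A - ω to (λ -
  -- ω)f. The excluded point ω = λ follows by continuity of 𝒢.
  have hne : ∀ ω ∈ Ω, ω ≠ lam → B.G L ω f = 0 := by
    intro ω hω hωl
    have hgA := B.mem_gaugeKernel_of_G_eq_zero L hA hsymm hI (hΩA hω) (hx ω hω)
    have h1 := B.G_sub_eq_zero L hA hsymm hI (hΩA hω) ((gaugeKernel L).sub_mem hfA hgA)
    simp only [Prod.fst_sub, Prod.snd_sub, ← hf] at h1
    have h2 : x + lam • f - (x + ω • boldRes L ω (iota S A x)) -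
        ω • (f - boldRes L ω (iota S A x)) = (lam - ω) • f := by module
    rw [h2, map_smul] at h1
    exact (smul_eq_zero.1 h1).resolve_left (sub_ne_zero.2 hωl.symm)
  intro ω hω
  by_cases hωl : ω = lam
  · subst hωl
    have h1 := (B.differentiableAt_G_apply L hA hsymm hI (hΩA hω) f).continuousAt.tendsto
    have h2 : Filter.Tendsto (fun z => B.G L z f) (nhdsWithin ω {ω}ᶜ) (nhds 0) := by
      refine tendsto_const_nhds.congr' ?_
      filter_upwards [self_mem_nhdsWithin, nhdsWithin_le_nhds (hΩ.mem_nhds hω)] with z hz hzΩ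
      exact (hne z hzΩ hz).symm
    exact tendsto_nhds_unique (h1.mono_left nhdsWithin_le_nhds) h2
  · exact hne ω hω hωl

omit hI in
/-- A vector `y` with `(a y, b y) ∈ A`, `L^{⟨*⟩} a y = 0`, is orthogonal to `H_𝔄`. -/
theorem ip_HA_eq_zero {y : H} (hy0 : y ≠ 0) {a b : ℂ} (hab : a = 0 → b ≠ 0)
    (hy : (a • y, b • y) ∈ gaugeKernel L) : ∀ m ∈ B.HA L, S.ip m y = 0 := by
  obtain ⟨hyA, hyL⟩ := (mem_gaugeKernel L).1 hy
  have hclosed : IsClosed {m : H | S.ip m y = 0} :=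
    isClosed_eq (S.continuous_ip continuous_id continuous_const) continuous_const
  refine fun m hm => closure_minimal ?_ hclosed hm
  intro m hm
  induction hm using Submodule.span_induction with
  | zero => exact S.ip_zero_left y
  | add m n _ _ h1 h2 =>
    change S.ip (m + n) y = 0
    rw [S.ip_add_left, show S.ip m y = 0 from h1, show S.ip n y = 0 from h2, add_zero]
  | smul c m _ h1 =>
    change S.ip (c • m) y = 0
    rw [S.ip_smul_left, show S.ip m y = 0 from h1, mul_zero]
  | mem m hm =>
    obtain ⟨μ, hμ, u, v, rfl⟩ := hm
    have hyA0 := B.le_A0 hsymm hyA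
    -- Otherwise y would be an eigenvector of A₀ at the regular point μ̄; a = 0 would force b = 0.
    have hne : conj b - μ * conj a ≠ 0 := by
      intro h
      have h1 : b = conj μ * a := by
        have := congrArg conj (sub_eq_zero.1 h)
        simpa using this
      have ha : a ≠ 0 := fun h0 => hab h0 (by rw [h1, h0, mul_zero])
      rw [h1, mul_smul] at hyA0
      have h2 := (B.conj_mem_regularPoints hsymm hμ).1 _ hyA0
      exact (smul_ne_zero ha hy0) h2
    have h1 := B.gamma_mem (lam := μ) u _ hyA
    simp only [S.ip_smul_left, S.ip_smul_right] at h1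
    have h2 := B.extRes0_spec hsymm hμ (gaugeMap L v) hyA0
    rw [← inner_Lstar, hyL, inner_zero_left] at h2
    simp only [S.ip_smul_right] at h2
    have h3 : (conj b - μ * conj a) * S.ip (B.gamma μ u + B.extRes0 μ (gaugeMap L v)) y = 0 := by
      rw [S.ip_add_left]
      linear_combination h2 - h1
    exact (mul_eq_zero.1 h3).resolve_left hne

/-- If `H_𝔄` has the full negative index, then the common kernel is positive. -/
theorem pos_of_mem_unobservable (hneg : S.HasNegIndex (B.HA L) S.negIndex) {Ω : Set ℂ}
    (hΩ : IsOpen Ω) (hΩA : Ω ⊆ gaugeRegular S A 𝔏) (hne : Ω.Nonempty) {x : H}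
    (hx : x ∈ B.unobservable L Ω) (hx0 : x ≠ 0) : 0 < (S.ip x x).re := by
  by_contra! hle
  -- The Cayley transform needs a nonreal point; a real point of the open set Ω is moved vertically.
  obtain ⟨ω, hω, hωim⟩ : ∃ ω ∈ Ω, ω - conj ω ≠ 0 := by
    obtain ⟨ω0, h0⟩ := hne
    by_cases him : ω0 - conj ω0 = 0
    · obtain ⟨ε, hε, hball⟩ := Metric.isOpen_iff.1 hΩ ω0 h0
      refine ⟨ω0 + (ε / 2 : ℝ) * Complex.I, hball ?_, ?_⟩
      · rw [Metric.mem_ball, dist_eq_norm, add_sub_cancel_left, norm_mul, Complex.norm_I, mul_one,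
          Complex.norm_real, Real.norm_of_nonneg (by positivity)]
        linarith
      · have h1 : ω0 + (ε / 2 : ℝ) * Complex.I - conj (ω0 + (ε / 2 : ℝ) * Complex.I) =
            (ε : ℂ) * Complex.I := by
          rw [map_add, map_mul, Complex.conj_I, Complex.conj_ofReal]
          push_cast
          linear_combination him
        rw [h1]
        exact mul_ne_zero (by exact_mod_cast hε.ne') Complex.I_ne_zero
    · exact ⟨ω0, h0, him⟩
  set c := ω - conj ω with hc
  have hcc : conj c = -c := by
    rw [hc, map_sub, Complex.conj_conj]
    ring
  let N := B.unobservable L Ω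
  have : CompleteSpace N := (B.isClosed_unobservable L Ω).completeSpace_coe
  let R : H →L[ℂ] H := boldRes L ω ∘L iotaL
  have hR : ∀ y ∈ N, R y ∈ N := fun y hy =>
    B.boldRes_mem_unobservable L hA hsymm hI hΩ hΩA hω hy
  have hRA : ∀ y ∈ N, (R y, y + ω • R y) ∈ gaugeKernel L := fun y hy =>
    B.mem_gaugeKernel_of_G_eq_zero L hA hsymm hI (hΩA hω) ((B.mem_unobservable L).1 hy ω hω)
  -- The Cayley transform f' - ωf ↦ f' - ω̄f of A, restricted to N. It preserves the form because A
  -- is symmetric.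
  let V : N →L[ℂ] N := ((ContinuousLinearMap.id ℂ H + c • R) ∘L N.subtypeL).codRestrict N
    fun y => N.add_mem y.2 (N.smul_mem c (hR y y.2))
  have hVc : ∀ y : N, (V y : H) = y + c • R y := fun _ => rfl
  let Q := S.negProj ∘L N.subtypeL
  have hQ : ∀ y : N, indef Q y = (S.ip (y : H) y).re := fun y => (S.re_ip_self (y : H)).symm
  have hV : ∀ y, indef Q (V y) = indef Q y := by
    intro y
    rw [hQ, hQ, hVc]
    have h1 := ((mem_gaugeKernel L).1 (hRA y y.2)).1
    have h2 := hsymm h1 _ h1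
    simp only [S.ip_add_left, S.ip_add_right, S.ip_smul_left, S.ip_smul_right] at h2
    congr 1
    simp only [S.ip_add_left, S.ip_add_right, S.ip_smul_left, S.ip_smul_right, hcc]
    linear_combination (-c) * h2
  obtain ⟨y, hy0, hyq, z, hz⟩ := exists_nonpos_eigenvector Q hV (x := (⟨x, hx⟩ : N))
    (fun h => hx0 (congrArg Subtype.val h)) (by rw [hQ]; exact hle)
  have hy0' : (y : H) ≠ 0 := fun h => hy0 (Subtype.ext h)
  have h1 : (y : H) + c • R y = z • (y : H) := congrArg Subtype.val hz
  have h2 : R y = ((z - 1) / c) • (y : H) := by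
    have h3 : c • R y = (z - 1) • (y : H) :=
      (eq_sub_of_add_eq' h1).trans (by module)
    rw [div_eq_inv_mul, mul_smul, ← h3, smul_smul, inv_mul_cancel₀ hωim, one_smul]
  have h3 := hRA y y.2
  rw [h2] at h3
  have h4 : (y : H) + ω • ((z - 1) / c) • (y : H) = (1 + ω * ((z - 1) / c)) • (y : H) := by module
  rw [h4] at h3
  -- The eigenvector gives (ay, by) in the gauge kernel with a = (z - 1)/c and b = 1 + ωa. The case
  -- a = 0, where b = 1, is a multivalued direction of A.
  have h5 := B.ip_HA_eq_zero L hA hsymm hy0'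
    (fun h => by rw [h, mul_zero, add_zero]; exact one_ne_zero) h3
  have h6 := hneg.pos h5 hy0'
  rw [hQ] at hyq
  exact absurd h6 (not_lt.2 hyq)

/-- The class of the resolvent matrix. -/
theorem inClassW_What (hneg : S.HasNegIndex (B.HA L) S.negIndex) {Ω : Set ℂ}
    (hΩ : IsOpen Ω) (hΩA : Ω ⊆ gaugeRegular S A 𝔏) (hne : Ω.Nonempty) :
    InClassW S.negIndex (B.What L) Ω := by
  refine ⟨hΩ, hne, fun i j z hz =>
    (B.differentiableAt_What L hA hsymm hI (hΩA hz) i j).differentiableWithinAt, ?_⟩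
  obtain ⟨W, hWD, hWfin, hWrank, hW⟩ := S.exists_negative_subspace
    (D := Submodule.span ℂ {x | ∃ ω ∈ Ω, ∃ b, x = B.Gstar L ω (pair b)}) fun x hx hx0 => by
      refine B.pos_of_mem_unobservable L hA hsymm hI hneg hΩ hΩA hne
        ((B.mem_unobservable L).2 fun ω hω => ?_) hx0
      -- Orthogonality to 𝒢(ω)^{⟨*⟩} of the vector 𝒢(ω)x itself gives ‖𝒢(ω)x‖² = 0, so x lies in the
      -- common kernel.
      obtain ⟨b, hb⟩ := pair_surjective (B.G L ω x)
      have h1 := hx _ (Submodule.subset_span ⟨ω, hω, b, rfl⟩)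
      rw [B.ip_Gstar, hb, BoundaryTriple.pairing, inner_self_eq_norm_sq_to_K,
        inner_self_eq_norm_sq_to_K] at h1
      have h2 : ‖(B.G L ω x).1‖ ^ 2 + ‖(B.G L ω x).2‖ ^ 2 = 0 := by
        refine Complex.ofReal_eq_zero.1 ?_
        push_cast
        exact h1
      refine Prod.ext (norm_eq_zero.1 ?_) (norm_eq_zero.1 ?_)
      · nlinarith [sq_nonneg ‖(B.G L ω x).1‖, sq_nonneg ‖(B.G L ω x).2‖]
      · nlinarith [sq_nonneg ‖(B.G L ω x).1‖, sq_nonneg ‖(B.G L ω x).2‖]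
  refine S.hasNegSquares_of_factorization (fun ω b => B.Gstar L ω (pair b))
    (fun ω hω lam hlam a b => ?_) hne hWD hW hWrank
  rw [B.kernelW_eq L hA hsymm hI (hΩA hlam) (hΩA hω), form_G]

end

end ExtendedBoundaryTriple

end

end

end LResolvent

/-! ### The theorem -/

theorem theorem4p12 {H : Type*} [NormedAddCommGroup H] [InnerProductSpace ℂ H] [CompleteSpace H]
    (S : FundamentalSymmetry H) (A : Submodule ℂ (H × H))
    (hclosed : IsClosed (A : Set (H × H))) (hsymm : A ≤ adj S A)
    (p : ℕ) (B : ExtendedBoundaryTriple S A p)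
    (hI : Complex.I ∈ regularPoints B.A0)
    (𝔏 : Submodule ℂ (HMinus S A)) (L : Cp p ≃L[ℂ] 𝔏)
    (hgauge : (gaugeRegular S A 𝔏).Nonempty) :
    -- `𝒬(λ) = L^{⟨*⟩} (𝐑_λ - 𝐑̂_λ Π_𝔏^λ)` for every generalized resolvent holomorphic at `λ`
    (∀ (K : Type*) [NormedAddCommGroup K] [InnerProductSpace ℂ K] [CompleteSpace K]
      (X : SelfAdjointExtension S A K), ∀ lam ∈ gaugeRegular S A 𝔏,
      lam ∈ regularPoints X.rel → (B.calQ L lam).toLinearMap = B.Qgen L X lam) ∧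
    -- (i) the factorization of the kernel
    (∀ lam ∈ gaugeRegular S A 𝔏, ∀ ω ∈ gaugeRegular S A 𝔏,
      kernelW (B.What L) ω lam = blockMat (B.G L lam ∘ₗ B.Gstar L ω)) ∧
    -- (ii) the class `𝒲_κ(J_p)`, on `ρ(A, 𝔏)` and on each of its non-empty open subsets
    (S.HasNegIndex (B.HA L) S.negIndex →
      InClassW S.negIndex (B.What L) (gaugeRegular S A 𝔏) ∧
      ∀ Ω ⊆ gaugeRegular S A 𝔏, IsOpen Ω → Ω.Nonempty →
        InClassW S.negIndex (B.What L) Ω) ∧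
    -- (iii) invertibility, and the coincidence with the `Π𝔏`-resolvent matrix
    (∀ lam ∈ gaugeRegular S A 𝔏, conj lam ∈ gaugeRegular S A 𝔏 →
      IsUnit (B.What L lam) ∧
      (lam ∈ regularPoints B.A0 → B.What L lam = B.resolventMatrix L lam)) := by
  refine ⟨?_, fun lam hlam ω hω => B.kernelW_eq L hclosed hsymm hI hlam hω, fun hneg => ?_,
    fun lam hlam hlam' => ⟨B.isUnit_What L hclosed hsymm hI hlam hlam', fun hlam0 => ?_⟩⟩
  · intro K _ _ _ X lam hlam hX
    exact B.calQ_eq_Qgen L hclosed hsymm hI hlam X hX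
  · exact ⟨B.inClassW_What L hclosed hsymm hI hneg (isOpen_gaugeRegular hclosed L) subset_rfl
      hgauge, fun Ω hΩA hΩ hne => B.inClassW_What L hclosed hsymm hI hneg hΩ hΩA hne⟩
  · exact B.What_eq_resolventMatrix L hclosed hsymm hI hlam hlam0
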